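/- Let $d\ge 7$. View the cable graph of $\mathbb Z^d$ as the union in $\mathbb R^d$ of all unit segments between nearest neighbours of $\mathbb Z^d$, equipped with the Euclidean distance (used for all distances and diameters below) and with its length measure $dx$. Brownian motion on the cable graph is the diffusion with generator $\frac12 f''$ along the edges and Kirchhoff conditions at the vertices (the outgoing derivatives of $f$ along the $2d$ adjacent edges sum to $0$); let $p_t(x,y)$ be its transition density with respect to $dx$, and let $\mathbb P^t_{x,x}$ be the law of its bridge of duration $t$ from $x$ to $x$. The Brownian loop measure is $$\mu=\int dx\int_0^\infty \frac{dt}{t}\,p_t(x,x)\,\mathbb P^t_{x,x}.$$ For an integer $N\ge 1$, the critical Brownian loop-soup in $\Lambda_N=[-N,N]^d$ is the Poisson point process with intensity $\frac12\mu$ restricted to the loops that stay in $\Lambda_N$ (roots and orientations of the loops being irrelevant). Let $a,b,c\in(0,1)$ with $c<b\le a$ and $$\nu:=(a+b)(d-2)-\bigl(d+c(d-4)\bigr)>0 .$$ Let $\mathcal E_1(a,b,c,N)$ be the event that there exists a loop $B$ in the critical Brownian loop-soup in $\Lambda_N$ and two points $x=B(i)$, $y=B(j)$ on it at distance smaller than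 $N^c$ from each other, such that the two arcs of $B$ joining $x$ and $y$ have diameter greater than $N^a$ and greater than $N^b$ respectively. Then $$P[\mathcal E_1(a,b,c,N)]=O(N^{-\nu})\qquad (N\to\infty),$$ that is, there is a constant $C=C(d,a,b,c)$ such that $P[\mathcal E_1(a,b,c,N)]\le C\,N^{-\nu}$ for all $N\ge 1$. -/

import Mathlib

open MeasureTheory ProbabilityTheory Set
open scoped ENNReal

noncomputable section

namespace Cable

/-! ### The cable graph of the lattice -/

/-- The cable graph of `ℤ^d`: the union in `ℝ^d` of all unit segments between nearest neighbours,
i.e. the points having all coordinates but (at most) one in `ℤ`. It carries the Euclidean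
distance of `ℝ^d`. -/
def cableGraph (d : ℕ) : Set (EuclideanSpace ℝ (Fin d)) :=
  {x | ∃ i : Fin d, ∀ j : Fin d, j ≠ i → ∃ k : ℤ, x j = k}

/-- The points of the cable graph, as a type. -/
abbrev Point (d : ℕ) : Type := cableGraph d

/-- The point `v + s • e_i` of the cable graph; for `s ∈ [0,1]` it runs along the
edge `(v, i)` from the vertex `v` to the vertex `v + e_i`. -/
def edgePoint {d : ℕ} (v : Fin d → ℤ) (i : Fin d) (s : ℝ) : Point d :=
  ⟨WithLp.toLp 2 (fun j => (v j : ℝ) + if j = i then s else 0),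
    i, fun j hj => ⟨v j, by simp [hj]⟩⟩

theorem continuous_edgePoint {d : ℕ} (v : Fin d → ℤ) (i : Fin d) :
    Continuous (edgePoint v i) := by
  unfold edgePoint
  refine Continuous.subtype_mk ?_ _
  refine (PiLp.continuous_toLp 2 _).comp (continuous_pi fun j => ?_)
  by_cases h : j = i <;> simp only [h, if_true, if_false] <;> fun_prop

/-- Every point of the cable graph lies on some edge `(v, i)`, so that `edgePoint`
parametrizes the whole cable graph. -/
theorem exists_edgePoint {d : ℕ} (x : Point d) :
    ∃ (v : Fin d → ℤ) (i : Fin d) (s : ℝ), s ∈ Ico (0 : ℝ) 1 ∧ edgePoint v i s = x := by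
  obtain ⟨x, i, hx⟩ := x
  refine ⟨fun j => ⌊x j⌋, i, Int.fract (x i),
    ⟨Int.fract_nonneg _, Int.fract_lt_one _⟩, Subtype.ext ?_⟩
  ext j
  by_cases h : j = i
  · subst h
    simp [edgePoint]
  · obtain ⟨k, hk⟩ := hx j h
    simp [edgePoint, h, hk]

/-- The length measure on the cable graph. -/
def lengthMeasure (d : ℕ) : Measure (Point d) :=
  Measure.sum fun e : (Fin d → ℤ) × Fin d =>
    (volume.restrict (Icc (0 : ℝ) 1)).map (edgePoint e.1 e.2)

/-! ### Brownian motion on the cable graph, through its transition density -/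

/-- The restriction of a function on the cable graph to the edge `(v, i)`, in the
arc-length coordinate. -/
def onEdge {d : ℕ} (f : Point d → ℝ) (v : Fin d → ℤ) (i : Fin d) (s : ℝ) : ℝ :=
  f (edgePoint v i s)

/-- Test functions: continuous, compactly supported, `C²` on every closed edge, and with the
outgoing derivatives along the `2 d` edges at each vertex `v` summing to zero
(Kirchhoff condition). -/
structure IsTestFunction {d : ℕ} (f : Point d → ℝ) : Prop where
  continuous : Continuous f
  compactSupport : HasCompactSupport f
  contDiffOn : ∀ v i, ContDiffOn ℝ 2 (onEdge f v i) (Icc 0 1)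
  kirchhoff : ∀ v : Fin d → ℤ,
    ∑ i, (derivWithin (onEdge f v i) (Icc 0 1) 0
      - derivWithin (onEdge f (v - Pi.single i 1) i) (Icc 0 1) 1) = 0

/-- `p t x y` is the transition density (with respect to length) of Brownian motion on the
cable graph, i.e. of the diffusion that behaves like a standard linear Brownian motion
inside the edges and chooses its excursions symmetrically among the `2 d` adjacent
edges at the vertices. Its generator is `f ↦ f'' / 2` on the functions satisfying the Kirchhoff
condition, and `p` is the (unique) continuous sub-Markovian fundamental solution of the
corresponding heat equation, in weak form. -/
structure IsHeatKernel (d : ℕ) (p : ℝ → Point d → Point d → ℝ) : Prop where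
  continuousOn : ContinuousOn (fun q : ℝ × Point d × Point d => p q.1 q.2.1 q.2.2)
    (Ioi 0 ×ˢ univ)
  nonneg : ∀ t > 0, ∀ x y, 0 ≤ p t x y
  mass_le : ∀ t > 0, ∀ x, ∫⁻ y, ENNReal.ofReal (p t x y) ∂(lengthMeasure d) ≤ 1
  forward : ∀ f : Point d → ℝ, IsTestFunction f → ∀ t > 0, ∀ x,
    ∫ y, p t x y * f y ∂(lengthMeasure d) =
      f x + ∫ r in (0 : ℝ)..t, (1 / 2) * ∑' e : (Fin d → ℤ) × Fin d,
        ∫ s in (0 : ℝ)..1, p r x (edgePoint e.1 e.2 s) *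
          iteratedDerivWithin 2 (onEdge f e.1 e.2) (Icc 0 1) s

/-! ### The Brownian loop measure -/

/-- A rooted oriented loop in the cable graph, of time-length `duration`, seen as a
continuous periodic path. -/
structure Loop (d : ℕ) where
  duration : ℝ
  duration_pos : 0 < duration
  path : ℝ → Point d
  continuous_path : Continuous path
  periodic_path : Function.Periodic path duration

/-- The σ-algebra generated by the duration and the positions at all times. -/
instance (d : ℕ) : MeasurableSpace (Loop d) :=
  MeasurableSpace.comap (fun l => (l.duration, l.path)) inferInstance

/-- `μ` is the (rooted) Brownian loop measure on the cable graph of `ℤ^d`,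
`∫ dx ∫ (dt / t) p_t(x, x) P^t_{x,x}`, where `P^t_{x,x}` is the law of the Brownian bridge of
duration `t` from `x` to `x`. It is given by its finite-dimensional marginals at the times
`0 = s_0 t < s_1 t < ⋯ < s_n t` before `s_{n+1} t = t`; the index `k + 1` in `Fin (n + 1)` is
cyclic. -/
def IsLoopMeasure (d : ℕ) (μ : Measure (Loop d)) : Prop :=
  ∃ p : ℝ → Point d → Point d → ℝ, IsHeatKernel d p ∧
    ∀ (n : ℕ) (s : Fin (n + 2) → ℝ), StrictMono s → s 0 = 0 → s (Fin.last (n + 1)) = 1 →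
    ∀ I : Set ℝ, MeasurableSet I → I ⊆ Ioi 0 →
    ∀ A : Fin (n + 1) → Set (Point d), (∀ k, MeasurableSet (A k)) →
      μ {l | l.duration ∈ I ∧ ∀ k, l.path (s k.castSucc * l.duration) ∈ A k} =
        ∫⁻ t in I, ENNReal.ofReal (1 / t) *
          ∫⁻ x, ∏ k, ENNReal.ofReal (p ((s k.succ - s k.castSucc) * t) (x k) (x (k + 1)))
            ∂(Measure.pi fun k => (lengthMeasure d).restrict (A k))

/-! ### Loop-soups -/

/-- The random countable set `ξ` is a Poisson point process with intensity `m`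
(for an `m` without atoms, so that there are no multiple points). -/
structure IsPoissonProcess {Ω S : Type*} [MeasurableSpace Ω] [MeasurableSpace S]
    (P : Measure Ω) (m : Measure S) (ξ : Ω → Set S) : Prop where
  countable : ∀ ω, (ξ ω).Countable
  measurable : ∀ A, MeasurableSet A → Measurable fun ω => (ξ ω ∩ A).encard
  poisson : ∀ A, MeasurableSet A → m A ≠ ∞ → ∀ k : ℕ,
    P {ω | (ξ ω ∩ A).encard = k} =
      ENNReal.ofReal (Real.exp (-(m A).toReal) * (m A).toReal ^ k / k.factorial)
  indep : ∀ (n : ℕ) (A : Fin n → Set S), (∀ i, MeasurableSet (A i)) →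
    Pairwise (fun i j => Disjoint (A i) (A j)) →
      iIndepFun (fun i ω => (ξ ω ∩ A i).encard) P

/-- The loops that stay in `Λ_N = [-N, N]^d`. -/
def loopsInBox (d N : ℕ) : Set (Loop d) :=
  {l | ∀ t i, |(l.path t : EuclideanSpace ℝ (Fin d)) i| ≤ N}

/-- The random set of loops `ξ` is a critical Brownian loop-soup in the cable graph of
`Λ_N = [-N, N]^d`: a Poisson point process with intensity one half of the (oriented)
Brownian loop measure, restricted to the loops that stay in `Λ_N`. The loops come with a root
and an orientation, to be forgotten. -/
def IsLoopSoup (d N : ℕ) {Ω : Type*} [MeasurableSpace Ω] (P : Measure Ω)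
    (ξ : Ω → Set (Loop d)) : Prop :=
  ∃ μ : Measure (Loop d), IsLoopMeasure d μ ∧
    IsPoissonProcess P ((1 / 2 : ℝ≥0∞) • μ.restrict (loopsInBox d N)) ξ

/-- The loop has two points `x = l.path i` and `y = l.path j` at distance smaller than `r`
such that the two arcs of the loop joining them have diameters greater than `R₁` and `R₂`
respectively. The pairs `(i, j)` and `(j, i + duration)` give the same two points and exchange
the two arcs, so this does not depend on an order of the arcs, on the root or on the
orientation. -/
def Loop.IsPinching {d : ℕ} (l : Loop d) (R₁ R₂ r : ℝ) : Prop :=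
  ∃ i j : ℝ, i ≤ j ∧ j ≤ i + l.duration ∧
    dist (l.path i) (l.path j) < r ∧
    R₁ < Metric.diam (l.path '' Icc i j) ∧
    R₂ < Metric.diam (l.path '' Icc j (i + l.duration))

/-- The event that some loop of the soup has an `(a, b, c)` pinching at scale `N`. -/
def pinchingEvent {d : ℕ} {Ω : Type*} (ξ : Ω → Set (Loop d)) (N : ℕ) (a b c : ℝ) : Set Ω :=
  {ω | ∃ l ∈ ξ ω, l.IsPinching ((N : ℝ) ^ a) ((N : ℝ) ^ b) ((N : ℝ) ^ c)}

end Cable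

end

/-!
# Pinching loops in the critical loop-soup

The number of pinching loops in the soup is a Poisson variable, so that it suffices to bound the loop
measure of the pinching loops contained in the box (`IsPoissonProcess.measure_le`,
`exists_pinching_bound`). Write `r = N ^ c`, `R₁ = N ^ a`, `R₂ = N ^ b`.

**Heat kernel.** Everything is derived from the weak form of the heat equation, by testing it against
approximate solutions of the backward equation (`IsHeatKernel.integral_le_of_backward`). Radial cutoffs
give polynomial tails of all orders (`exists_tail_bound`). A Gaussian on `ℝ^d`, with a corrector vanishing at
the vertices, solves the equation on the cable graph up to an error of relative order `s ^ (-3/2)`; an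
iteration yields the bound `t ^ (-d/2)` for the mass of cubes (`exists_transition_cube_bound`). Near a vertex,
sums of even one-dimensional heat kernels satisfy the Kirchhoff condition, which turns the bound on cubes into
the pointwise bound `p t x y ≤ C t ^ (-d/2)` (`exists_heatKernel_bound`).

**Loops with one constraint.** The positions of a loop at the points of a regular grid have a density
which is a cyclic product of heat kernels, invariant under rotation. Hence, among the loops of duration
of order `T` in the box, those which come back within distance `r` after the fraction `k / n` of their duration
have measure at most of order
`N ^ d * r ^ d * (k T / n) ^ (-d/2) * ((n - k) T / n) ^ (-d/2)`.
The condition that a part of the loop, of `w` steps, has a diameter larger than `Λ` adds the factor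
`min 1 (w T / (n Λ ^ 2)) ^ M` for any `M`, by chaining (`exists_osc_bound`).

**Pinchings.** A pinching is looked at on a grid of steps of duration of order `r ^ 2`
(`Loop.IsPinching.grid`). Up to events in which a single step is exceptionally large, two points of the grid
are at distance of order `r` and the arcs between them have diameters of order at least `R₁` and `R₂`. Three
conditions, on the two arcs and on the steps next to the pinching, are imposed at the same time; as each
of them alone gives a bound by an arbitrary power, the geometric mean of the three bounds serves for their
conjunction (`le_ofReal_mul_of_le_cubes`), and no independence is needed. In the sum over the durations, the arcs
take about `R₁ ^ 2` and `R₂ ^ 2` units of time, and the total is of order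
`N ^ d * r ^ d * (R₁ ^ 2 * R₂ ^ 2) ^ (-d/2)` times the number `R₁ ^ 2 * R₂ ^ 2 / r ^ 4` of pairs of lengths, in
units of `r ^ 2` (`exists_sum_gridPinches_bound`). This is
`N ^ (d + c (d - 4) - (a + b) (d - 2)) = N ^ (-ν)`. The exceptional events are negligible because `c < b`
(`exists_sum_bigSteps_bound`).
-/

noncomputable section

namespace Cable

open Filter Topology

/-! ### The length measure -/

@[simp] theorem edgePoint_apply {d : ℕ} (v : Fin d → ℤ) (i j : Fin d) (u : ℝ) :
    (edgePoint v i u : EuclideanSpace ℝ (Fin d)) j = v j + if j = i then u else 0 := rfl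

theorem lengthMeasure_apply {d : ℕ} {B : Set (Point d)} (hB : MeasurableSet B) :
    lengthMeasure d B = ∑' e : (Fin d → ℤ) × Fin d,
      volume {u | u ∈ Icc (0 : ℝ) 1 ∧ edgePoint e.1 e.2 u ∈ B} := by
  rw [lengthMeasure, Measure.sum_apply _ hB]
  refine tsum_congr fun e => ?_
  have hm := (continuous_edgePoint e.1 e.2).measurable hB
  rw [Measure.map_apply (continuous_edgePoint e.1 e.2).measurable hB,
    Measure.restrict_apply hm, inter_comm]
  rfl

/-- The points of the cable graph in the closed cube of half-side `ρ` around `z`. -/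
def cube {d : ℕ} (z : Fin d → ℝ) (ρ : ℝ) : Set (Point d) :=
  {y | ∀ j, |(y : EuclideanSpace ℝ (Fin d)) j - z j| ≤ ρ}

theorem continuous_coord {d : ℕ} (j : Fin d) :
    Continuous fun y : Point d => (y : EuclideanSpace ℝ (Fin d)) j :=
  (EuclideanSpace.proj j : EuclideanSpace ℝ (Fin d) →L[ℝ] ℝ).continuous.comp continuous_subtype_val

theorem isClosed_cube {d : ℕ} (z : Fin d → ℝ) (ρ : ℝ) : IsClosed (cube z ρ) := by
  simp only [cube, ← Set.iInter_ofPred]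
  exact isClosed_iInter fun j => isClosed_le
    ((continuous_coord j).sub continuous_const).abs continuous_const

theorem measurableSet_cube {d : ℕ} (z : Fin d → ℝ) (ρ : ℝ) : MeasurableSet (cube z ρ) :=
  (isClosed_cube z ρ).measurableSet

/-- The edges that may meet a cube. -/
def cubeEdges {d : ℕ} (z : Fin d → ℝ) (ρ : ℝ) : Finset ((Fin d → ℤ) × Fin d) :=
  (Fintype.piFinset fun j => Finset.Icc ⌈z j - ρ - 1⌉ ⌊z j + ρ⌋) ×ˢ Finset.univ

theorem mem_cubeEdges {d : ℕ} {z : Fin d → ℝ} {ρ : ℝ} {e : (Fin d → ℤ) × Fin d} {u : ℝ}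
    (hu : u ∈ Icc (0 : ℝ) 1) (h : edgePoint e.1 e.2 u ∈ cube z ρ) : e ∈ cubeEdges z ρ := by
  simp only [cubeEdges, Finset.mem_product, Fintype.mem_piFinset, Finset.mem_Icc, Finset.mem_univ,
    and_true, Int.ceil_le, Int.le_floor]
  intro j
  have h1 := abs_le.1 (h j)
  rw [edgePoint_apply] at h1
  split_ifs at h1 with hj
  · constructor <;> linarith [hu.1, hu.2, h1.1, h1.2]
  · constructor <;> linarith [h1.1, h1.2]

theorem card_cubeEdges_le {d : ℕ} (z : Fin d → ℝ) {ρ : ℝ} (hρ : 0 ≤ ρ) :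
    ((cubeEdges z ρ).card : ℝ) ≤ d * (2 * ρ + 2) ^ d := by
  rw [cubeEdges, Finset.card_product, Fintype.card_piFinset, Finset.card_univ, Fintype.card_fin]
  push_cast
  rw [mul_comm]
  gcongr
  calc _ ≤ ∏ _j : Fin d, (2 * ρ + 2) := by
        refine Finset.prod_le_prod (fun _ _ => by positivity) fun j _ => ?_
        rw [Int.card_Icc]
        have h1 : (⌊z j + ρ⌋ : ℝ) ≤ z j + ρ := Int.floor_le _
        have h2 : z j - ρ - 1 ≤ ⌈z j - ρ - 1⌉ := Int.le_ceil _
        have h3 : (((⌊z j + ρ⌋ + 1 - ⌈z j - ρ - 1⌉).toNat : ℤ) : ℝ) ≤ 2 * ρ + 2 := by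
          rw [Int.toNat_eq_max]
          push_cast
          exact max_le (by linarith) (by linarith)
        exact_mod_cast h3
    _ = _ := by simp

theorem lengthMeasure_cube_le {d : ℕ} (z : Fin d → ℝ) {ρ : ℝ} (hρ : 0 ≤ ρ) :
    lengthMeasure d (cube z ρ) ≤ ENNReal.ofReal (d * (2 * ρ + 2) ^ d) := by
  rw [lengthMeasure_apply (measurableSet_cube z ρ)]
  calc _ ≤ ∑' e : (Fin d → ℤ) × Fin d, if e ∈ cubeEdges z ρ then (1 : ℝ≥0∞) else 0 := by
        refine ENNReal.tsum_le_tsum fun e => ?_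
        split_ifs with he
        · calc _ ≤ volume (Icc (0 : ℝ) 1) := measure_mono fun u hu => hu.1
            _ = 1 := by simp
        · rw [nonpos_iff_eq_zero, show {u | u ∈ Icc (0 : ℝ) 1 ∧ edgePoint e.1 e.2 u ∈ cube z ρ} = ∅
            from eq_empty_of_forall_notMem fun u hu => he (mem_cubeEdges hu.1 hu.2)]
          simp
    _ = ((cubeEdges z ρ).card : ℝ≥0∞) := by
        rw [tsum_eq_sum (s := cubeEdges z ρ) (fun e he => by simp [he])]
        simp
    _ = ENNReal.ofReal ((cubeEdges z ρ).card : ℝ) := by simp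
    _ ≤ _ := ENNReal.ofReal_le_ofReal (card_cubeEdges_le z hρ)

instance (d : ℕ) : SigmaFinite (lengthMeasure d) := by
  refine ⟨⟨⟨fun n => cube 0 n, fun _ => trivial, fun n => ?_, ?_⟩⟩⟩
  · exact (lengthMeasure_cube_le _ n.cast_nonneg).trans_lt ENNReal.ofReal_lt_top
  · refine eq_univ_of_forall fun y => mem_iUnion.2 ?_
    obtain ⟨n, hn⟩ := exists_nat_ge (∑ j, |(y : EuclideanSpace ℝ (Fin d)) j|)
    refine ⟨n, fun j => ?_⟩
    simp only [Pi.zero_apply, sub_zero]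
    exact (Finset.single_le_sum (f := fun j => |(y : EuclideanSpace ℝ (Fin d)) j|)
      (fun _ _ => abs_nonneg _) (Finset.mem_univ j)).trans hn

theorem abs_coord_sub_le_dist {d : ℕ} (x y : Point d) (j : Fin d) :
    |(x : EuclideanSpace ℝ (Fin d)) j - (y : EuclideanSpace ℝ (Fin d)) j| ≤ dist x y := by
  rw [Subtype.dist_eq, EuclideanSpace.dist_eq]
  refine Real.le_sqrt_of_sq_le ?_
  rw [sq_abs]
  refine le_trans (le_of_eq ?_) (Finset.single_le_sum
    (f := fun j => dist ((x : EuclideanSpace ℝ (Fin d)) j) ((y : EuclideanSpace ℝ (Fin d)) j) ^ 2)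
    (fun _ _ => sq_nonneg _) (Finset.mem_univ j))
  rw [Real.dist_eq, sq_abs]

theorem dist_sq_eq {d : ℕ} (x y : Point d) : dist x y ^ 2 =
    ∑ j, ((x : EuclideanSpace ℝ (Fin d)) j - (y : EuclideanSpace ℝ (Fin d)) j) ^ 2 := by
  rw [Subtype.dist_eq, EuclideanSpace.dist_eq, Real.sq_sqrt (by positivity)]
  simp [Real.dist_eq]

/-! ### Test functions given edge by edge -/

/-- A continuous function of compact support which is given on each edge by a `C²` function
on the line is a test function if these satisfy the Kirchhoff condition. -/
theorem isTestFunction_of_edges {d : ℕ} {f : Point d → ℝ}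
    {F F₁ F₂ : (Fin d → ℤ) × Fin d → ℝ → ℝ} (hf : Continuous f) (hs : HasCompactSupport f)
    (h1 : ∀ e u, HasDerivAt (F e) (F₁ e u) u) (h2 : ∀ e u, HasDerivAt (F₁ e) (F₂ e u) u)
    (hc : ∀ e, Continuous (F₂ e)) (hfF : ∀ e, ∀ u ∈ Icc (0 : ℝ) 1, f (edgePoint e.1 e.2 u) = F e u)
    (hK : ∀ v, ∑ i, (F₁ (v, i) 0 - F₁ (v - Pi.single i 1, i) 1) = 0) : IsTestFunction f := by
  have hd1 : ∀ e, deriv (F e) = F₁ e := fun e => funext fun u => (h1 e u).deriv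
  have hd2 : ∀ e, deriv (F₁ e) = F₂ e := fun e => funext fun u => (h2 e u).deriv
  have hder : ∀ v i, ∀ u ∈ Icc (0 : ℝ) 1, derivWithin (onEdge f v i) (Icc 0 1) u = F₁ (v, i) u := by
    intro v i u hu
    rw [derivWithin_congr (f₁ := onEdge f v i) (fun w hw => hfF (v, i) w hw) (hfF (v, i) u hu)]
    exact (h1 (v, i) u).hasDerivWithinAt.derivWithin (uniqueDiffOn_Icc_zero_one u hu)
  refine ⟨hf, hs, fun v i => ?_, fun v => ?_⟩
  · have : ContDiff ℝ 2 (F (v, i)) := by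
      rw [show (2 : WithTop ℕ∞) = 1 + 1 from by norm_num, contDiff_succ_iff_deriv]
      refine ⟨fun u => (h1 _ u).differentiableAt, by simp, ?_⟩
      rw [hd1, contDiff_one_iff_deriv]
      exact ⟨fun u => (h2 _ u).differentiableAt, by rw [hd2]; exact hc _⟩
    exact this.contDiffOn.congr fun u hu => hfF (v, i) u hu
  · refine (Finset.sum_congr rfl fun i _ => ?_).trans (hK v)
    rw [hder v i 0 (by simp), hder _ i 1 (by simp)]

/-- The generator on functions given edge by edge, in the form used by `IsHeatKernel.forward`. -/
theorem iteratedDerivWithin_onEdge {d : ℕ} {f : Point d → ℝ}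
    {F F₁ F₂ : (Fin d → ℤ) × Fin d → ℝ → ℝ}
    (h1 : ∀ e u, HasDerivAt (F e) (F₁ e u) u) (h2 : ∀ e u, HasDerivAt (F₁ e) (F₂ e u) u)
    (hfF : ∀ e, ∀ u ∈ Icc (0 : ℝ) 1, f (edgePoint e.1 e.2 u) = F e u)
    (e : (Fin d → ℤ) × Fin d) {u : ℝ} (hu : u ∈ Icc (0 : ℝ) 1) :
    iteratedDerivWithin 2 (onEdge f e.1 e.2) (Icc 0 1) u = F₂ e u := by
  have hder : ∀ w ∈ Icc (0 : ℝ) 1, derivWithin (onEdge f e.1 e.2) (Icc 0 1) w = F₁ e w := by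
    intro w hw
    rw [derivWithin_congr (f₁ := onEdge f e.1 e.2) (fun w hw => hfF e w hw) (hfF e w hw)]
    exact (h1 e w).hasDerivWithinAt.derivWithin (uniqueDiffOn_Icc_zero_one w hw)
  rw [show (2 : ℕ) = 1 + 1 from rfl, iteratedDerivWithin_succ]
  have h3 : ∀ w ∈ Icc (0 : ℝ) 1,
      iteratedDerivWithin 1 (onEdge f e.1 e.2) (Icc 0 1) w = F₁ e w := fun w hw => by
    rw [iteratedDerivWithin_one]; exact hder w hw
  rw [derivWithin_congr h3 (h3 u hu)]
  exact (h2 e u).hasDerivWithinAt.derivWithin (uniqueDiffOn_Icc_zero_one u hu)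

/-! ### The transition measures -/

/-- The law `p t x y dy` of the position at time `t` of the motion started at `x`. -/
def transition {d : ℕ} (p : ℝ → Point d → Point d → ℝ) (t : ℝ) (x : Point d) :
    Measure (Point d) :=
  (lengthMeasure d).withDensity fun y => ENNReal.ofReal (p t x y)

namespace IsHeatKernel

variable {d : ℕ} {p : ℝ → Point d → Point d → ℝ}

theorem continuous_right (hp : IsHeatKernel d p) {t : ℝ} (ht : 0 < t) (x : Point d) :
    Continuous (p t x) := by
  refine hp.continuousOn.comp_continuous (f := fun y => (t, x, y)) (by fun_prop) fun y => ?_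
  exact ⟨ht, trivial⟩

theorem measurable_right (hp : IsHeatKernel d p) {t : ℝ} (ht : 0 < t) (x : Point d) :
    Measurable (p t x) := (hp.continuous_right ht x).measurable

theorem transition_univ_le (hp : IsHeatKernel d p) {t : ℝ} (ht : 0 < t) (x : Point d) :
    transition p t x univ ≤ 1 := by
  rw [transition, withDensity_apply _ MeasurableSet.univ, Measure.restrict_univ]
  exact hp.mass_le t ht x

theorem isFiniteMeasure_transition (hp : IsHeatKernel d p) {t : ℝ} (ht : 0 < t) (x : Point d) :
    IsFiniteMeasure (transition p t x) :=
  ⟨(hp.transition_univ_le ht x).trans_lt ENNReal.one_lt_top⟩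

theorem integral_transition (hp : IsHeatKernel d p) {t : ℝ} (ht : 0 < t) (x : Point d)
    (f : Point d → ℝ) :
    ∫ y, f y ∂(transition p t x) = ∫ y, p t x y * f y ∂(lengthMeasure d) := by
  rw [transition, integral_withDensity_eq_integral_toReal_smul
    (hp.measurable_right ht x).ennreal_ofReal (by simp)]
  simp [ENNReal.toReal_ofReal (hp.nonneg t ht x _)]

theorem integrable_transition (hp : IsHeatKernel d p) {t : ℝ} (ht : 0 < t) (x : Point d)
    {f : Point d → ℝ} (hf : Continuous f) {B : ℝ} (hB : ∀ y, |f y| ≤ B) :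
    Integrable f (transition p t x) := by
  have := hp.isFiniteMeasure_transition ht x
  exact Integrable.of_bound hf.aestronglyMeasurable B (ae_of_all _ fun y => hB y)

theorem integrable_mul (hp : IsHeatKernel d p) {t : ℝ} (ht : 0 < t) (x : Point d)
    {f : Point d → ℝ} (hf : Continuous f) {B : ℝ} (hB : ∀ y, |f y| ≤ B) :
    Integrable (fun y => p t x y * f y) (lengthMeasure d) := by
  have h := hp.integrable_transition ht x hf hB
  rw [transition, integrable_withDensity_iff_integrable_smul'
    (hp.measurable_right ht x).ennreal_ofReal (by simp)] at h
  simpa [ENNReal.toReal_ofReal (hp.nonneg t ht x _)] using h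

/-- Integrals against the transition measures, edge by edge. -/
theorem hasSum_integral_transition (hp : IsHeatKernel d p) {t : ℝ} (ht : 0 < t) (x : Point d)
    {f : Point d → ℝ} (hf : Continuous f) {B : ℝ} (hB : ∀ y, |f y| ≤ B) :
    HasSum (fun e : (Fin d → ℤ) × Fin d =>
        ∫ u in (0 : ℝ)..1, p t x (edgePoint e.1 e.2 u) * f (edgePoint e.1 e.2 u))
      (∫ y, f y ∂(transition p t x)) := by
  rw [hp.integral_transition ht x]
  have h := hasSum_integral_measure (hp.integrable_mul ht x hf hB)
  have he : (fun e : (Fin d → ℤ) × Fin d =>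
      ∫ u in (0 : ℝ)..1, p t x (edgePoint e.1 e.2 u) * f (edgePoint e.1 e.2 u)) =
      fun e => ∫ y, p t x y * f y
        ∂((volume.restrict (Icc (0 : ℝ) 1)).map (edgePoint e.1 e.2)) := funext fun e => by
    have hc : Continuous fun y => p t x y * f y := (hp.continuous_right ht x).mul hf
    rw [integral_map (continuous_edgePoint e.1 e.2).aemeasurable hc.aestronglyMeasurable,
      integral_Icc_eq_integral_Ioc,
      intervalIntegral.integral_of_le zero_le_one]
  rw [he]
  exact h

/-! ### Duality with solutions of the backward equation -/

theorem continuousOn_edge (hp : IsHeatKernel d p) (x : Point d) (e : (Fin d → ℤ) × Fin d)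
    {Φ : ℝ → ℝ → ℝ} (hΦ : ContinuousOn (Function.uncurry Φ) (Ioi 0 ×ˢ univ)) :
    ContinuousOn (fun q : ℝ × ℝ =>
      ∫ u in (0 : ℝ)..1, p q.1 x (edgePoint e.1 e.2 u) * Φ q.2 u) (Ioi 0 ×ˢ Ioi 0) := by
  rw [continuousOn_iff_continuous_domRestrict]
  refine intervalIntegral.continuous_parametric_intervalIntegral_of_continuous'
    (f := fun (q : ↥(Ioi (0 : ℝ) ×ˢ Ioi (0 : ℝ))) u =>
      p q.1.1 x (edgePoint e.1 e.2 u) * Φ q.1.2 u) ?_ 0 1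
  refine Continuous.mul ?_ ?_
  · refine hp.continuousOn.comp_continuous (f := fun w : ↥(Ioi (0 : ℝ) ×ˢ Ioi (0 : ℝ)) × ℝ =>
      (w.1.1.1, x, edgePoint e.1 e.2 w.2)) ?_ fun w => ⟨w.1.2.1, trivial⟩
    have := continuous_edgePoint e.1 e.2
    fun_prop
  · exact hΦ.comp_continuous (f := fun w : ↥(Ioi (0 : ℝ) ×ˢ Ioi (0 : ℝ)) × ℝ => (w.1.1.2, w.2))
      (by fun_prop) fun w => ⟨w.1.2.2, trivial⟩

theorem sum_integral_edge_le (hp : IsHeatKernel d p) (x : Point d) {t : ℝ} (ht : 0 < t)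
    (E : Finset ((Fin d → ℤ) × Fin d)) {f : Point d → ℝ} (hf : Continuous f) (h0 : ∀ y, 0 ≤ f y)
    {B : ℝ} (hB : ∀ y, f y ≤ B) :
    ∑ e ∈ E, ∫ u in (0 : ℝ)..1, p t x (edgePoint e.1 e.2 u) * f (edgePoint e.1 e.2 u) ≤
      ∫ y, f y ∂(transition p t x) := by
  refine sum_le_hasSum E (fun e _ => ?_) (hp.hasSum_integral_transition ht x hf
    (B := B) fun y => by rw [abs_of_nonneg (h0 y)]; exact hB y)
  exact intervalIntegral.integral_nonneg zero_le_one fun u _ =>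
    mul_nonneg (hp.nonneg t ht _ _) (h0 _)

theorem continuous_edge (hp : IsHeatKernel d p) (x : Point d) {t : ℝ} (ht : 0 < t)
    (e : (Fin d → ℤ) × Fin d) : Continuous fun u => p t x (edgePoint e.1 e.2 u) :=
  (hp.continuous_right ht x).comp (continuous_edgePoint e.1 e.2)

theorem intervalIntegrable_edge (hp : IsHeatKernel d p) (x : Point d) {t : ℝ} (ht : 0 < t)
    (e : (Fin d → ℤ) × Fin d) {φ : ℝ → ℝ} (hφ : Continuous φ) (α β : ℝ) :
    IntervalIntegrable (fun u => p t x (edgePoint e.1 e.2 u) * φ u) volume α β :=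
  ((hp.continuous_edge x ht e).mul hφ).intervalIntegrable _ _

/-- If `|φ e| ≤ B` on the edges `e ∈ E`, the integral of `φ` against a transition measure is at
most `B`. -/
theorem abs_sum_integral_edge_le (hp : IsHeatKernel d p) (x : Point d) {t : ℝ} (ht : 0 < t)
    (E : Finset ((Fin d → ℤ) × Fin d)) {φ : (Fin d → ℤ) × Fin d → ℝ → ℝ}
    (hφ : ∀ e, Continuous (φ e)) {B : ℝ} (hB0 : 0 ≤ B)
    (hB : ∀ e ∈ E, ∀ u ∈ Icc (0 : ℝ) 1, |φ e u| ≤ B) :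
    |∑ e ∈ E, ∫ u in (0 : ℝ)..1, p t x (edgePoint e.1 e.2 u) * φ e u| ≤ B := by
  have hfin := hp.isFiniteMeasure_transition ht x
  have h1 : |∑ e ∈ E, ∫ u in (0 : ℝ)..1, p t x (edgePoint e.1 e.2 u) * φ e u| ≤
      ∑ e ∈ E, ∫ u in (0 : ℝ)..1, p t x (edgePoint e.1 e.2 u) * B := by
    refine (Finset.abs_sum_le_sum_abs _ _).trans (Finset.sum_le_sum fun e he => ?_)
    refine (intervalIntegral.abs_integral_le_integral_abs zero_le_one).trans ?_
    refine intervalIntegral.integral_mono_on zero_le_one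
      (hp.intervalIntegrable_edge x ht e (hφ e) 0 1).abs
      (hp.intervalIntegrable_edge x ht e continuous_const 0 1) fun u hu => ?_
    rw [abs_mul, abs_of_nonneg (hp.nonneg t ht _ _)]
    exact mul_le_mul_of_nonneg_left (hB e he u hu) (hp.nonneg t ht _ _)
  refine h1.trans ((hp.sum_integral_edge_le x ht E (f := fun _ => B) continuous_const
    (fun _ => hB0) fun _ => le_rfl).trans ?_)
  rw [integral_const, smul_eq_mul]
  refine mul_le_of_le_one_left hB0 ?_
  rw [measureReal_def]
  exact ENNReal.toReal_le_of_le_ofReal zero_le_one (by simpa using hp.transition_univ_le ht x)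

/-- Let `h s`, `s > 0`, be a smooth family of test functions, given by `F e s` on the edge `e` and
vanishing outside of the finitely many edges of `E`. If the integral of
`h'' / 2 - ∂ h / ∂ s` at `s = s₁ + T - r` against `p r x` is at most `ε r`, then the integral of
`h s₁` against `p T x` is at most `h (s₁ + T) x` plus the integral `Ξ T - Ξ 0` of `ε = Ξ'`. -/
theorem integral_le_of_backward_compact (hp : IsHeatKernel d p) (x : Point d) {T s₁ : ℝ}
    (hT : 0 < T) (hs₁ : 0 < s₁) {h : ℝ → Point d → ℝ}
    {F F₁ F₂ Fs : (Fin d → ℤ) × Fin d → ℝ → ℝ → ℝ} (E : Finset ((Fin d → ℤ) × Fin d))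
    (hh : ∀ s > 0, IsTestFunction (h s))
    (hF : ∀ e, ∀ s > 0, ∀ u, HasDerivAt (F e s) (F₁ e s u) u)
    (hF₁ : ∀ e, ∀ s > 0, ∀ u, HasDerivAt (F₁ e s) (F₂ e s u) u)
    (hFs : ∀ e, ∀ s > 0, ∀ u, HasDerivAt (fun s => F e s u) (Fs e s u) s)
    (hc₂ : ∀ e, ContinuousOn (Function.uncurry (F₂ e)) (Ioi 0 ×ˢ univ))
    (hcs : ∀ e, ContinuousOn (Function.uncurry (Fs e)) (Ioi 0 ×ˢ univ))
    (hhF : ∀ s > 0, ∀ e, ∀ u ∈ Icc (0 : ℝ) 1, h s (edgePoint e.1 e.2 u) = F e s u)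
    (hE : ∀ e ∉ E, ∀ s > 0, ∀ u ∈ Icc (0 : ℝ) 1, F e s u = 0 ∧ F₂ e s u = 0)
    {Ξ ε : ℝ → ℝ} (hΞc : ContinuousOn Ξ (Icc 0 T)) (hΞ : ∀ r ∈ Ioo 0 T, HasDerivAt Ξ (ε r) r)
    (hle : ∀ r ∈ Ioo 0 T, ∑ e ∈ E, ∫ u in (0 : ℝ)..1, p r x (edgePoint e.1 e.2 u) *
      ((1 / 2) * F₂ e (s₁ + T - r) u - Fs e (s₁ + T - r) u) ≤ ε r) :
    ∫ y, h s₁ y ∂(transition p T x) ≤ h (s₁ + T) x + (Ξ T - Ξ 0) := by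
  -- `m r s` is the pairing of `p r x` with `h s`; `a` and `b` are its derivatives in `r` and in `s`.
  -- The value `m r (S - r)` is differentiated along the path joining the times `0` and `T`.
  set m : ℝ → ℝ → ℝ := fun r s => ∑ e ∈ E,
    ∫ u in (0 : ℝ)..1, p r x (edgePoint e.1 e.2 u) * F e s u with hm
  set a : ℝ → ℝ → ℝ := fun r s => (1 / 2) * ∑ e ∈ E,
    ∫ u in (0 : ℝ)..1, p r x (edgePoint e.1 e.2 u) * F₂ e s u with ha
  set b : ℝ → ℝ → ℝ := fun r s => ∑ e ∈ E,
    ∫ u in (0 : ℝ)..1, p r x (edgePoint e.1 e.2 u) * Fs e s u with hb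
  have hca : ContinuousOn (Function.uncurry a) (Ioi 0 ×ˢ Ioi 0) :=
    continuousOn_const.mul (continuousOn_finsetSum _ fun e _ => hp.continuousOn_edge x e (hc₂ e))
  have hcb : ContinuousOn (Function.uncurry b) (Ioi 0 ×ˢ Ioi 0) :=
    continuousOn_finsetSum _ fun e _ => hp.continuousOn_edge x e (hcs e)
  have hFc : ∀ e, ∀ s > 0, Continuous (F e s) := fun e s hs =>
    continuous_iff_continuousAt.2 fun u => (hF e s hs u).continuousAt
  have hF₂c : ∀ e, ∀ s > 0, Continuous (F₂ e s) := fun e s hs =>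
    (hc₂ e).comp_continuous (f := fun u => (s, u)) (by fun_prop) fun u => ⟨hs, trivial⟩
  have hFsc : ∀ e, ∀ s > 0, Continuous (Fs e s) := fun e s hs =>
    (hcs e).comp_continuous (f := fun u => (s, u)) (by fun_prop) fun u => ⟨hs, trivial⟩
  -- the pairing is computed on finitely many edges
  have hm_eq : ∀ r > 0, ∀ s > 0, ∫ y, h s y ∂(transition p r x) = m r s := by
    intro r hr s hs
    obtain ⟨B, hB⟩ := (hh s hs).compactSupport.exists_bound_of_continuous (hh s hs).continuous
    have h1 := hp.hasSum_integral_transition hr x (hh s hs).continuous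
      (B := B) fun y => by simpa using hB y
    have h2 : ∀ e, ∫ u in (0 : ℝ)..1, p r x (edgePoint e.1 e.2 u) * h s (edgePoint e.1 e.2 u) =
        ∫ u in (0 : ℝ)..1, p r x (edgePoint e.1 e.2 u) * F e s u := fun e =>
      intervalIntegral.integral_congr fun u hu => by
        rw [uIcc_of_le zero_le_one] at hu
        simp only [hhF s hs e u hu]
    simp only [h2] at h1
    refine h1.unique (hasSum_sum_of_ne_finset_zero fun e he => ?_)
    refine (intervalIntegral.integral_congr fun u hu => ?_).trans
      (intervalIntegral.integral_zero (a := 0) (b := 1))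
    rw [uIcc_of_le zero_le_one] at hu
    simp [(hE e he s hs u hu).1]
  -- the weak form of the heat equation
  have hm_int : ∀ r > 0, ∀ s > 0, m r s = h s x + ∫ ρ in (0 : ℝ)..r, a ρ s := by
    intro r hr s hs
    rw [← hm_eq r hr s hs, hp.integral_transition hr, hp.forward _ (hh s hs) r hr x]
    congr 1
    refine intervalIntegral.integral_congr fun ρ hρ => ?_
    simp only [ha]
    congr 1
    have h2 : ∀ e : (Fin d → ℤ) × Fin d, ∫ u in (0 : ℝ)..1, p ρ x (edgePoint e.1 e.2 u) *
        iteratedDerivWithin 2 (onEdge (h s) e.1 e.2) (Icc 0 1) u =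
        ∫ u in (0 : ℝ)..1, p ρ x (edgePoint e.1 e.2 u) * F₂ e s u := fun e =>
      intervalIntegral.integral_congr fun u hu => by
        rw [uIcc_of_le zero_le_one] at hu
        simp only [iteratedDerivWithin_onEdge (fun e u => hF e s hs u) (fun e u => hF₁ e s hs u)
          (fun e u hu => hhF s hs e u hu) e hu]
    simp only [h2]
    refine tsum_eq_sum fun e he => ?_
    refine (intervalIntegral.integral_congr fun u hu => ?_).trans
      (intervalIntegral.integral_zero (a := 0) (b := 1))
    rw [uIcc_of_le zero_le_one] at hu
    simp [(hE e he s hs u hu).2]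
  -- bounds on compact sets of times
  have hbd : ∀ {Φ : (Fin d → ℤ) × Fin d → ℝ → ℝ → ℝ},
      (∀ e, ContinuousOn (Function.uncurry (Φ e)) (Ioi 0 ×ˢ univ)) → ∀ s₀ > 0, ∀ s₂,
      ∃ B, 0 ≤ B ∧ ∀ e ∈ E, ∀ s ∈ Icc s₀ s₂, ∀ u ∈ Icc (0 : ℝ) 1, |Φ e s u| ≤ B := by
    intro Φ hΦ s₀ hs₀ s₂
    have h1 : ∀ e, ∃ B, ∀ q ∈ Icc s₀ s₂ ×ˢ Icc (0 : ℝ) 1, ‖Function.uncurry (Φ e) q‖ ≤ B :=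
      fun e => (isCompact_Icc.prod isCompact_Icc).exists_bound_of_continuousOn
        ((hΦ e).mono (prod_mono (fun s hs => lt_of_lt_of_le hs₀ hs.1) (subset_univ _)))
    choose B hB using h1
    refine ⟨∑ e ∈ E, |B e|, Finset.sum_nonneg fun _ _ => abs_nonneg _, fun e he s hs u hu => ?_⟩
    exact (hB e (s, u) ⟨hs, hu⟩).trans ((le_abs_self _).trans
      (Finset.single_le_sum (f := fun e => |B e|) (fun _ _ => abs_nonneg _) he))
  have hint : ∀ s > 0, ∀ r ≥ 0, IntervalIntegrable (fun ρ => a ρ s) volume 0 r := by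
    intro s hs r hr
    obtain ⟨B, hB0, hB⟩ := hbd hc₂ s hs s
    rw [intervalIntegrable_iff_integrableOn_Ioc_of_le hr]
    refine Integrable.of_bound (C := (1 / 2) * B) ?_ ?_
    · refine ContinuousOn.aestronglyMeasurable ?_ measurableSet_Ioc
      exact hca.comp (f := fun ρ => (ρ, s)) (by fun_prop) fun ρ hρ => ⟨hρ.1, hs⟩
    · refine (ae_restrict_iff' measurableSet_Ioc).2 (ae_of_all _ fun ρ hρ => ?_)
      rw [Real.norm_eq_abs, ha, abs_mul, abs_of_nonneg (by norm_num : (0 : ℝ) ≤ 1 / 2)]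
      gcongr
      exact hp.abs_sum_integral_edge_le x hρ.1 E (fun e => hF₂c e s hs) hB0
        fun e he u hu => hB e he s ⟨le_rfl, le_rfl⟩ u hu
  have hm1 : ∀ r > 0, ∀ s > 0, HasDerivAt (fun r => m r s) (a r s) r := by
    intro r hr s hs
    have hco : ContinuousOn (fun ρ => a ρ s) (Ioi 0) :=
      hca.comp (f := fun ρ => (ρ, s)) (by fun_prop) fun ρ hρ => ⟨hρ, hs⟩
    have h1 : HasDerivAt (fun r => h s x + ∫ ρ in (0 : ℝ)..r, a ρ s) (a r s) r := by
      refine (intervalIntegral.integral_hasDerivAt_right (hint s hs r hr.le)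
        ?_ (hco.continuousAt (Ioi_mem_nhds hr))).const_add _
      exact hco.stronglyMeasurableAtFilter isOpen_Ioi r hr
    refine h1.congr_of_eventuallyEq ?_
    filter_upwards [Ioi_mem_nhds hr] with ρ hρ
    exact hm_int ρ hρ s hs
  have hm2 : ∀ r > 0, ∀ s > 0, HasDerivAt (m r) (b r s) s := by
    intro r hr s hs
    refine HasDerivAt.fun_sum fun e he => ?_
    obtain ⟨B, hB0, hB⟩ := hbd hcs (s / 2) (by linarith) (2 * s)
    refine (intervalIntegral.hasDerivAt_integral_of_dominated_loc_of_deriv_le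
      (F := fun s u => p r x (edgePoint e.1 e.2 u) * F e s u)
      (F' := fun s u => p r x (edgePoint e.1 e.2 u) * Fs e s u)
      (bound := fun u => p r x (edgePoint e.1 e.2 u) * B)
      (s := Icc (s / 2) (2 * s)) (Icc_mem_nhds (by linarith) (by linarith)) ?_ ?_ ?_ ?_ ?_ ?_).2
    · filter_upwards [Ioi_mem_nhds hs] with σ hσ
      exact ((hp.continuous_edge x hr e).mul (hFc e σ hσ)).aestronglyMeasurable
    · exact hp.intervalIntegrable_edge x hr e (hFc e s hs) 0 1
    · exact ((hp.continuous_edge x hr e).mul (hFsc e s hs)).aestronglyMeasurable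
    · refine ae_of_all _ fun u hu σ hσ => ?_
      rw [uIoc_of_le zero_le_one] at hu
      rw [Real.norm_eq_abs, abs_mul, abs_of_nonneg (hp.nonneg r hr _ _)]
      exact mul_le_mul_of_nonneg_left (hB e he σ hσ u ⟨hu.1.le, hu.2⟩) (hp.nonneg r hr _ _)
    · exact hp.intervalIntegrable_edge x hr e continuous_const 0 1
    · refine ae_of_all _ fun u hu σ hσ => ?_
      exact (hFs e σ (by linarith [hσ.1]) u).const_mul _
  set S := s₁ + T with hS
  -- At `r = 0` the transition measure is the Dirac mass at `x`, so that the value of `m` there is `h S x`.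
  set G : ℝ → ℝ := fun r => if r = 0 then h S x else m r (S - r) with hG
  have hcl : Continuous fun c : ℝ => ContinuousLinearMap.toSpanSingleton ℝ c :=
    (ContinuousLinearMap.toSpanSingletonLE ℝ ℝ ℝ).toLinearMap.continuous_of_finiteDimensional
  have hGd : ∀ r ∈ Ioo 0 S, HasDerivAt G (a r (S - r) - b r (S - r)) r := by
    intro r hr
    have hSr : 0 < S - r := by linarith [hr.2]
    have hmem : Ioi (0 : ℝ) ×ˢ Ioi (0 : ℝ) ∈ 𝓝 (r, S - r) :=
      (isOpen_Ioi.prod isOpen_Ioi).mem_nhds ⟨hr.1, hSr⟩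
    have hst := hasStrictFDerivAt_uncurry_coprod (𝕜 := ℝ) (u := (r, S - r)) (f := m)
      (f₁ := fun r s => ContinuousLinearMap.toSpanSingleton ℝ (a r s))
      (f₂ := fun r s => ContinuousLinearMap.toSpanSingleton ℝ (b r s))
      (by filter_upwards [hmem] with q hq
          exact (hm1 q.1 hq.1 q.2 hq.2).hasFDerivAt)
      (by filter_upwards [hmem] with q hq
          exact (hm2 q.1 hq.1 q.2 hq.2).hasFDerivAt)
      (hcl.continuousAt.comp
        (hca.continuousAt hmem))
      (hcl.continuousAt.comp
        (hcb.continuousAt hmem))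
    have hcurve : HasDerivAt (fun r : ℝ => (r, S - r)) ((1 : ℝ), (-1 : ℝ)) r := by
      refine (hasDerivAt_id r).prodMk ?_
      simpa using (hasDerivAt_id r).const_sub S
    have h3 := hst.hasFDerivAt.comp_hasDerivAt r hcurve
    have h4 : HasDerivAt (fun r => m r (S - r)) (a r (S - r) - b r (S - r)) r := by
      refine HasDerivAt.congr_deriv (f := fun r => m r (S - r)) h3 ?_
      change (1 : ℝ) • a r (S - r) + (-1 : ℝ) • b r (S - r) = _
      rw [one_smul, neg_one_smul]
      exact (sub_eq_add_neg _ _).symm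
    refine h4.congr_of_eventuallyEq ?_
    filter_upwards [Ioi_mem_nhds hr.1] with ρ hρ
    exact if_neg (ne_of_gt hρ)
  -- Continuity at `r = 0` is quantitative: by `hm_int`, `m r s` differs from `h s x` by `O(r)`, uniformly
  -- for `s` in a compact set.
  have hG0 : ContinuousWithinAt G (Ici 0) 0 := by
    obtain ⟨e, u, hu, rfl⟩ : ∃ (e : (Fin d → ℤ) × Fin d) (u : ℝ), u ∈ Ico (0 : ℝ) 1 ∧
        edgePoint e.1 e.2 u = x := by
      obtain ⟨v, i, u, hu, hx⟩ := exists_edgePoint x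
      exact ⟨(v, i), u, hu, hx⟩
    set x := edgePoint e.1 e.2 u
    obtain ⟨B, hB0, hB⟩ := hbd hc₂ s₁ hs₁ S
    have hS0 : 0 < S := by linarith
    have h1 : Tendsto (fun r => h (S - r) x) (𝓝 0) (𝓝 (h S x)) := by
      have h2 : ContinuousAt (fun r => F e (S - r) u) 0 := by
        have h3 := (hFs e S hS0 u).continuousAt
        refine ContinuousAt.comp (g := fun s => F e s u) (by simpa using h3) (by fun_prop)
      have h4 := h2.tendsto
      simp only [sub_zero] at h4
      rw [← hhF S hS0 e u ⟨hu.1, hu.2.le⟩] at h4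
      refine h4.congr' ?_
      filter_upwards [Iio_mem_nhds hS0] with r hr
      exact (hhF (S - r) (by simpa using hr) e u ⟨hu.1, hu.2.le⟩).symm
    have h5 : Tendsto (fun r => |h (S - r) x - h S x| + (1 / 2) * B * r) (𝓝[≥] 0) (𝓝 0) := by
      have h6 : Tendsto (fun r => |h (S - r) x - h S x| + (1 / 2) * B * r) (𝓝 0)
          (𝓝 (|h S x - h S x| + (1 / 2) * B * 0)) :=
        (h1.sub_const _).abs.add (tendsto_id.const_mul _)
      simp only [sub_self, abs_zero, mul_zero, add_zero] at h6
      exact h6.mono_left nhdsWithin_le_nhds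
    rw [ContinuousWithinAt, tendsto_iff_dist_tendsto_zero]
    refine squeeze_zero' (Eventually.of_forall fun _ => dist_nonneg) ?_ h5
    filter_upwards [self_mem_nhdsWithin, mem_nhdsWithin_of_mem_nhds (Iio_mem_nhds hT)] with r hr hrT
    rcases eq_or_lt_of_le (show (0 : ℝ) ≤ r from hr) with rfl | hr
    · simp
    · have hsr : S - r ∈ Icc s₁ S := ⟨by linarith [show r < T from hrT], by linarith⟩
      have hs0 : 0 < S - r := lt_of_lt_of_le hs₁ hsr.1
      have h7 : |∫ ρ in (0 : ℝ)..r, a ρ (S - r)| ≤ (1 / 2) * B * |r - 0| := by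
        rw [← Real.norm_eq_abs]
        refine intervalIntegral.norm_integral_le_of_norm_le_const fun ρ hρ => ?_
        rw [uIoc_of_le hr.le] at hρ
        rw [Real.norm_eq_abs, ha, abs_mul, abs_of_nonneg (by norm_num : (0 : ℝ) ≤ 1 / 2)]
        gcongr
        exact hp.abs_sum_integral_edge_le x hρ.1 E (fun e => hF₂c e _ hs0) hB0
          fun e he u hu => hB e he _ hsr u hu
      rw [sub_zero, abs_of_pos hr] at h7
      rw [Real.dist_eq]
      simp only [hG, if_neg hr.ne', if_true, hm_int r hr _ hs0]
      calc _ = |(h (S - r) x - h S x) + ∫ ρ in (0 : ℝ)..r, a ρ (S - r)| := by congr 1; ring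
        _ ≤ _ := (abs_add_le _ _).trans (by gcongr)
  have hGc : ContinuousOn G (Icc 0 T) := by
    intro r hr
    rcases eq_or_lt_of_le hr.1 with rfl | hr0
    · exact hG0.mono fun _ h => h.1
    · exact (hGd r ⟨hr0, by linarith [hr.2]⟩).continuousAt.continuousWithinAt
  have hanti : AntitoneOn (fun r => G r - Ξ r) (Icc 0 T) := by
    refine antitoneOn_of_deriv_nonpos (convex_Icc 0 T) (hGc.sub hΞc) ?_ ?_
    · intro r hr
      rw [interior_Icc] at hr
      exact ((hGd r ⟨hr.1, by linarith [hr.2]⟩).sub (hΞ r hr)).differentiableAt.differentiableWithinAt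
    · intro r hr
      rw [interior_Icc] at hr
      have hd : HasDerivAt (fun r => G r - Ξ r) _ r :=
        (hGd r ⟨hr.1, by linarith [hr.2]⟩).sub (hΞ r hr)
      rw [hd.deriv, sub_nonpos]
      refine le_trans (le_of_eq ?_) (hle r hr)
      have hs0 : 0 < S - r := by linarith [hr.2]
      simp only [ha, hb]
      rw [Finset.mul_sum, ← Finset.sum_sub_distrib]
      refine Finset.sum_congr rfl fun e _ => ?_
      rw [← intervalIntegral.integral_const_mul, ← intervalIntegral.integral_sub
        ((hp.intervalIntegrable_edge x hr.1 e (hF₂c e _ hs0) 0 1).const_mul _)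
        (hp.intervalIntegrable_edge x hr.1 e (hFsc e _ hs0) 0 1)]
      exact intervalIntegral.integral_congr fun u _ => by ring
  have hfin := hanti (left_mem_Icc.2 hT.le) (right_mem_Icc.2 hT.le) hT.le
  simp only [hG, if_neg hT.ne', if_true] at hfin
  rw [hm_eq T hT s₁ hs₁, show s₁ = S - T by rw [hS]; ring]
  linarith

end IsHeatKernel

/-! ### Smooth cutoffs -/

/-- The first derivative of `Real.smoothTransition`. -/
def stepDeriv : ℝ → ℝ := deriv Real.smoothTransition

/-- The second derivative of `Real.smoothTransition`. -/
def stepDeriv₂ : ℝ → ℝ := deriv stepDeriv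

theorem contDiff_stepDeriv : ContDiff ℝ 1 stepDeriv := by
  have h : ContDiff ℝ (1 + 1) Real.smoothTransition := Real.smoothTransition.contDiff (n := 2)
  exact (contDiff_succ_iff_deriv.1 h).2.2

theorem hasDerivAt_smoothTransition (z : ℝ) :
    HasDerivAt Real.smoothTransition (stepDeriv z) z :=
  ((Real.smoothTransition.contDiff (n := 1)).differentiable (by simp) z).hasDerivAt

theorem hasDerivAt_stepDeriv (z : ℝ) : HasDerivAt stepDeriv (stepDeriv₂ z) z :=
  (contDiff_stepDeriv.differentiable (by simp) z).hasDerivAt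

theorem continuous_stepDeriv : Continuous stepDeriv := contDiff_stepDeriv.continuous

theorem continuous_stepDeriv₂ : Continuous stepDeriv₂ := contDiff_stepDeriv.continuous_deriv (by simp)

theorem stepDeriv_eq_zero {z : ℝ} (hz : z ∉ Icc (0 : ℝ) 1) : stepDeriv z = 0 := by
  rw [mem_Icc, not_and_or, not_le, not_le] at hz
  rcases hz with hz | hz
  · refine (((hasDerivAt_const z (0 : ℝ)).congr_of_eventuallyEq ?_).unique
      (hasDerivAt_smoothTransition z)).symm
    filter_upwards [Iio_mem_nhds hz] with w hw
    exact Real.smoothTransition.zero_of_nonpos (le_of_lt hw)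
  · refine (((hasDerivAt_const z (1 : ℝ)).congr_of_eventuallyEq ?_).unique
      (hasDerivAt_smoothTransition z)).symm
    filter_upwards [Ioi_mem_nhds hz] with w hw
    exact Real.smoothTransition.one_of_one_le (le_of_lt hw)

theorem stepDeriv₂_eq_zero {z : ℝ} (hz : z ∉ Icc (0 : ℝ) 1) : stepDeriv₂ z = 0 := by
  refine (((hasDerivAt_const z (0 : ℝ)).congr_of_eventuallyEq ?_).unique
    (hasDerivAt_stepDeriv z)).symm
  filter_upwards [isClosed_Icc.isOpen_compl.mem_nhds hz] with w hw
  exact stepDeriv_eq_zero hw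

theorem exists_stepDeriv_bound :
    ∃ C : ℝ, 1 ≤ C ∧ ∀ z, |stepDeriv z| ≤ C ∧ |stepDeriv₂ z| ≤ C := by
  obtain ⟨C₁, h1⟩ := (isCompact_Icc (a := (0 : ℝ)) (b := 1)).exists_bound_of_continuousOn
    continuous_stepDeriv.continuousOn
  obtain ⟨C₂, h2⟩ := (isCompact_Icc (a := (0 : ℝ)) (b := 1)).exists_bound_of_continuousOn
    continuous_stepDeriv₂.continuousOn
  refine ⟨max 1 (max C₁ C₂), le_max_left _ _, fun z => ?_⟩
  by_cases hz : z ∈ Icc (0 : ℝ) 1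
  · exact ⟨(h1 z hz).trans ((le_max_left _ _).trans (le_max_right _ _)),
      (h2 z hz).trans ((le_max_right _ _).trans (le_max_right _ _))⟩
  · rw [stepDeriv_eq_zero hz, stepDeriv₂_eq_zero hz, abs_zero]
    exact ⟨by positivity, by positivity⟩

/-- The squared distance of a point of the cable graph to a point of space. -/
def sqDist {d : ℕ} (c : Fin d → ℝ) (y : Point d) : ℝ :=
  ∑ j, ((y : EuclideanSpace ℝ (Fin d)) j - c j) ^ 2

/-- The squared distance to `c` along an edge. -/
def edgeSqDist {d : ℕ} (c : Fin d → ℝ) (e : (Fin d → ℤ) × Fin d) (u : ℝ) : ℝ :=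
  ∑ j, ((e.1 j : ℝ) + (if j = e.2 then u else 0) - c j) ^ 2

theorem sqDist_edgePoint {d : ℕ} (c : Fin d → ℝ) (e : (Fin d → ℤ) × Fin d) (u : ℝ) :
    sqDist c (edgePoint e.1 e.2 u) = edgeSqDist c e u := rfl

theorem continuous_sqDist {d : ℕ} (c : Fin d → ℝ) : Continuous (sqDist c) :=
  continuous_finsetSum _ fun j _ => ((continuous_coord j).sub continuous_const).pow 2

theorem sqDist_nonneg {d : ℕ} (c : Fin d → ℝ) (y : Point d) : 0 ≤ sqDist c y :=
  Finset.sum_nonneg fun _ _ => sq_nonneg _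

theorem sq_le_edgeSqDist {d : ℕ} (c : Fin d → ℝ) (e : (Fin d → ℤ) × Fin d) (u : ℝ) :
    (e.1 e.2 + u - c e.2) ^ 2 ≤ edgeSqDist c e u := by
  have h := Finset.single_le_sum
    (f := fun j => ((e.1 j : ℝ) + (if j = e.2 then u else 0) - c j) ^ 2)
    (fun _ _ => sq_nonneg _) (Finset.mem_univ e.2)
  simpa [edgeSqDist] using h

theorem hasDerivAt_edgeSqDist {d : ℕ} (c : Fin d → ℝ) (e : (Fin d → ℤ) × Fin d) (u : ℝ) :
    HasDerivAt (edgeSqDist c e) (2 * (e.1 e.2 + u - c e.2)) u := by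
  have h : HasDerivAt (edgeSqDist c e)
      (∑ j, (if j = e.2 then 2 * ((e.1 j : ℝ) + u - c j) else 0)) u := by
    refine HasDerivAt.fun_sum fun j _ => ?_
    split_ifs with hj
    · have h1 : HasDerivAt (fun u : ℝ => (e.1 j : ℝ) + u - c j) 1 u :=
        ((hasDerivAt_id u).const_add _).sub_const _
      simpa using h1.fun_pow 2
    · exact hasDerivAt_const _ _
  simpa using h

/-- The second-order chain rule along an edge for a function of the squared distance. -/
theorem hasDerivAt_comp_edgeSqDist {d : ℕ} (c : Fin d → ℝ) (e : (Fin d → ℤ) × Fin d)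
    {φ φ₁ φ₂ : ℝ → ℝ} (h1 : ∀ z, HasDerivAt φ (φ₁ z) z) (h2 : ∀ z, HasDerivAt φ₁ (φ₂ z) z) (u : ℝ) :
    HasDerivAt (fun u => φ (edgeSqDist c e u))
      (φ₁ (edgeSqDist c e u) * (2 * (e.1 e.2 + u - c e.2))) u ∧
    HasDerivAt (fun u => φ₁ (edgeSqDist c e u) * (2 * (e.1 e.2 + u - c e.2)))
      (φ₂ (edgeSqDist c e u) * (2 * (e.1 e.2 + u - c e.2)) ^ 2 + 2 * φ₁ (edgeSqDist c e u)) u := by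
  have hq := hasDerivAt_edgeSqDist c e u
  refine ⟨(h1 _).comp u hq, ?_⟩
  have h3 : HasDerivAt (fun u : ℝ => 2 * (e.1 e.2 + u - c e.2)) 2 u := by
    simpa using (((hasDerivAt_id u).const_add (e.1 e.2 : ℝ)).sub_const (c e.2)).const_mul 2
  refine (((h2 _).comp u hq).mul h3).congr_deriv ?_
  simp only [Function.comp_apply]
  ring

theorem continuous_edgeSqDist {d : ℕ} (c : Fin d → ℝ) (e : (Fin d → ℤ) × Fin d) :
    Continuous (edgeSqDist c e) :=
  continuous_iff_continuousAt.2 fun u => (hasDerivAt_edgeSqDist c e u).continuousAt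

/-- The end of the edge before `v` in direction `i` is the start of the edge after `v`. -/
theorem edgePoint_sub_single {d : ℕ} (v : Fin d → ℤ) (i : Fin d) :
    edgePoint (v - Pi.single i 1) i 1 = edgePoint v i 0 := by
  refine Subtype.ext ?_
  ext j
  rw [edgePoint_apply, edgePoint_apply]
  by_cases h : j = i
  · subst h; simp
  · simp [h]

theorem edgePoint_zero {d : ℕ} (v : Fin d → ℤ) (i i' : Fin d) :
    edgePoint v i 0 = edgePoint v i' 0 := by
  refine Subtype.ext ?_
  ext j
  simp [edgePoint_apply]

theorem isCompact_cube {d : ℕ} (z : Fin d → ℝ) (ρ : ℝ) : IsCompact (cube z ρ) := by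
  have h1 : IsCompact (⋃ e ∈ cubeEdges z ρ, edgePoint e.1 e.2 '' Icc (0 : ℝ) 1) :=
    (cubeEdges z ρ).isCompact_biUnion fun e _ =>
      isCompact_Icc.image (continuous_edgePoint e.1 e.2)
  refine h1.of_isClosed_subset (isClosed_cube z ρ) fun y hy => ?_
  obtain ⟨v, i, u, hu, rfl⟩ := exists_edgePoint y
  have hu' : u ∈ Icc (0 : ℝ) 1 := ⟨hu.1, hu.2.le⟩
  exact mem_biUnion (mem_cubeEdges (e := (v, i)) hu' hy) ⟨u, hu', rfl⟩

/-! ### Supersolutions of the backward equation -/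

/-- A bounded smooth family `h s`, `s > 0`, satisfying the Kirchhoff conditions and
`h'' / 2 - ∂ h / ∂ s ≤ W s` is a supersolution of the backward equation up to the error `W`:
the integral of `h s₁` against `p T x` is at most `h (s₁ + T) x` plus the accumulated error. -/
theorem IsHeatKernel.integral_le_of_backward {d : ℕ} {p : ℝ → Point d → Point d → ℝ}
    (hp : IsHeatKernel d p) (x : Point d) {T s₁ : ℝ}
    (hT : 0 < T) (hs₁ : 0 < s₁) {h : ℝ → Point d → ℝ}
    {F F₁ F₂ Fs : (Fin d → ℤ) × Fin d → ℝ → ℝ → ℝ}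
    (hh : ∀ s > 0, Continuous (h s))
    (hK : ∀ s > 0, ∀ v, ∑ i, (F₁ (v, i) s 0 - F₁ (v - Pi.single i 1, i) s 1) = 0)
    (hF : ∀ e, ∀ s > 0, ∀ u, HasDerivAt (F e s) (F₁ e s u) u)
    (hF₁ : ∀ e, ∀ s > 0, ∀ u, HasDerivAt (F₁ e s) (F₂ e s u) u)
    (hFs : ∀ e, ∀ s > 0, ∀ u, HasDerivAt (fun s => F e s u) (Fs e s u) s)
    (hc₀ : ∀ e, ContinuousOn (Function.uncurry (F e)) (Ioi 0 ×ˢ univ))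
    (hc₁ : ∀ e, ContinuousOn (Function.uncurry (F₁ e)) (Ioi 0 ×ˢ univ))
    (hc₂ : ∀ e, ContinuousOn (Function.uncurry (F₂ e)) (Ioi 0 ×ˢ univ))
    (hcs : ∀ e, ContinuousOn (Function.uncurry (Fs e)) (Ioi 0 ×ˢ univ))
    (hhF : ∀ s > 0, ∀ e, ∀ u ∈ Icc (0 : ℝ) 1, h s (edgePoint e.1 e.2 u) = F e s u)
    {B : ℝ} (hB : ∀ s ∈ Icc s₁ (s₁ + T), ∀ e, ∀ u ∈ Icc (0 : ℝ) 1, |F e s u| ≤ B ∧ |F₁ e s u| ≤ B)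
    {W : ℝ → Point d → ℝ} (hWc : ∀ s ∈ Ioo s₁ (s₁ + T), Continuous (W s)) {B' : ℝ}
    (hWB : ∀ s ∈ Ioo s₁ (s₁ + T), ∀ y, 0 ≤ W s y ∧ W s y ≤ B')
    (hW : ∀ s ∈ Ioo s₁ (s₁ + T), ∀ e, ∀ u ∈ Icc (0 : ℝ) 1,
      (1 / 2) * F₂ e s u - Fs e s u ≤ W s (edgePoint e.1 e.2 u))
    {Ξ ε : ℝ → ℝ} (hΞc : ContinuousOn Ξ (Icc 0 T)) (hΞ : ∀ r ∈ Ioo 0 T, HasDerivAt Ξ (ε r) r)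
    (hle : ∀ r ∈ Ioo 0 T, ∫ y, W (s₁ + T - r) y ∂(transition p r x) ≤ ε r) :
    ∫ y, h s₁ y ∂(transition p T x) ≤ h (s₁ + T) x + (Ξ T - Ξ 0) := by
  obtain ⟨C, hC1, hC⟩ := exists_stepDeriv_bound
  have hB0 : 0 ≤ B := by
    obtain ⟨v, i, u, hu, hx⟩ := exists_edgePoint x
    exact (abs_nonneg _).trans (hB s₁ ⟨le_rfl, by linarith⟩ (v, i) 0 (by simp)).1
  have hFc : ∀ e, ∀ s > 0, Continuous (F e s) := fun e s hs =>
    continuous_iff_continuousAt.2 fun u => (hF e s hs u).continuousAt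
  have hFc₁ : ∀ e, ∀ s > 0, Continuous (F₁ e s) := fun e s hs =>
    continuous_iff_continuousAt.2 fun u => (hF₁ e s hs u).continuousAt
  -- the cutoff at distance `R` costs an error of order `1 / R`
  have key : ∀ R : ℝ, 1 ≤ R →
      ∫ y, Real.smoothTransition (2 - sqDist 0 y / R ^ 2) * h s₁ y ∂(transition p T x) ≤
        Real.smoothTransition (2 - sqDist 0 x / R ^ 2) * h (s₁ + T) x +
          (Ξ T - Ξ 0) + 13 * C * B / R * T := by
    intro R hR
    have hR0 : 0 < R := by linarith
    -- `φ (|y|²)` is `1` for `|y| ≤ R` and `0` for `|y| ≥ √2 R`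
    set φ : ℝ → ℝ := fun z => Real.smoothTransition (2 - z / R ^ 2) with hφ
    set φ₁ : ℝ → ℝ := fun z => stepDeriv (2 - z / R ^ 2) * (-1 / R ^ 2) with hφ₁
    set φ₂ : ℝ → ℝ := fun z => stepDeriv₂ (2 - z / R ^ 2) * (-1 / R ^ 2) * (-1 / R ^ 2) with hφ₂
    have hlin : ∀ z : ℝ, HasDerivAt (fun z : ℝ => 2 - z / R ^ 2) (-1 / R ^ 2) z := fun z => by
      simpa [neg_div] using ((hasDerivAt_id z).div_const (R ^ 2)).const_sub 2
    have hd1 : ∀ z, HasDerivAt φ (φ₁ z) z := fun z =>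
      (hasDerivAt_smoothTransition _).comp z (hlin z)
    have hd2 : ∀ z, HasDerivAt φ₁ (φ₂ z) z := fun z =>
      ((hasDerivAt_stepDeriv _).comp z (hlin z)).mul_const _
    set X : (Fin d → ℤ) × Fin d → ℝ → ℝ := fun e u => φ (edgeSqDist 0 e u) with hX
    set X₁ : (Fin d → ℤ) × Fin d → ℝ → ℝ := fun e u =>
      φ₁ (edgeSqDist 0 e u) * (2 * (e.1 e.2 + u - (0 : Fin d → ℝ) e.2)) with hX₁
    set X₂ : (Fin d → ℤ) × Fin d → ℝ → ℝ := fun e u =>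
      φ₂ (edgeSqDist 0 e u) * (2 * (e.1 e.2 + u - (0 : Fin d → ℝ) e.2)) ^ 2 +
        2 * φ₁ (edgeSqDist 0 e u) with hX₂
    have hXd : ∀ e u, HasDerivAt (X e) (X₁ e u) u := fun e u =>
      (hasDerivAt_comp_edgeSqDist 0 e hd1 hd2 u).1
    have hXd₁ : ∀ e u, HasDerivAt (X₁ e) (X₂ e u) u := fun e u =>
      (hasDerivAt_comp_edgeSqDist 0 e hd1 hd2 u).2
    have hXc : ∀ e, Continuous (X e) := fun e =>
      continuous_iff_continuousAt.2 fun u => (hXd e u).continuousAt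
    have hXc₁ : ∀ e, Continuous (X₁ e) := fun e =>
      continuous_iff_continuousAt.2 fun u => (hXd₁ e u).continuousAt
    have hXc₂ : ∀ e, Continuous (X₂ e) := fun e => by
      have h1 := continuous_edgeSqDist (0 : Fin d → ℝ) e
      have h2 := continuous_stepDeriv
      have h3 := continuous_stepDeriv₂
      simp only [hX₂, hφ₁, hφ₂]
      fun_prop
    have hφ₁b : ∀ z, |φ₁ z| ≤ C / R ^ 2 := fun z => by
      simp only [hφ₁, abs_mul, neg_div, abs_neg, abs_div, abs_one, abs_pow, abs_of_pos hR0]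
      rw [mul_one_div]
      gcongr
      exact (hC _).1
    have hφ₂b : ∀ z, |φ₂ z| ≤ C / R ^ 4 := fun z => by
      simp only [hφ₂, abs_mul, neg_div, abs_neg, abs_div, abs_one, abs_pow, abs_of_pos hR0]
      rw [mul_one_div, mul_one_div, div_div, ← pow_add]
      gcongr
      exact (hC _).2
    have hφc : Continuous φ := continuous_iff_continuousAt.2 fun z => (hd1 z).continuousAt
    have hφz : ∀ z, 2 * R ^ 2 < z → φ z = 0 ∧ φ₁ z = 0 ∧ φ₂ z = 0 := fun z hz => by
      have h1 : 2 - z / R ^ 2 < 0 := by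
        rw [sub_neg, lt_div_iff₀ (by positivity)]; exact hz
      have h2 : 2 - z / R ^ 2 ∉ Icc (0 : ℝ) 1 := fun h => absurd h.1 (not_le.2 h1)
      simp only [hφ, hφ₁, hφ₂, stepDeriv_eq_zero h2, stepDeriv₂_eq_zero h2, zero_mul,
        Real.smoothTransition.zero_of_nonpos h1.le, and_self]
    have hφ01 : ∀ z, 0 ≤ φ z ∧ φ z ≤ 1 := fun z =>
      ⟨Real.smoothTransition.nonneg _, Real.smoothTransition.le_one _⟩
    have hXb : ∀ e u, |X₁ e u| ≤ 3 * C / R ∧ |X₂ e u| ≤ 20 * C / R := by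
      intro e u
      simp only [hX₁, hX₂]
      rcases lt_or_ge (2 * R ^ 2) (edgeSqDist 0 e u) with hz | hz
      · obtain ⟨-, h1, h2⟩ := hφz _ hz
        rw [h1, h2]
        simp only [zero_mul, mul_zero, add_zero, abs_zero]
        exact ⟨by positivity, by positivity⟩
      · have h1 := (sq_le_edgeSqDist 0 e u).trans hz
        set w := (e.1 e.2 : ℝ) + u - (0 : Fin d → ℝ) e.2
        have h2 : |w| ≤ 3 / 2 * R := by
          refine abs_le_of_sq_le_sq ?_ (by positivity)
          nlinarith
        have h2w : |2 * w| = 2 * |w| := by rw [abs_mul, abs_two]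
        constructor
        · rw [abs_mul, h2w]
          calc _ ≤ C / R ^ 2 * (2 * (3 / 2 * R)) := by
                gcongr
                exact hφ₁b _
            _ = 3 * C / R := by field_simp
        · calc _ ≤ |φ₂ (edgeSqDist 0 e u)| * (2 * |w|) ^ 2 + 2 * |φ₁ (edgeSqDist 0 e u)| := by
                refine (abs_add_le _ _).trans (le_of_eq ?_)
                rw [abs_mul, abs_pow, h2w, abs_mul 2, abs_two]
            _ ≤ C / R ^ 4 * (2 * (3 / 2 * R)) ^ 2 + 2 * (C / R ^ 2) := by
                gcongr
                · exact hφ₂b _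
                · exact hφ₁b _
            _ = 11 * C / R ^ 2 := by field_simp; ring
            _ ≤ 20 * C / R := by
                rw [div_le_div_iff₀ (by positivity) hR0]
                nlinarith [mul_pos (show 0 < C by linarith) hR0, mul_le_mul_of_nonneg_left hR (mul_pos (show 0 < C by linarith) hR0).le]
    -- the derivative of the cutoff is continuous across a vertex in each direction, which preserves the
    -- Kirchhoff condition for the product
    have hXK : ∀ v i, X₁ (v, i) 0 = X₁ (v - Pi.single i 1, i) 1 ∧
        X (v, i) 0 = X (v - Pi.single i 1, i) 1 := by
      intro v i
      have h1 : edgeSqDist (0 : Fin d → ℝ) (v, i) 0 = edgeSqDist 0 (v - Pi.single i 1, i) 1 := by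
        rw [← sqDist_edgePoint, ← sqDist_edgePoint, edgePoint_sub_single]
      simp only [hX₁, hX, h1]
      simp
    have hsupp : ∀ y, y ∉ cube (0 : Fin d → ℝ) (2 * R) → 2 * R ^ 2 < sqDist 0 y := by
      intro y hy
      simp only [cube, mem_ofPred_eq, not_forall, not_le] at hy
      obtain ⟨j, hj⟩ := hy
      have h1 : ((y : EuclideanSpace ℝ (Fin d)) j - (0 : Fin d → ℝ) j) ^ 2 ≤ sqDist 0 y :=
        Finset.single_le_sum
          (f := fun j => ((y : EuclideanSpace ℝ (Fin d)) j - (0 : Fin d → ℝ) j) ^ 2)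
          (fun _ _ => sq_nonneg _) (Finset.mem_univ j)
      have h2 : (2 * R) ^ 2 < ((y : EuclideanSpace ℝ (Fin d)) j - (0 : Fin d → ℝ) j) ^ 2 := by
        rw [← sq_abs (_ - _)]
        exact pow_lt_pow_left₀ hj (by positivity) two_ne_zero
      nlinarith
    have hmain := hp.integral_le_of_backward_compact x hT hs₁
      (h := fun s y => φ (sqDist 0 y) * h s y)
      (F := fun e s u => X e u * F e s u)
      (F₁ := fun e s u => X₁ e u * F e s u + X e u * F₁ e s u)
      (F₂ := fun e s u => (X₂ e u * F e s u + X₁ e u * F₁ e s u) +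
        (X₁ e u * F₁ e s u + X e u * F₂ e s u))
      (Fs := fun e s u => X e u * Fs e s u) (cubeEdges (0 : Fin d → ℝ) (2 * R))
      (Ξ := fun r => Ξ r + 13 * C * B / R * r) (ε := fun r => ε r + 13 * C * B / R)
      ?_ ?_ ?_ ?_ ?_ ?_ ?_ ?_ ?_ ?_ ?_
    · refine hmain.trans (le_of_eq ?_)
      simp only [hφ]
      ring
    · intro s hs
      refine isTestFunction_of_edges (F := fun e u => X e u * F e s u)
        (F₁ := fun e u => X₁ e u * F e s u + X e u * F₁ e s u)
        (F₂ := fun e u => (X₂ e u * F e s u + X₁ e u * F₁ e s u) +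
          (X₁ e u * F₁ e s u + X e u * F₂ e s u)) ?_ ?_ ?_ ?_ ?_ ?_ ?_
      · exact (hφc.comp (continuous_sqDist 0)).mul (hh s hs)
      · refine HasCompactSupport.intro (isCompact_cube (0 : Fin d → ℝ) (2 * R)) fun y hy => ?_
        simp only [(hφz _ (hsupp y hy)).1, zero_mul]
      · exact fun e u => (hXd e u).mul (hF e s hs u)
      · exact fun e u => ((hXd₁ e u).mul (hF e s hs u)).add ((hXd e u).mul (hF₁ e s hs u))
      · intro e
        have h2 : Continuous (F₂ e s) :=
          (hc₂ e).comp_continuous (f := fun u => (s, u)) (by fun_prop) fun u => ⟨hs, trivial⟩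
        exact (((hXc₂ e).mul (hFc e s hs)).add ((hXc₁ e).mul (hFc₁ e s hs))).add
          (((hXc₁ e).mul (hFc₁ e s hs)).add ((hXc e).mul h2))
      · intro e u hu
        simp only [sqDist_edgePoint, hhF s hs e u hu, hX]
      · intro v
        have hv : ∀ i, F (v - Pi.single i 1, i) s 1 = F (v, i) s 0 := fun i => by
          rw [← hhF s hs _ 1 (by simp), ← hhF s hs _ 0 (by simp), edgePoint_sub_single]
        have hXv : ∀ i i', X (v, i) 0 = X (v, i') 0 := fun i i' => by
          simp only [hX, ← sqDist_edgePoint]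
          rw [edgePoint_zero v i i']
        rcases isEmpty_or_nonempty (Fin d) with hd | ⟨⟨i₀⟩⟩
        · simp
        · calc _ = ∑ i, X (v, i₀) 0 * (F₁ (v, i) s 0 - F₁ (v - Pi.single i 1, i) s 1) := by
                refine Finset.sum_congr rfl fun i _ => ?_
                rw [← (hXK v i).1, ← (hXK v i).2, hv, hXv i i₀]
                ring
            _ = 0 := by rw [← Finset.mul_sum, hK s hs v, mul_zero]
    · exact fun e s hs u => (hXd e u).mul (hF e s hs u)
    · exact fun e s hs u => ((hXd₁ e u).mul (hF e s hs u)).add ((hXd e u).mul (hF₁ e s hs u))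
    · exact fun e s hs u => (hFs e s hs u).const_mul _
    · intro e
      have h0 : ContinuousOn (fun q : ℝ × ℝ => X e q.2) (Ioi 0 ×ˢ univ) :=
        ((hXc e).comp continuous_snd).continuousOn
      have h1 : ContinuousOn (fun q : ℝ × ℝ => X₁ e q.2) (Ioi 0 ×ˢ univ) :=
        ((hXc₁ e).comp continuous_snd).continuousOn
      have h2 : ContinuousOn (fun q : ℝ × ℝ => X₂ e q.2) (Ioi 0 ×ˢ univ) :=
        ((hXc₂ e).comp continuous_snd).continuousOn
      exact ((h2.mul (hc₀ e)).add (h1.mul (hc₁ e))).add ((h1.mul (hc₁ e)).add (h0.mul (hc₂ e)))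
    · intro e
      exact (((hXc e).comp continuous_snd).continuousOn).mul (hcs e)
    · intro s hs e u hu
      simp only [sqDist_edgePoint, hhF s hs e u hu, hX]
    · intro e he s hs u hu
      have h1 := hφz _ (hsupp (edgePoint e.1 e.2 u) fun hy => he (mem_cubeEdges hu hy))
      rw [sqDist_edgePoint] at h1
      simp only [hX, hX₁, hX₂, h1.1, h1.2.1, h1.2.2]
      simp
    · exact hΞc.add (by fun_prop)
    · intro r hr
      simpa using (hΞ r hr).fun_add ((hasDerivAt_id r).const_mul (13 * C * B / R))
    · intro r hr
      have hs : s₁ + T - r ∈ Ioo s₁ (s₁ + T) := ⟨by linarith [hr.2], by linarith [hr.1]⟩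
      have hs0 : 0 < s₁ + T - r := hs₁.trans hs.1
      -- the terms in which the cutoff is differentiated contribute the constant `c`
      set s := s₁ + T - r
      set c := 13 * C * B / R with hc
      have hc0 : 0 ≤ c := by positivity
      have hfin := hp.isFiniteMeasure_transition hr.1 x
      calc _ ≤ ∑ e ∈ cubeEdges (0 : Fin d → ℝ) (2 * R), ∫ u in (0 : ℝ)..1,
            p r x (edgePoint e.1 e.2 u) * (W s (edgePoint e.1 e.2 u) + c) := by
            refine Finset.sum_le_sum fun e _ => intervalIntegral.integral_mono_on zero_le_one
              (hp.intervalIntegrable_edge x hr.1 e ?_ 0 1)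
              (hp.intervalIntegrable_edge x hr.1 e ?_ 0 1) fun u hu =>
              mul_le_mul_of_nonneg_left ?_ (hp.nonneg r hr.1 _ _)
            · have h2 : Continuous (F₂ e s) :=
                (hc₂ e).comp_continuous (f := fun u => (s, u)) (by fun_prop) fun u => ⟨hs0, trivial⟩
              have h3 : Continuous (Fs e s) :=
                (hcs e).comp_continuous (f := fun u => (s, u)) (by fun_prop) fun u => ⟨hs0, trivial⟩
              exact (continuous_const.mul ((((hXc₂ e).mul (hFc e s hs0)).add
                ((hXc₁ e).mul (hFc₁ e s hs0))).add (((hXc₁ e).mul (hFc₁ e s hs0)).add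
                ((hXc e).mul h2)))).sub ((hXc e).mul h3)
            · exact ((hWc s hs).comp (continuous_edgePoint e.1 e.2)).add continuous_const
            · have hb := hB s ⟨hs.1.le, hs.2.le⟩ e u hu
              have e1 : X₂ e u * F e s u ≤ 20 * C / R * B := (le_abs_self _).trans (by
                rw [abs_mul]; gcongr; exacts [(hXb e u).2, hb.1])
              have e2 : X₁ e u * F₁ e s u ≤ 3 * C / R * B := (le_abs_self _).trans (by
                rw [abs_mul]; gcongr; exacts [(hXb e u).1, hb.2])
              have e3 : X e u * ((1 / 2) * F₂ e s u - Fs e s u) ≤ W s (edgePoint e.1 e.2 u) :=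
                (mul_le_mul_of_nonneg_left (hW s hs e u hu) (hφ01 _).1).trans
                  (mul_le_of_le_one_left (hWB s hs _).1 (hφ01 _).2)
              have e4 : c = (1 / 2) * (20 * C / R * B) + 3 * C / R * B := by rw [hc]; ring
              rw [e4]
              linarith
        _ ≤ ∫ y, (W s y + c) ∂(transition p r x) :=
            hp.sum_integral_edge_le x hr.1 _ ((hWc s hs).add continuous_const)
              (fun y => add_nonneg (hWB s hs y).1 hc0) (B := B' + c)
              fun y => add_le_add_left (hWB s hs y).2 c
        _ = ∫ y, W s y ∂(transition p r x) + (transition p r x).real univ * c := by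
            rw [integral_add (hp.integrable_transition hr.1 x (hWc s hs) (B := B') fun y => by
              rw [abs_of_nonneg (hWB s hs y).1]; exact (hWB s hs y).2) (integrable_const _)]
            simp
        _ ≤ ε r + c := by
            refine add_le_add (hle r hr) (mul_le_of_le_one_left hc0 ?_)
            rw [measureReal_def]
            exact ENNReal.toReal_le_of_le_ofReal zero_le_one
              (by simpa using hp.transition_univ_le hr.1 x)
  -- remove the cutoff
  have hlim : ∀ y : Point d, ∀ᶠ n : ℕ in atTop,
      Real.smoothTransition (2 - sqDist 0 y / ((n : ℝ) + 1) ^ 2) = 1 := by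
    intro y
    obtain ⟨n₀, hn₀⟩ := exists_nat_ge (sqDist 0 y)
    filter_upwards [eventually_ge_atTop n₀] with n hn
    refine Real.smoothTransition.one_of_one_le ?_
    have h1 : sqDist 0 y ≤ ((n : ℝ) + 1) ^ 2 := by
      have : (n₀ : ℝ) ≤ n := by exact_mod_cast hn
      have h0 : (0 : ℝ) ≤ n := n.cast_nonneg
      nlinarith
    have h2 : sqDist 0 y / ((n : ℝ) + 1) ^ 2 ≤ 1 := div_le_one_of_le₀ h1 (by positivity)
    linarith
  have hfin := hp.isFiniteMeasure_transition hT x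
  have hbound : ∀ y, |h s₁ y| ≤ B := fun y => by
    obtain ⟨v, i, u, hu, rfl⟩ := exists_edgePoint y
    rw [hhF s₁ hs₁ (v, i) u ⟨hu.1, hu.2.le⟩]
    exact (hB s₁ ⟨le_rfl, by linarith⟩ (v, i) u ⟨hu.1, hu.2.le⟩).1
  have hL : Tendsto (fun n : ℕ => ∫ y, Real.smoothTransition
      (2 - sqDist 0 y / ((n : ℝ) + 1) ^ 2) * h s₁ y ∂(transition p T x)) atTop
      (𝓝 (∫ y, h s₁ y ∂(transition p T x))) := by
    refine tendsto_integral_of_dominated_convergence (fun _ => B) (fun n => ?_)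
      (integrable_const _) (fun n => ae_of_all _ fun y => ?_) (ae_of_all _ fun y => ?_)
    · refine Continuous.aestronglyMeasurable (Continuous.mul ?_ (hh s₁ hs₁))
      exact Real.smoothTransition.continuous.comp
        (continuous_const.sub ((continuous_sqDist 0).div_const _))
    · rw [norm_mul, Real.norm_eq_abs, Real.norm_eq_abs,
        abs_of_nonneg (Real.smoothTransition.nonneg _)]
      exact (mul_le_of_le_one_left (abs_nonneg _) (Real.smoothTransition.le_one _)).trans (hbound y)
    · refine tendsto_const_nhds.congr' ?_
      filter_upwards [hlim y] with n hn
      rw [hn, one_mul]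
  have hRlim : Tendsto (fun n : ℕ => Real.smoothTransition
      (2 - sqDist 0 x / ((n : ℝ) + 1) ^ 2) * h (s₁ + T) x + (Ξ T - Ξ 0) +
        13 * C * B / ((n : ℝ) + 1) * T) atTop (𝓝 (h (s₁ + T) x + (Ξ T - Ξ 0) + 0 * T)) := by
    refine (Tendsto.add_const _ ?_).add (Tendsto.mul_const _ ?_)
    · refine tendsto_const_nhds.congr' ?_
      filter_upwards [hlim x] with n hn
      rw [hn, one_mul]
    · have := (tendsto_one_div_add_atTop_nhds_zero_nat (𝕜 := ℝ)).const_mul (13 * C * B)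
      simpa [div_eq_mul_inv] using this
  have hfinal := le_of_tendsto_of_tendsto' hL hRlim fun n =>
    key ((n : ℝ) + 1) (by linarith [(n.cast_nonneg : (0 : ℝ) ≤ n)])
  simpa using hfinal

/-! ### Tails of the transition probabilities -/

theorem sqDist_coord {d : ℕ} (x y : Point d) :
    sqDist (fun j => (x : EuclideanSpace ℝ (Fin d)) j) y = dist x y ^ 2 := by
  rw [dist_comm, dist_sq_eq]
  rfl

theorem IsHeatKernel.transition_real_le_one {d : ℕ} {p : ℝ → Point d → Point d → ℝ}
    (hp : IsHeatKernel d p) {t : ℝ} (ht : 0 < t) (x : Point d) (B : Set (Point d)) :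
    (transition p t x).real B ≤ 1 := by
  rw [measureReal_def]
  exact ENNReal.toReal_le_of_le_ofReal zero_le_one
    (by simpa using (measure_mono (subset_univ B)).trans (hp.transition_univ_le ht x))

/-- If `f ≤ 1` vanishes outside of `B`, its integral is at most the measure of `B`. -/
theorem integral_le_measureReal {X : Type*} [MeasurableSpace X] {κ : Measure X} [IsFiniteMeasure κ]
    {f : X → ℝ} {B : Set X} (hB : MeasurableSet B) (h1 : ∀ y, f y ≤ 1)
    (hf : Integrable f κ) (hfB : ∀ y ∉ B, f y ≤ 0) : ∫ y, f y ∂κ ≤ κ.real B := by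
  calc ∫ y, f y ∂κ ≤ ∫ y, B.indicator (fun _ => (1 : ℝ)) y ∂κ := by
        refine integral_mono hf ((integrable_const _).indicator hB) fun y => ?_
        by_cases hy : y ∈ B
        · simpa [hy] using h1 y
        · simpa [hy] using hfB y hy
    _ = κ.real B := by rw [integral_indicator hB]; simp

theorem measureReal_le_integral {X : Type*} [MeasurableSpace X] {κ : Measure X} [IsFiniteMeasure κ]
    {f : X → ℝ} {B : Set X} (hB : MeasurableSet B) (h0 : ∀ y, 0 ≤ f y)
    (hf : Integrable f κ) (hfB : ∀ y ∈ B, 1 ≤ f y) : κ.real B ≤ ∫ y, f y ∂κ := by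
  calc κ.real B = ∫ y, B.indicator (fun _ => (1 : ℝ)) y ∂κ := by rw [integral_indicator hB]; simp
    _ ≤ _ := by
        refine integral_mono ((integrable_const _).indicator hB) hf fun y => ?_
        by_cases hy : y ∈ B
        · simpa [hy] using hfB y hy
        · simpa [hy] using h0 y

theorem measurableSet_le_dist {d : ℕ} (x : Point d) (lam : ℝ) :
    MeasurableSet {y | lam ≤ dist x y} :=
  measurableSet_le measurable_const (continuous_const.dist continuous_id).measurable

/-- One step of the tail estimate: to be at distance `lam` at time `t`, the motion has to spend
time at distance more than `lam / 4`. -/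
theorem IsHeatKernel.tail_step {d : ℕ} {C : ℝ} (hC1 : 1 ≤ C)
    (hC : ∀ z, |stepDeriv z| ≤ C ∧ |stepDeriv₂ z| ≤ C) {p : ℝ → Point d → Point d → ℝ}
    (hp : IsHeatKernel d p) (x : Point d) {t lam : ℝ} (ht : 0 < t) (hlam : 0 < lam)
    {K : ℝ} {M : ℕ} (hK : ∀ r ∈ Ioo 0 t, (transition p r x).real {y | lam / 4 ≤ dist x y} ≤ K * r ^ M)
    (hK0 : 0 ≤ K) :
    (transition p t x).real {y | lam ≤ dist x y} ≤ 5 * C / lam ^ 2 * K * t ^ (M + 1) := by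
  -- `φ (|y - x|²)` rises from `0` to `1` when the distance grows from `lam / 2` to `lam`; its second
  -- derivatives, of order `lam⁻²`, are dominated by `W`, which is supported at distances above `lam / 4`.
  set c : Fin d → ℝ := fun j => (x : EuclideanSpace ℝ (Fin d)) j with hc
  set φ : ℝ → ℝ := fun z => Real.smoothTransition ((4 * z / lam ^ 2 - 1) / 3) with hφ
  set φ₁ : ℝ → ℝ := fun z => stepDeriv ((4 * z / lam ^ 2 - 1) / 3) * (4 / lam ^ 2 / 3) with hφ₁
  set φ₂ : ℝ → ℝ := fun z =>
    stepDeriv₂ ((4 * z / lam ^ 2 - 1) / 3) * (4 / lam ^ 2 / 3) * (4 / lam ^ 2 / 3) with hφ₂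
  have hlin : ∀ z : ℝ, HasDerivAt (fun z : ℝ => (4 * z / lam ^ 2 - 1) / 3) (4 / lam ^ 2 / 3) z :=
    fun z => by
      simpa using ((((hasDerivAt_id z).const_mul 4).div_const (lam ^ 2)).sub_const 1).div_const 3
  have hd1 : ∀ z, HasDerivAt φ (φ₁ z) z := fun z => (hasDerivAt_smoothTransition _).comp z (hlin z)
  have hd2 : ∀ z, HasDerivAt φ₁ (φ₂ z) z := fun z =>
    ((hasDerivAt_stepDeriv _).comp z (hlin z)).mul_const _
  have hφ₁b : ∀ z, |φ₁ z| ≤ C * (4 / lam ^ 2 / 3) := fun z => by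
    simp only [hφ₁]
    rw [abs_mul, abs_of_pos (show 0 < 4 / lam ^ 2 / 3 by positivity)]
    gcongr
    exact (hC _).1
  have hφ₂b : ∀ z, |φ₂ z| ≤ C * (4 / lam ^ 2 / 3) * (4 / lam ^ 2 / 3) := fun z => by
    simp only [hφ₂]
    rw [abs_mul, abs_mul, abs_of_pos (show 0 < 4 / lam ^ 2 / 3 by positivity)]
    gcongr
    exact (hC _).2
  have hφz : ∀ z, z < lam ^ 2 / 4 ∨ lam ^ 2 < z → φ₁ z = 0 ∧ φ₂ z = 0 := fun z hz => by
    have h2 : (4 * z / lam ^ 2 - 1) / 3 ∉ Icc (0 : ℝ) 1 := by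
      rintro ⟨h3, h4⟩
      have h5 : 1 ≤ 4 * z / lam ^ 2 := by linarith
      have h6 : 4 * z / lam ^ 2 ≤ 4 := by linarith
      rw [le_div_iff₀ (by positivity)] at h5
      rw [div_le_iff₀ (by positivity)] at h6
      rcases hz with hz | hz <;> linarith
    simp only [hφ₁, hφ₂, stepDeriv_eq_zero h2, stepDeriv₂_eq_zero h2, zero_mul, and_self]
  set W : Point d → ℝ := fun y =>
    5 * C / lam ^ 2 * Real.smoothTransition ((16 * sqDist c y / lam ^ 2 - 1) / 3) with hW
  have hWc : Continuous W := by
    have := continuous_sqDist c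
    have := Real.smoothTransition.continuous
    simp only [hW]
    fun_prop
  have hsmall : ∀ (e : (Fin d → ℤ) × Fin d) (u : ℝ), edgeSqDist c e u ≤ lam ^ 2 →
      |2 * (e.1 e.2 + u - c e.2)| ≤ 2 * lam := fun e u hz => by
    have h1 := (sq_le_edgeSqDist c e u).trans hz
    rw [abs_mul, abs_two]
    gcongr
    exact abs_le_of_sq_le_sq h1 hlam.le
  have hsq : ∀ y, sqDist c y = dist x y ^ 2 := sqDist_coord x
  have hfin := hp.isFiniteMeasure_transition ht x
  have h01 : ∀ y, 0 ≤ φ (sqDist c y) ∧ φ (sqDist c y) ≤ 1 := fun y =>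
    ⟨Real.smoothTransition.nonneg _, Real.smoothTransition.le_one _⟩
  have hφc : Continuous fun y => φ (sqDist c y) :=
    (continuous_iff_continuousAt.2 fun z => (hd1 z).continuousAt).comp (continuous_sqDist c)
  have hφc₀ : Continuous φ := continuous_iff_continuousAt.2 fun z => (hd1 z).continuousAt
  have hsnd : ∀ {φ : ℝ → ℝ}, Continuous φ →
      ContinuousOn (Function.uncurry fun _ : ℝ => φ) (Ioi 0 ×ˢ univ) := fun h =>
    (h.comp continuous_snd).continuousOn
  have hdc : ∀ e u, _ := fun (e : (Fin d → ℤ) × Fin d) u => hasDerivAt_comp_edgeSqDist c e hd1 hd2 u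
  have hmain := hp.integral_le_of_backward x ht one_pos (h := fun _ y => φ (sqDist c y))
    (F := fun e _ u => φ (edgeSqDist c e u))
    (F₁ := fun e _ u => φ₁ (edgeSqDist c e u) * (2 * (e.1 e.2 + u - c e.2)))
    (F₂ := fun e _ u => φ₂ (edgeSqDist c e u) * (2 * (e.1 e.2 + u - c e.2)) ^ 2 +
      2 * φ₁ (edgeSqDist c e u)) (Fs := fun _ _ _ => 0)
    (B := max 1 (C * (4 / lam ^ 2 / 3) * (2 * lam)))
    (W := fun _ => W) (B' := 5 * C / lam ^ 2)
    (Ξ := fun r => 5 * C / lam ^ 2 * K * r ^ (M + 1))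
    (ε := fun r => 5 * C / lam ^ 2 * K * ((M + 1 : ℕ) * r ^ M))
    (fun _ _ => hφc) ?_ (fun e _ _ u => (hdc e u).1) (fun e _ _ u => (hdc e u).2)
    (fun e _ _ u => hasDerivAt_const _ _)
    (fun e => hsnd (continuous_iff_continuousAt.2 fun u => (hdc e u).1.continuousAt))
    (fun e => hsnd (continuous_iff_continuousAt.2 fun u => (hdc e u).2.continuousAt))
    (fun e => hsnd ?_) (fun e => continuousOn_const) (fun _ _ _ _ _ => rfl) ?_ (fun _ _ => hWc)
    ?_ ?_ (by fun_prop) ?_ ?_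
  · have h0 : φ (sqDist c x) = 0 := by
      rw [hsq, dist_self]
      refine Real.smoothTransition.zero_of_nonpos ?_
      norm_num
    simp only [h0, ne_eq, Nat.add_eq_zero_iff, one_ne_zero, and_false, not_false_eq_true, zero_pow,
      mul_zero, sub_zero, zero_add] at hmain
    refine le_trans (measureReal_le_integral (measurableSet_le_dist x lam) (fun y => (h01 y).1)
      (hp.integrable_transition ht x hφc (B := 1) fun y => by
        rw [abs_of_nonneg (h01 y).1]; exact (h01 y).2) fun y hy => ?_) hmain
    refine le_of_eq (Real.smoothTransition.one_of_one_le ?_).symm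
    have h3 : 4 ≤ 4 * sqDist c y / lam ^ 2 := by
      rw [le_div_iff₀ (by positivity), hsq]
      have : lam ^ 2 ≤ dist x y ^ 2 := pow_le_pow_left₀ hlam.le hy 2
      linarith
    linarith
  · intro s _ v
    refine Finset.sum_eq_zero fun i _ => ?_
    have h1 : edgeSqDist c (v - Pi.single i 1, i) 1 = edgeSqDist c (v, i) 0 := by
      rw [← sqDist_edgePoint, ← sqDist_edgePoint, edgePoint_sub_single]
    simp [h1]
  · have := continuous_edgeSqDist c e
    have := continuous_stepDeriv
    have := continuous_stepDeriv₂
    simp only [hφ₁, hφ₂]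
    fun_prop
  · intro s _ e u hu
    refine ⟨?_, ?_⟩
    · rw [← sqDist_edgePoint, abs_of_nonneg (h01 _).1]
      exact (h01 _).2.trans (le_max_left _ _)
    · refine le_trans ?_ (le_max_right _ _)
      rcases le_or_gt (edgeSqDist c e u) (lam ^ 2) with hz | hz
      · rw [abs_mul]
        exact mul_le_mul (hφ₁b _) (hsmall e u hz) (abs_nonneg _) (by positivity)
      · rw [(hφz _ (Or.inr hz)).1, zero_mul, abs_zero]
        positivity
  · intro s _ y
    exact ⟨mul_nonneg (by positivity) (Real.smoothTransition.nonneg _),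
      mul_le_of_le_one_right (by positivity) (Real.smoothTransition.le_one _)⟩
  · intro s _ e u hu
    have hW0 : 0 ≤ W (edgePoint e.1 e.2 u) :=
      mul_nonneg (by positivity) (Real.smoothTransition.nonneg _)
    by_cases hz : edgeSqDist c e u < lam ^ 2 / 4 ∨ lam ^ 2 < edgeSqDist c e u
    · rw [(hφz _ hz).1, (hφz _ hz).2]
      simpa using hW0
    · push Not at hz
      have h1 : W (edgePoint e.1 e.2 u) = 5 * C / lam ^ 2 := by
        simp only [hW, sqDist_edgePoint]
        rw [Real.smoothTransition.one_of_one_le, mul_one]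
        have : 4 ≤ 16 * edgeSqDist c e u / lam ^ 2 := by
          rw [le_div_iff₀ (by positivity)]
          linarith
        linarith
      rw [h1]
      have h2 := pow_le_pow_left₀ (abs_nonneg _) (hsmall e u hz.2) 2
      have h3 : φ₂ (edgeSqDist c e u) * (2 * (e.1 e.2 + u - c e.2)) ^ 2 ≤
          C * (4 / lam ^ 2 / 3) * (4 / lam ^ 2 / 3) * (2 * lam) ^ 2 := by
        refine (le_abs_self _).trans ?_
        rw [abs_mul, abs_pow]
        gcongr
        exact hφ₂b _
      have h4 := (le_abs_self _).trans (hφ₁b (edgeSqDist c e u))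
      have h5 : (1 / 2) * (C * (4 / lam ^ 2 / 3) * (4 / lam ^ 2 / 3) * (2 * lam) ^ 2 +
          2 * (C * (4 / lam ^ 2 / 3))) = 44 / 9 * C / lam ^ 2 := by field_simp; ring
      have h6 : 44 / 9 * C / lam ^ 2 ≤ 5 * C / lam ^ 2 := by gcongr; norm_num
      linarith
  · intro r hr
    exact (hasDerivAt_pow (M + 1) r).const_mul _
  · intro r hr
    have hfin := hp.isFiniteMeasure_transition hr.1 x
    have h1 : ∫ y, Real.smoothTransition ((16 * sqDist c y / lam ^ 2 - 1) / 3)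
        ∂(transition p r x) ≤ (transition p r x).real {y | lam / 4 ≤ dist x y} := by
      have h2 : Continuous fun y : Point d =>
          Real.smoothTransition ((16 * sqDist c y / lam ^ 2 - 1) / 3) := by
        have := continuous_sqDist c
        have := Real.smoothTransition.continuous
        fun_prop
      refine integral_le_measureReal (measurableSet_le_dist x _)
        (fun y => Real.smoothTransition.le_one _)
        (hp.integrable_transition hr.1 x h2 (B := 1) fun y => ?_) fun y hy => ?_
      · rw [abs_of_nonneg (Real.smoothTransition.nonneg _)]
        exact Real.smoothTransition.le_one _
      · refine le_of_eq (Real.smoothTransition.zero_of_nonpos ?_)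
        have h3 : dist x y < lam / 4 := not_le.1 hy
        have h4 : dist x y ^ 2 ≤ (lam / 4) ^ 2 := pow_le_pow_left₀ dist_nonneg h3.le 2
        have h5 : 16 * sqDist c y / lam ^ 2 ≤ 1 := by
          rw [div_le_one (by positivity), hsq]
          nlinarith
        linarith
    simp only [hW]
    rw [integral_const_mul, mul_assoc (5 * C / lam ^ 2)]
    refine mul_le_mul_of_nonneg_left ((h1.trans (hK r hr)).trans ?_) (by positivity)
    refine mul_le_mul_of_nonneg_left ?_ hK0
    have : (1 : ℝ) ≤ (M + 1 : ℕ) := by exact_mod_cast Nat.le_add_left 1 M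
    nlinarith [pow_nonneg hr.1.le M]

/-- The motion is at distance `lam` from its starting point at time `t` with a probability of at
most `C (t / lam ^ 2) ^ M`, at all scales and for all `M`. -/
theorem exists_tail_bound (d M : ℕ) : ∃ C : ℝ, 1 ≤ C ∧ ∀ p : ℝ → Point d → Point d → ℝ,
    IsHeatKernel d p → ∀ t > 0, ∀ x, ∀ lam > 0,
      (transition p t x).real {y | lam ≤ dist x y} ≤ C * (t / lam ^ 2) ^ M := by
  obtain ⟨C, hC1, hC⟩ := exists_stepDeriv_bound
  induction M with
  | zero => exact ⟨1, le_rfl, fun p hp t ht x lam _ => by simpa using hp.transition_real_le_one ht x _⟩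
  | succ M ih =>
    obtain ⟨K, hK1, hK⟩ := ih
    have h16 : (1 : ℝ) ≤ 16 ^ M := one_le_pow₀ (by norm_num)
    refine ⟨5 * C * (K * 16 ^ M), by nlinarith [mul_le_mul hK1 h16 zero_le_one (by linarith)],
      fun p hp t ht x lam hlam => ?_⟩
    have h1 := hp.tail_step hC1 hC x ht hlam (K := K * (16 / lam ^ 2) ^ M) (M := M)
      (fun r hr => ?_) (by positivity)
    · refine h1.trans (le_of_eq ?_)
      rw [div_pow, div_pow, pow_succ (lam ^ 2)]
      field_simp
    · refine (hK p hp r hr.1 x (lam / 4) (by positivity)).trans (le_of_eq ?_)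
      rw [mul_assoc, ← mul_pow]
      congr 2
      field_simp
      norm_num

/-! ### Covering by cubes -/

/-- A bound on the mass of all cubes of half-side `L` gives one for larger cubes, by covering. -/
theorem measureReal_cube_le {d : ℕ} {κ : Measure (Point d)} [IsFiniteMeasure κ] {L σ : ℝ}
    (hL : 0 < L) (hσ : ∀ z, κ.real (cube z L) ≤ σ) (z : Fin d → ℝ) {ρ : ℝ} (hρ : 0 ≤ ρ) :
    κ.real (cube z ρ) ≤ (2 * (ρ / L) + 2) ^ d * σ := by
  set G : Finset (Fin d → ℤ) := Fintype.piFinset fun _ => Finset.Icc ⌊-(ρ / L)⌋ ⌊ρ / L⌋ with hG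
  have hσ0 : 0 ≤ σ := measureReal_nonneg.trans (hσ 0)
  have hsub : cube z ρ ⊆ ⋃ k ∈ G, cube (d := d) (fun j => z j + L * k j) L := by
    intro y hy
    set k : Fin d → ℤ := fun j => ⌊((y : EuclideanSpace ℝ (Fin d)) j - z j) / L⌋ with hk
    refine mem_biUnion (x := k) ?_ fun j => ?_
    · refine Finset.mem_coe.2 (Fintype.mem_piFinset.2 fun j => Finset.mem_Icc.2 ?_)
      have h1 := abs_le.1 (hy j)
      refine ⟨Int.floor_le_floor ?_, Int.floor_le_floor ?_⟩
      · rw [← neg_div]; gcongr; exact h1.1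
      · gcongr; exact h1.2
    · have h1 := Int.floor_le (((y : EuclideanSpace ℝ (Fin d)) j - z j) / L)
      have h2 := (Int.lt_floor_add_one (((y : EuclideanSpace ℝ (Fin d)) j - z j) / L)).le
      rw [le_div_iff₀ hL] at h1
      rw [div_le_iff₀ hL] at h2
      simp only [hk]
      rw [abs_le]
      constructor <;> nlinarith
  have hcard : (G.card : ℝ) ≤ (2 * (ρ / L) + 2) ^ d := by
    rw [hG, Fintype.card_piFinset]
    simp only [Finset.prod_const, Finset.card_univ, Fintype.card_fin, Nat.cast_pow]
    gcongr
    rw [Int.card_Icc]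
    have h1 := Int.floor_le (ρ / L)
    have h2 := Int.lt_floor_add_one (-(ρ / L))
    have h3 : (((⌊ρ / L⌋ + 1 - ⌊-(ρ / L)⌋).toNat : ℤ) : ℝ) ≤ 2 * (ρ / L) + 2 := by
      rw [Int.toNat_eq_max]
      push_cast
      have : 0 ≤ ρ / L := by positivity
      exact max_le (by linarith) (by linarith)
    exact_mod_cast h3
  calc κ.real (cube z ρ) ≤ κ.real (⋃ k ∈ G, cube (d := d) (fun j => z j + L * k j) L) :=
        measureReal_mono hsub (measure_ne_top _ _)
    _ ≤ ∑ k ∈ G, κ.real (cube (d := d) (fun j => z j + L * k j) L) :=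
        measureReal_biUnion_finset_le _ _
    _ ≤ ∑ _k ∈ G, σ := Finset.sum_le_sum fun k _ => hσ _
    _ = G.card * σ := by simp
    _ ≤ _ := by gcongr

/-- If the cubes of half-side `L` have measure at most `σ`, then a Gaussian at scale `√s ≥ L`
has integral of order `(√s / L) ^ d * σ`. -/
theorem exists_integral_gaussian_le (d : ℕ) : ∃ K : ℝ, 1 ≤ K ∧ ∀ (κ : Measure (Point d))
    [IsFiniteMeasure κ] (L σ : ℝ), 0 < L → (∀ z, κ.real (cube z L) ≤ σ) →
    ∀ (z : Fin d → ℝ) (s : ℝ), L ^ 2 ≤ s →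
      ∫ y, Real.exp (-(sqDist z y / (4 * s))) ∂κ ≤ K * (√s / L) ^ d * σ := by
  have hsum : Summable fun n : ℕ => Real.exp (-(n : ℝ)) * (4 * ((n : ℝ) + 1) + 2) ^ d := by
    have h1 : Summable fun n : ℕ => (10 : ℝ) ^ d * ((n : ℝ) ^ d * Real.exp (-1 * n)) :=
      (Real.summable_pow_mul_exp_neg_nat_mul d one_pos).mul_left _
    refine summable_of_isBigO_nat h1 (Asymptotics.IsBigO.of_bound 1 ?_)
    filter_upwards [eventually_ge_atTop 1] with n hn
    have hn' : (1 : ℝ) ≤ n := by exact_mod_cast hn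
    rw [Real.norm_of_nonneg (by positivity), Real.norm_of_nonneg (by positivity), one_mul,
      ← mul_assoc, ← mul_pow, mul_comm, neg_one_mul]
    gcongr
    linarith
  set K := ∑' n : ℕ, Real.exp (-(n : ℝ)) * (4 * ((n : ℝ) + 1) + 2) ^ d with hK
  refine ⟨max 1 K, le_max_left _ _, fun κ _ L σ hL hσ z s hs => ?_⟩
  have hs0 : 0 < s := lt_of_lt_of_le (by positivity) hs
  have hσ0 : 0 ≤ σ := measureReal_nonneg.trans (hσ 0)
  have hsL : 1 ≤ √s / L := by
    rw [one_le_div hL]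
    exact Real.le_sqrt_of_sq_le hs
  -- the Gaussian is dominated by the layers `exp (-n)` on cubes of half-side `2 √s (n + 1)`
  set f : ℕ → Point d → ℝ := fun n y =>
    (cube z (2 * √s * ((n : ℝ) + 1))).indicator (fun _ => Real.exp (-(n : ℝ))) y with hf
  have hfi : ∀ n, ∫ y, f n y ∂κ ≤
      (Real.exp (-(n : ℝ)) * (4 * ((n : ℝ) + 1) + 2) ^ d) * ((√s / L) ^ d * σ) := by
    intro n
    simp only [hf]
    rw [integral_indicator (measurableSet_cube _ _), setIntegral_const, smul_eq_mul]
    have h1 := measureReal_cube_le hL hσ z (ρ := 2 * √s * ((n : ℝ) + 1)) (by positivity)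
    have h2 : 2 * (2 * √s * ((n : ℝ) + 1) / L) + 2 ≤ (4 * ((n : ℝ) + 1) + 2) * (√s / L) := by
      have : 2 * (2 * √s * ((n : ℝ) + 1) / L) = 4 * ((n : ℝ) + 1) * (√s / L) := by ring
      rw [this]
      nlinarith
    calc _ ≤ ((4 * ((n : ℝ) + 1) + 2) * (√s / L)) ^ d * σ * Real.exp (-(n : ℝ)) := by
          gcongr
          exact h1.trans (by gcongr)
      _ = _ := by rw [mul_pow]; ring
  have hfint : ∀ n, Integrable (f n) κ := fun n =>
    (integrable_const _).indicator (measurableSet_cube _ _)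
  have hf0 : ∀ n y, 0 ≤ f n y := fun n y => indicator_nonneg (fun _ _ => (Real.exp_pos _).le) y
  have hsum2 : Summable fun n => ∫ y, f n y ∂κ :=
    Summable.of_nonneg_of_le (fun n => integral_nonneg (hf0 n)) hfi (hsum.mul_right _)
  have hle : ∫ y, Real.exp (-(sqDist z y / (4 * s))) ∂κ ≤ ∑' n, ∫ y, f n y ∂κ := by
    rw [integral_tsum_of_summable_integral_norm hfint (by
      simpa only [Real.norm_of_nonneg (hf0 _ _)] using hsum2)]
    have hpt : ∀ y, Summable fun n => f n y := fun y => by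
      refine Summable.of_nonneg_of_le (fun n => hf0 n y) (fun n => ?_)
        Real.summable_exp_neg_nat
      exact indicator_le_self' (fun _ _ => (Real.exp_pos _).le) y
    refine integral_mono_of_nonneg (ae_of_all _ fun y => (Real.exp_pos _).le) ?_
      (ae_of_all _ fun y => ?_)
    · have hfm : Measurable fun y => ∑' n, f n y :=
        measurable_of_tendsto_metrizable
          (fun m => Finset.measurable_sum (Finset.range m) fun n _ =>
            measurable_const.indicator (measurableSet_cube _ _))
          (tendsto_pi_nhds.2 fun y => by
            simpa only [Finset.sum_apply] using (hpt y).hasSum.tendsto_sum_nat)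
      refine Integrable.of_bound hfm.aestronglyMeasurable (∑' n : ℕ, Real.exp (-(n : ℝ)))
        (ae_of_all _ fun y => ?_)
      rw [Real.norm_of_nonneg (tsum_nonneg fun n => hf0 n y)]
      exact (hpt y).tsum_le_tsum
        (fun n => indicator_le_self' (fun _ _ => (Real.exp_pos _).le) y) Real.summable_exp_neg_nat
    · set n := ⌊sqDist z y / (4 * s)⌋₊
      have hq0 : 0 ≤ sqDist z y / (4 * s) := div_nonneg (sqDist_nonneg z y) (by positivity)
      have h1 : f n y ≤ ∑' n, f n y := (hpt y).le_tsum n fun m _ => hf0 m y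
      refine le_trans ?_ h1
      have hmem : y ∈ cube z (2 * √s * ((n : ℝ) + 1)) := fun j => by
        have h2 : ((y : EuclideanSpace ℝ (Fin d)) j - z j) ^ 2 ≤ sqDist z y :=
          Finset.single_le_sum (f := fun j => ((y : EuclideanSpace ℝ (Fin d)) j - z j) ^ 2)
            (fun _ _ => sq_nonneg _) (Finset.mem_univ j)
        have h3 : sqDist z y ≤ (n + 1) * (4 * s) := by
          rw [← div_le_iff₀ (by positivity)]
          exact (Nat.lt_floor_add_one _).le
        refine abs_le_of_sq_le_sq ?_ (by positivity)
        have h4 : (2 * √s * ((n : ℝ) + 1)) ^ 2 = 4 * s * (n + 1) ^ 2 := by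
          rw [mul_pow, mul_pow, Real.sq_sqrt hs0.le]; ring
        rw [h4]
        have h5 : ((n : ℝ) + 1) ≤ (n + 1) ^ 2 := by nlinarith [(n.cast_nonneg : (0 : ℝ) ≤ n)]
        nlinarith
      simp only [hf, indicator_of_mem hmem]
      exact Real.exp_le_exp.2 (neg_le_neg (Nat.floor_le hq0))
  calc _ ≤ ∑' n, ∫ y, f n y ∂κ := hle
    _ ≤ ∑' n : ℕ, (Real.exp (-(n : ℝ)) * (4 * ((n : ℝ) + 1) + 2) ^ d) * ((√s / L) ^ d * σ) :=
        hsum2.tsum_le_tsum hfi (hsum.mul_right _)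
    _ = K * ((√s / L) ^ d * σ) := by rw [tsum_mul_right]
    _ ≤ max 1 K * (√s / L) ^ d * σ := by
        rw [mul_assoc]
        gcongr
        exact le_max_right _ _

/-! ### A Gaussian parametrix and bounds at large scales -/

/-- The Gaussian of total variance `s` (so that each of the `d` coordinates has variance `s / d`)
as a function of the squared distance `q`, without its numerical normalization. -/
def gauss (d : ℕ) (s q : ℝ) : ℝ := (√s)⁻¹ ^ d * Real.exp (-(d / s * q / 2))

/-- The coefficient of the corrector of the Gaussian on an edge: `x` is the coordinate along the
edge and `q` the squared distance, both relative to the centre. -/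
def corrector (d : ℕ) (s q x : ℝ) : ℝ := (1 / 2) * (d / s) ^ 2 * (x ^ 2 - q / d)

theorem hasDerivAt_gauss (d : ℕ) (s q : ℝ) :
    HasDerivAt (gauss d s) (-(d / s / 2) * gauss d s q) q := by
  have h1 : HasDerivAt (fun q : ℝ => -(d / s * q / 2)) (-(d / s / 2)) q := by
    simpa [mul_div_assoc, div_eq_mul_inv] using
      ((((hasDerivAt_id q).const_mul ((d : ℝ) / s)).div_const 2).fun_neg)
  refine ((h1.exp).const_mul ((√s)⁻¹ ^ d)).congr_deriv ?_
  simp only [gauss]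
  ring

theorem hasDerivAt_gauss_time {d : ℕ} (hd : d ≠ 0) {s : ℝ} (hs : 0 < s) (q : ℝ) :
    HasDerivAt (fun s => gauss d s q)
      (gauss d s q * (-(d / s / 2) + (d / s) ^ 2 * q / (2 * d))) s := by
  have hd' : (d : ℝ) ≠ 0 := by exact_mod_cast hd
  have hs' : √s ≠ 0 := (Real.sqrt_pos.2 hs).ne'
  have h1 : HasDerivAt (fun s : ℝ => -(d / s * q / 2)) (d / s ^ 2 * q / 2) s := by
    have := ((((hasDerivAt_inv hs.ne').const_mul (d : ℝ)).mul_const q).div_const 2).fun_neg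
    simp only [← div_eq_mul_inv] at this
    refine this.congr_deriv ?_
    ring
  have h2 : HasDerivAt (fun s : ℝ => (√s)⁻¹ ^ d) (-(d / s / 2) * (√s)⁻¹ ^ d) s := by
    have h3 := ((Real.hasDerivAt_sqrt hs.ne').fun_inv hs').fun_pow d
    refine h3.congr_deriv ?_
    obtain ⟨n, rfl⟩ := Nat.exists_eq_succ_of_ne_zero hd
    have h4 : s = √s ^ 2 := (Real.sq_sqrt hs.le).symm
    have h5 : ((n.succ : ℕ) : ℝ) / s = n.succ / √s ^ 2 := by rw [← h4]
    rw [h5]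
    simp only [Nat.succ_eq_add_one, Nat.add_sub_cancel, pow_succ]
    field_simp
  refine (h2.mul h1.exp).congr_deriv ?_
  simp only [gauss]
  field_simp

/-- The continuous tent `u (1 - u)` on the unit interval, extended periodically. -/
def tent (u : ℝ) : ℝ := Int.fract u * (1 - Int.fract u)

theorem continuous_tent : Continuous tent := by
  have h : ContinuousOn (fun u : ℝ => u * (1 - u)) (Icc 0 1) := by fun_prop
  exact h.comp_fract'' (by simp)

theorem tent_int_add (k : ℤ) {u : ℝ} (hu : u ∈ Icc (0 : ℝ) 1) : tent (k + u) = u * (1 - u) := by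
  rcases hu.2.lt_or_eq with h | rfl
  · have : Int.fract ((k : ℝ) + u) = u := by
      rw [Int.fract_intCast_add, Int.fract_eq_self.2 ⟨hu.1, h⟩]
    simp [tent, this]
  · simp [tent]

theorem tent_int (k : ℤ) : tent k = 0 := by simp [tent]

/-- An approximate solution of the heat equation on the cable graph: the Gaussian plus a corrector
vanishing at the vertices. The corrector compensates, to leading order, the difference between the
second derivative along an edge and the average of the second derivatives in all directions. -/
def parametrix {d : ℕ} (z : Fin d → ℝ) (s : ℝ) (y : Point d) : ℝ :=
  gauss d s (sqDist z y) * (1 + ∑ i, corrector d s (sqDist z y)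
    ((y : EuclideanSpace ℝ (Fin d)) i - z i) * tent ((y : EuclideanSpace ℝ (Fin d)) i))

theorem continuous_gauss (d : ℕ) (s : ℝ) : Continuous (gauss d s) := by
  unfold gauss; fun_prop

theorem continuous_parametrix {d : ℕ} (z : Fin d → ℝ) (s : ℝ) : Continuous (parametrix z s) := by
  have h1 := continuous_sqDist z
  have h2 := continuous_coord (d := d)
  have h3 := continuous_tent
  have h4 := continuous_gauss d s
  unfold parametrix corrector
  fun_prop

theorem parametrix_edgePoint {d : ℕ} (z : Fin d → ℝ) (s : ℝ) (e : (Fin d → ℤ) × Fin d) {u : ℝ}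
    (hu : u ∈ Icc (0 : ℝ) 1) : parametrix z s (edgePoint e.1 e.2 u) =
      gauss d s (edgeSqDist z e u) *
        (1 + corrector d s (edgeSqDist z e u) (e.1 e.2 + u - z e.2) * (u * (1 - u))) := by
  rw [parametrix, sqDist_edgePoint, Finset.sum_eq_single e.2]
  · simp only [edgePoint_apply, if_true, tent_int_add _ hu]
  · intro j _ hj
    simp [edgePoint_apply, hj, tent_int]
  · simp

theorem sq_one_add_le_exp {Y : ℝ} (hY : 0 ≤ Y) : (1 + Y) ^ 2 ≤ 64 * Real.exp (Y / 4) := by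
  have h1 := Real.add_one_le_exp (Y / 8)
  have h2 : Real.exp (Y / 4) = Real.exp (Y / 8) ^ 2 := by
    rw [← Real.exp_nat_mul]; ring_nf
  rw [h2, show (64 : ℝ) * Real.exp (Y / 8) ^ 2 = (8 * Real.exp (Y / 8)) ^ 2 by ring]
  gcongr
  linarith

theorem abs_corrector_le {d : ℕ} (hd : 1 ≤ d) {s q x : ℝ} (hx : x ^ 2 ≤ q) :
    |corrector d s q x| ≤ (1 / 2) * (d / s) ^ 2 * q := by
  have hd' : (1 : ℝ) ≤ d := by exact_mod_cast hd
  have hq : 0 ≤ q := (sq_nonneg x).trans hx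
  have h1 : q / d ≤ q := div_le_self hq hd'
  have h0 : 0 ≤ q / d := by positivity
  rw [corrector, abs_mul, abs_of_nonneg (by positivity : 0 ≤ 1 / 2 * ((d : ℝ) / s) ^ 2)]
  gcongr
  rw [abs_le]
  constructor <;> nlinarith [sq_nonneg x]

/-- The pointwise bound on the error in the heat equation, in terms of `b = √(d / s)`. -/
theorem abs_error_le {b y ζ E Eu Euu w w' σ : ℝ} (hb0 : 0 ≤ b) (hb1 : b ≤ 1) (hy : 0 ≤ y)
    (hζ : |ζ| ≤ y) (hE : |E| ≤ b ^ 2 * y ^ 2 / 2) (hEu : |Eu| ≤ b ^ 3 * y) (hEuu : |Euu| ≤ b ^ 4)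
    (hw0 : 0 ≤ w) (hw : w ≤ 1 / 4) (hw' : |w'| ≤ 1) (hσ : 0 ≤ σ) (hσb : σ ≤ b ^ 2) :
    |E ^ 2 * w - b * ζ * (Eu * w + E * w') + Euu * w / 2 + Eu * w' + 2 * E * w * σ| ≤
      b ^ 3 * (1 + y) ^ 4 := by
  have hb43 : b ^ 4 ≤ b ^ 3 := pow_le_pow_of_le_one hb0 hb1 (by norm_num)
  have hb3 : 0 ≤ b ^ 3 := by positivity
  have hw1 : |w| ≤ 1 / 4 := by rwa [abs_of_nonneg hw0]
  have t1 : |E ^ 2 * w| ≤ b ^ 3 * (y ^ 4 / 16) := by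
    rw [abs_mul, abs_pow]
    calc |E| ^ 2 * |w| ≤ (b ^ 2 * y ^ 2 / 2) ^ 2 * (1 / 4) := by gcongr
      _ = b ^ 4 * (y ^ 4 / 16) := by ring
      _ ≤ _ := by gcongr
  have t2 : |b * ζ * (Eu * w + E * w')| ≤ b ^ 3 * (y ^ 2 / 4 + y ^ 3 / 2) := by
    rw [abs_mul, abs_mul, abs_of_nonneg hb0]
    calc b * |ζ| * |Eu * w + E * w'| ≤ b * y * (b ^ 3 * y * (1 / 4) + b ^ 2 * y ^ 2 / 2 * 1) := by
          gcongr
          refine (abs_add_le _ _).trans ?_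
          rw [abs_mul, abs_mul]
          gcongr
      _ = b ^ 4 * (y ^ 2 / 4) + b ^ 3 * (y ^ 3 / 2) := by ring
      _ ≤ b ^ 3 * (y ^ 2 / 4) + b ^ 3 * (y ^ 3 / 2) := by gcongr
      _ = _ := by ring
  have t3 : |Euu * w / 2| ≤ b ^ 3 * (1 / 8) := by
    rw [abs_div, abs_mul, abs_two]
    calc |Euu| * |w| / 2 ≤ b ^ 4 * (1 / 4) / 2 := by gcongr
      _ = b ^ 4 * (1 / 8) := by ring
      _ ≤ _ := by gcongr
  have t4 : |Eu * w'| ≤ b ^ 3 * y := by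
    rw [abs_mul]
    calc |Eu| * |w'| ≤ b ^ 3 * y * 1 := by gcongr
      _ = _ := mul_one _
  have t5 : |2 * E * w * σ| ≤ b ^ 3 * (y ^ 2 / 4) := by
    rw [abs_mul, abs_mul, abs_mul, abs_two, abs_of_nonneg hσ]
    calc 2 * |E| * |w| * σ ≤ 2 * (b ^ 2 * y ^ 2 / 2) * (1 / 4) * b ^ 2 := by gcongr
      _ = b ^ 4 * (y ^ 2 / 4) := by ring
      _ ≤ _ := by gcongr
  have hsum : |E ^ 2 * w - b * ζ * (Eu * w + E * w') + Euu * w / 2 + Eu * w' + 2 * E * w * σ| ≤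
      b ^ 3 * (y ^ 4 / 16) + b ^ 3 * (y ^ 2 / 4 + y ^ 3 / 2) + b ^ 3 * (1 / 8) + b ^ 3 * y +
        b ^ 3 * (y ^ 2 / 4) := by
    refine (abs_add_le _ _).trans (add_le_add ?_ t5)
    refine (abs_add_le _ _).trans (add_le_add ?_ t4)
    refine (abs_add_le _ _).trans (add_le_add ?_ t3)
    exact (abs_sub _ _).trans (add_le_add t1 t2)
  refine hsum.trans ?_
  rw [← mul_add, ← mul_add, ← mul_add, ← mul_add]
  gcongr
  have : (1 + y) ^ 4 = 1 + 4 * y + 6 * y ^ 2 + 4 * y ^ 3 + y ^ 4 := by ring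
  rw [this]
  have := pow_nonneg hy 2
  have := pow_nonneg hy 3
  have := pow_nonneg hy 4
  linarith

/-- The derivative of the parametrix along an edge. -/
def parametrixDeriv {d : ℕ} (z : Fin d → ℝ) (e : (Fin d → ℤ) × Fin d) (s u : ℝ) : ℝ :=
  gauss d s (edgeSqDist z e u) *
    (-(d / s * (e.1 e.2 + u - z e.2)) *
      (1 + corrector d s (edgeSqDist z e u) (e.1 e.2 + u - z e.2) * (u * (1 - u))) +
    ((d / s) ^ 2 * (1 - 1 / d) * (e.1 e.2 + u - z e.2) * (u * (1 - u)) +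
      corrector d s (edgeSqDist z e u) (e.1 e.2 + u - z e.2) * (1 - 2 * u)))

/-- The second derivative of the parametrix along an edge. -/
def parametrixDeriv₂ {d : ℕ} (z : Fin d → ℝ) (e : (Fin d → ℤ) × Fin d) (s u : ℝ) : ℝ :=
  gauss d s (edgeSqDist z e u) *
    (((d / s * (e.1 e.2 + u - z e.2)) ^ 2 - d / s) *
      (1 + corrector d s (edgeSqDist z e u) (e.1 e.2 + u - z e.2) * (u * (1 - u))) -
    2 * (d / s * (e.1 e.2 + u - z e.2)) *
      ((d / s) ^ 2 * (1 - 1 / d) * (e.1 e.2 + u - z e.2) * (u * (1 - u)) +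
        corrector d s (edgeSqDist z e u) (e.1 e.2 + u - z e.2) * (1 - 2 * u)) +
    ((d / s) ^ 2 * (1 - 1 / d) * (u * (1 - u)) +
      2 * ((d / s) ^ 2 * (1 - 1 / d) * (e.1 e.2 + u - z e.2)) * (1 - 2 * u) -
      2 * corrector d s (edgeSqDist z e u) (e.1 e.2 + u - z e.2)))

/-- The time derivative of the parametrix along an edge. -/
def parametrixDerivTime {d : ℕ} (z : Fin d → ℝ) (e : (Fin d → ℤ) × Fin d) (s u : ℝ) : ℝ :=
  gauss d s (edgeSqDist z e u) *
    ((-(d / s / 2) + (d / s) ^ 2 * edgeSqDist z e u / (2 * d)) *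
      (1 + corrector d s (edgeSqDist z e u) (e.1 e.2 + u - z e.2) * (u * (1 - u))) -
    2 * corrector d s (edgeSqDist z e u) (e.1 e.2 + u - z e.2) * (u * (1 - u)) / s)

section Edge

variable {d : ℕ} (z : Fin d → ℝ) (e : (Fin d → ℤ) × Fin d)

theorem hasDerivAt_gauss_edge (s u : ℝ) : HasDerivAt (fun u => gauss d s (edgeSqDist z e u))
    (-(d / s * (e.1 e.2 + u - z e.2)) * gauss d s (edgeSqDist z e u)) u := by
  refine ((hasDerivAt_gauss d s _).comp u (hasDerivAt_edgeSqDist z e u)).congr_deriv ?_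
  ring

theorem hasDerivAt_edgeCoord (u : ℝ) :
    HasDerivAt (fun u : ℝ => (e.1 e.2 : ℝ) + u - z e.2) 1 u :=
  ((hasDerivAt_id u).const_add _).sub_const _

theorem hasDerivAt_corrector_edge (s u : ℝ) :
    HasDerivAt (fun u => corrector d s (edgeSqDist z e u) (e.1 e.2 + u - z e.2))
    ((d / s) ^ 2 * (1 - 1 / d) * (e.1 e.2 + u - z e.2)) u := by
  refine ((((hasDerivAt_edgeCoord z e u).fun_pow 2).fun_sub
    ((hasDerivAt_edgeSqDist z e u).div_const (d : ℝ))).const_mul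
      ((1 / 2) * ((d : ℝ) / s) ^ 2)).congr_deriv ?_
  ring

theorem hasDerivAt_tent_edge (u : ℝ) : HasDerivAt (fun u : ℝ => u * (1 - u)) (1 - 2 * u) u := by
  refine ((hasDerivAt_id u).fun_mul ((hasDerivAt_id u).const_sub 1)).congr_deriv ?_
  simp only [id]
  ring

theorem hasDerivAt_parametrix (s u : ℝ) : HasDerivAt (fun u => gauss d s (edgeSqDist z e u) *
      (1 + corrector d s (edgeSqDist z e u) (e.1 e.2 + u - z e.2) * (u * (1 - u))))
    (parametrixDeriv z e s u) u := by
  refine ((hasDerivAt_gauss_edge z e s u).fun_mul (((hasDerivAt_corrector_edge z e s u).fun_mul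
    (hasDerivAt_tent_edge u)).const_add 1)).congr_deriv ?_
  rw [parametrixDeriv]
  ring

theorem hasDerivAt_parametrixDeriv (s u : ℝ) :
    HasDerivAt (parametrixDeriv z e s) (parametrixDeriv₂ z e s u) u := by
  have hg := hasDerivAt_gauss_edge z e s u
  have hc := hasDerivAt_corrector_edge z e s u
  have hw := hasDerivAt_tent_edge u
  have hx := hasDerivAt_edgeCoord z e u
  have hw' : HasDerivAt (fun u : ℝ => 1 - 2 * u) (-2) u := by
    simpa using ((hasDerivAt_id u).const_mul 2).const_sub 1
  refine (hg.fun_mul ((((hx.const_mul ((d : ℝ) / s)).fun_neg).fun_mul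
    ((hc.fun_mul hw).const_add 1)).fun_add
    (((hx.const_mul (((d : ℝ) / s) ^ 2 * (1 - 1 / d))).fun_mul hw).fun_add
      (hc.fun_mul hw')))).congr_deriv ?_
  rw [parametrixDeriv₂]
  ring

theorem hasDerivAt_parametrix_time (hd : d ≠ 0) {s : ℝ} (hs : 0 < s) (u : ℝ) :
    HasDerivAt (fun s => gauss d s (edgeSqDist z e u) *
      (1 + corrector d s (edgeSqDist z e u) (e.1 e.2 + u - z e.2) * (u * (1 - u))))
    (parametrixDerivTime z e s u) s := by
  have hb : HasDerivAt (fun s : ℝ => (d : ℝ) / s) (-(d / s / s)) s := by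
    have := (hasDerivAt_inv hs.ne').const_mul (d : ℝ)
    simp only [← div_eq_mul_inv] at this
    refine this.congr_deriv ?_
    field_simp
  have hc := ((((hb.fun_pow 2).const_mul (1 / 2)).mul_const
    ((e.1 e.2 + u - z e.2) ^ 2 - edgeSqDist z e u / d)).mul_const (u * (1 - u))).const_add 1
  refine ((hasDerivAt_gauss_time hd hs _).fun_mul hc).congr_deriv ?_
  rw [parametrixDerivTime, corrector]
  ring

/-- The error in the heat equation for the parametrix: the terms of leading order cancel. -/
theorem parametrix_error (hd : d ≠ 0) (s u : ℝ) :
    (1 / 2) * parametrixDeriv₂ z e s u - parametrixDerivTime z e s u =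
    gauss d s (edgeSqDist z e u) *
      (corrector d s (edgeSqDist z e u) (e.1 e.2 + u - z e.2) ^ 2 * (u * (1 - u)) -
      (d / s * (e.1 e.2 + u - z e.2)) *
        ((d / s) ^ 2 * (1 - 1 / d) * (e.1 e.2 + u - z e.2) * (u * (1 - u)) +
        corrector d s (edgeSqDist z e u) (e.1 e.2 + u - z e.2) * (1 - 2 * u)) +
      (d / s) ^ 2 * (1 - 1 / d) * (u * (1 - u)) / 2 +
      (d / s) ^ 2 * (1 - 1 / d) * (e.1 e.2 + u - z e.2) * (1 - 2 * u) +
      2 * corrector d s (edgeSqDist z e u) (e.1 e.2 + u - z e.2) * (u * (1 - u)) * s⁻¹) := by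
  have hd' : (d : ℝ) ≠ 0 := by exact_mod_cast hd
  have h : (d / s) ^ 2 * (e.1 e.2 + u - z e.2) ^ 2 =
      2 * corrector d s (edgeSqDist z e u) (e.1 e.2 + u - z e.2) +
        2 * ((d / s) ^ 2 * edgeSqDist z e u / (2 * d)) := by
    rw [corrector]
    field_simp
    ring
  rw [parametrixDeriv₂, parametrixDerivTime, mul_pow, h]
  ring

/-- Compared with the Gaussian, the error has an additional factor of order `s ^ (-3/2)`, which is
integrable at infinity. -/
theorem abs_parametrix_error_le (hd : 1 ≤ d) {s u : ℝ} (hs : (d : ℝ) ≤ s) (hu : u ∈ Icc (0 : ℝ) 1) :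
    |(1 / 2) * parametrixDeriv₂ z e s u - parametrixDerivTime z e s u| ≤
      256 * √(d / s) ^ 3 * ((√s)⁻¹ ^ d * Real.exp (-(edgeSqDist z e u / (4 * (s / d))))) := by
  have hd' : (1 : ℝ) ≤ d := by exact_mod_cast hd
  have hs0 : 0 < s := by linarith
  rw [parametrix_error z e (by omega)]
  set q := edgeSqDist z e u
  set x := (e.1 e.2 : ℝ) + u - z e.2
  have hxq : x ^ 2 ≤ q := sq_le_edgeSqDist z e u
  have hq : 0 ≤ q := (sq_nonneg x).trans hxq
  set b := √(d / s) with hb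
  have hb0 : 0 ≤ b := Real.sqrt_nonneg _
  have hb2 : (d : ℝ) / s = b ^ 2 := (Real.sq_sqrt (by positivity)).symm
  have hb1 : b ≤ 1 := Real.sqrt_le_one.2 ((div_le_one hs0).2 hs)
  have hxs : |x| ≤ √q := Real.abs_le_sqrt hxq
  have hc := abs_corrector_le hd (s := s) hxq
  have hd1 : 0 ≤ 1 - 1 / (d : ℝ) ∧ 1 - 1 / (d : ℝ) ≤ 1 := by
    have : 1 / (d : ℝ) ≤ 1 := (div_le_one (by linarith)).2 hd'
    have : 0 ≤ 1 / (d : ℝ) := by positivity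
    constructor <;> linarith
  have hY : (b * √q) ^ 2 = d / s * q := by rw [mul_pow, Real.sq_sqrt hq, hb2]
  have herr := abs_error_le (b := b) (y := b * √q) (ζ := b * x)
    (E := corrector d s q x) (Eu := (d / s) ^ 2 * (1 - 1 / d) * x)
    (Euu := (d / s) ^ 2 * (1 - 1 / d)) (w := u * (1 - u)) (w' := 1 - 2 * u) (σ := s⁻¹)
    hb0 hb1 (by positivity)
    (by rw [abs_mul, abs_of_nonneg hb0]; gcongr)
    (by rw [hY]; rw [hb2] at hc ⊢; refine hc.trans (le_of_eq ?_); ring)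
    (by
      rw [abs_mul, abs_mul, abs_of_nonneg (by positivity), abs_of_nonneg hd1.1, hb2]
      calc (b ^ 2) ^ 2 * (1 - 1 / d) * |x| ≤ (b ^ 2) ^ 2 * 1 * √q := by gcongr; exact hd1.2
        _ = _ := by ring)
    (by
      rw [abs_mul, abs_of_nonneg (by positivity), abs_of_nonneg hd1.1, hb2]
      calc (b ^ 2) ^ 2 * (1 - 1 / d) ≤ (b ^ 2) ^ 2 * 1 := by gcongr; exact hd1.2
        _ = _ := by ring)
    (mul_nonneg hu.1 (by linarith [hu.2])) (by nlinarith [sq_nonneg (u - 1 / 2)])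
    (abs_le.2 ⟨by linarith [hu.2], by linarith [hu.1]⟩) (by positivity)
    (by rw [← hb2, div_eq_mul_inv]; exact le_mul_of_one_le_left (by positivity) hd')
  have hbx : b * (b * x) = d / s * x := by rw [hb2]; ring
  rw [hbx] at herr
  have hg0 : 0 ≤ gauss d s q := by unfold gauss; positivity
  rw [abs_mul, abs_of_nonneg hg0]
  have h4 : (1 + b * √q) ^ 4 ≤ 256 * Real.exp (d / s * q / 4) := by
    have h5 := sq_one_add_le_exp (Y := d / s * q) (by positivity)
    have h6 : (1 + b * √q) ^ 2 ≤ 2 * (1 + d / s * q) := by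
      rw [← hY]; nlinarith [sq_nonneg (b * √q - 1)]
    calc (1 + b * √q) ^ 4 = ((1 + b * √q) ^ 2) ^ 2 := by ring
      _ ≤ (2 * (1 + d / s * q)) ^ 2 := by gcongr
      _ = 4 * (1 + d / s * q) ^ 2 := by ring
      _ ≤ 4 * (64 * Real.exp (d / s * q / 4)) := by gcongr
      _ = _ := by ring
  calc _ ≤ gauss d s q * (b ^ 3 * (256 * Real.exp (d / s * q / 4))) := by
        gcongr
        exact herr.trans (by gcongr)
    _ = 256 * b ^ 3 * ((√s)⁻¹ ^ d *
        (Real.exp (-(d / s * q / 2)) * Real.exp (d / s * q / 4))) := by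
        unfold gauss; ring
    _ = _ := by
        rw [← Real.exp_add]
        congr 4
        field_simp
        ring

theorem abs_parametrixDeriv_le (hd : 1 ≤ d) {s u : ℝ} (hs : (d : ℝ) ≤ s)
    (hu : u ∈ Icc (0 : ℝ) 1) : |parametrixDeriv z e s u| ≤ 1024 * (√s)⁻¹ ^ d := by
  have hd' : (1 : ℝ) ≤ d := by exact_mod_cast hd
  have hs0 : 0 < s := by linarith
  rw [parametrixDeriv]
  set q := edgeSqDist z e u
  set x := (e.1 e.2 : ℝ) + u - z e.2
  have hxq : x ^ 2 ≤ q := sq_le_edgeSqDist z e u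
  have hq : 0 ≤ q := (sq_nonneg x).trans hxq
  set β := (d : ℝ) / s with hβ
  have hβ0 : 0 ≤ β := by positivity
  have hβ1 : β ≤ 1 := (div_le_one hs0).2 hs
  have hc := abs_corrector_le hd (s := s) hxq
  rw [← hβ] at hc
  have hβq : 0 ≤ β * q := by positivity
  have hc1 : |corrector d s q x| ≤ 1 + β * q := by
    refine hc.trans ?_
    have : β ^ 2 * q ≤ β * q := by nlinarith
    linarith
  have hx1 : |β * x| ≤ 1 + β * q := by
    refine abs_le_of_sq_le_sq ?_ (by linarith)
    have h1 : (β * x) ^ 2 ≤ β * q := by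
      rw [mul_pow]
      calc β ^ 2 * x ^ 2 ≤ β ^ 2 * q := by gcongr
        _ ≤ β * q := by nlinarith
    nlinarith
  have hw : |u * (1 - u)| ≤ 1 := by
    rw [abs_le]
    constructor <;> nlinarith [hu.1, hu.2, sq_nonneg (u - 1 / 2)]
  have hw' : |1 - 2 * u| ≤ 1 := abs_le.2 ⟨by linarith [hu.2], by linarith [hu.1]⟩
  have hd1 : |1 - 1 / (d : ℝ)| ≤ 1 := by
    have : 1 / (d : ℝ) ≤ 1 := (div_le_one (by linarith)).2 hd'
    have : 0 ≤ 1 / (d : ℝ) := by positivity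
    rw [abs_le]; constructor <;> linarith
  have hm : |(-(β * x) * (1 + corrector d s q x * (u * (1 - u))) +
      (β ^ 2 * (1 - 1 / d) * x * (u * (1 - u)) + corrector d s q x * (1 - 2 * u)))| ≤
      4 * (1 + β * q) ^ 2 := by
    have t1 : |1 + corrector d s q x * (u * (1 - u))| ≤ 2 * (1 + β * q) := by
      refine (abs_add_le _ _).trans ?_
      rw [abs_one, abs_mul]
      have : |corrector d s q x| * |u * (1 - u)| ≤ (1 + β * q) * 1 := by gcongr
      linarith
    have t2 : |-(β * x) * (1 + corrector d s q x * (u * (1 - u)))| ≤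
        (1 + β * q) * (2 * (1 + β * q)) := by
      rw [abs_mul, abs_neg]
      gcongr
    have t3 : |β ^ 2 * (1 - 1 / d) * x * (u * (1 - u))| ≤ 1 + β * q := by
      rw [show β ^ 2 * (1 - 1 / d) * x * (u * (1 - u)) =
        β * ((1 - 1 / d) * ((β * x) * (u * (1 - u)))) by ring, abs_mul, abs_mul, abs_mul,
        abs_of_nonneg hβ0]
      calc _ ≤ 1 * (1 * ((1 + β * q) * 1)) := by gcongr
        _ = _ := by ring
    have t4 : |corrector d s q x * (1 - 2 * u)| ≤ (1 + β * q) * 1 := by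
      rw [abs_mul]; gcongr
    refine (abs_add_le _ _).trans ?_
    have := abs_add_le (β ^ 2 * (1 - 1 / d) * x * (u * (1 - u))) (corrector d s q x * (1 - 2 * u))
    nlinarith
  have hg0 : 0 ≤ gauss d s q := by unfold gauss; positivity
  rw [abs_mul, abs_of_nonneg hg0]
  calc _ ≤ gauss d s q * (4 * (64 * Real.exp (β * q / 4))) := by
        gcongr
        exact hm.trans (by gcongr; exact sq_one_add_le_exp hβq)
    _ = 256 * (√s)⁻¹ ^ d * (Real.exp (-(β * q / 2)) * Real.exp (β * q / 4)) := by
        unfold gauss; ring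
    _ = 256 * (√s)⁻¹ ^ d * Real.exp (-(β * q / 4)) := by
        rw [← Real.exp_add]; congr 2; ring
    _ ≤ 256 * (√s)⁻¹ ^ d * 1 := by
        gcongr
        exact Real.exp_le_one_iff.2 (by linarith)
    _ ≤ _ := by
        have : 0 ≤ (√s)⁻¹ ^ d := by positivity
        linarith

theorem abs_parametrix_sub_gauss_le (hd : 1 ≤ d) (s : ℝ) (y : Point d) :
    |parametrix z s y - gauss d s (sqDist z y)| ≤ gauss d s (sqDist z y) *
      (d / s * (d / s * sqDist z y / 8)) := by
  obtain ⟨v, i, u, hu, rfl⟩ := exists_edgePoint y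
  have hu' : u ∈ Icc (0 : ℝ) 1 := ⟨hu.1, hu.2.le⟩
  rw [parametrix_edgePoint z s (v, i) hu', sqDist_edgePoint z (v, i)]
  have hg0 : 0 ≤ gauss d s (edgeSqDist z (v, i) u) := by unfold gauss; positivity
  rw [mul_add, mul_one, add_sub_cancel_left, abs_mul, abs_of_nonneg hg0, abs_mul]
  have hc := abs_corrector_le hd (s := s) (sq_le_edgeSqDist z (v, i) u)
  have hq : 0 ≤ edgeSqDist z (v, i) u := (sq_nonneg _).trans (sq_le_edgeSqDist z (v, i) u)
  have hw : |u * (1 - u)| ≤ 1 / 4 := by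
    rw [abs_le]
    constructor <;> nlinarith [hu.1, hu.2, sq_nonneg (u - 1 / 2)]
  refine mul_le_mul_of_nonneg_left ?_ hg0
  calc _ ≤ (1 / 2) * (d / s) ^ 2 * edgeSqDist z (v, i) u * (1 / 4) :=
        mul_le_mul hc hw (abs_nonneg _) (by positivity)
    _ = _ := by ring

end Edge

theorem sum_corrector (d : ℕ) (s : ℝ) (x : Fin d → ℝ) :
    ∑ i, corrector d s (∑ j, x j ^ 2) (x i) = 0 := by
  rcases Nat.eq_zero_or_pos d with rfl | hd
  · simp
  have hd' : (d : ℝ) ≠ 0 := by exact_mod_cast hd.ne'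
  simp only [corrector, ← Finset.mul_sum, Finset.sum_sub_distrib, Finset.sum_const,
    Finset.card_univ, Fintype.card_fin, nsmul_eq_mul]
  rw [mul_div_cancel₀ _ hd', sub_self, mul_zero]

/-- The Kirchhoff condition for the parametrix: the derivative of the Gaussian is continuous across a
vertex, and the derivatives of the correctors sum to zero by `sum_corrector`. -/
theorem parametrix_kirchhoff {d : ℕ} (z : Fin d → ℝ) (s : ℝ) (v : Fin d → ℤ) :
    ∑ i, (parametrixDeriv z (v, i) s 0 - parametrixDeriv z (v - Pi.single i 1, i) s 1) = 0 := by
  have h0 : ∀ i, edgeSqDist z (v, i) 0 = ∑ j, ((v j : ℝ) - z j) ^ 2 := fun i => by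
    simp [edgeSqDist]
  have h1 : ∀ i, edgeSqDist z (v - Pi.single i 1, i) 1 = ∑ j, ((v j : ℝ) - z j) ^ 2 := fun i => by
    rw [← h0 i, ← sqDist_edgePoint, ← sqDist_edgePoint, edgePoint_sub_single]
  have h2 : ∀ i, parametrixDeriv z (v, i) s 0 - parametrixDeriv z (v - Pi.single i 1, i) s 1 =
      2 * gauss d s (∑ j, ((v j : ℝ) - z j) ^ 2) *
        corrector d s (∑ j, ((v j : ℝ) - z j) ^ 2) (v i - z i) := fun i => by
    simp only [parametrixDeriv, h0, h1, Pi.sub_apply, Pi.single_eq_same, Int.cast_sub, Int.cast_one,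
      sub_add_cancel, add_zero]
    ring
  rw [Finset.sum_congr rfl fun i _ => h2 i, ← Finset.mul_sum, sum_corrector, mul_zero]

theorem gauss_mul_le {d : ℕ} {s q : ℝ} (hY : 0 ≤ d / s * q) :
    gauss d s q * (d / s * q / 8) ≤ (√s)⁻¹ ^ d * Real.exp (-(d / s * q / 4)) := by
  have h1 : d / s * q / 8 ≤ Real.exp (d / s * q / 4) := by
    have := Real.add_one_le_exp (d / s * q / 4)
    linarith
  calc gauss d s q * (d / s * q / 8) ≤ gauss d s q * Real.exp (d / s * q / 4) := by
        unfold gauss; gcongr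
    _ = (√s)⁻¹ ^ d * (Real.exp (-(d / s * q / 2)) * Real.exp (d / s * q / 4)) := by
        unfold gauss; ring
    _ = _ := by rw [← Real.exp_add]; ring_nf

theorem abs_parametrix_le {d : ℕ} (hd : 1 ≤ d) (z : Fin d → ℝ) {s : ℝ} (hs : (d : ℝ) ≤ s)
    (y : Point d) : |parametrix z s y| ≤ (√s)⁻¹ ^ d := by
  have hd' : (1 : ℝ) ≤ d := by exact_mod_cast hd
  have hs0 : 0 < s := by linarith
  have h1 := abs_parametrix_sub_gauss_le z hd s y
  have hq := sqDist_nonneg z y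
  have hg0 : 0 ≤ gauss d s (sqDist z y) := by unfold gauss; positivity
  have hβ1 : (d : ℝ) / s ≤ 1 := (div_le_one hs0).2 hs
  have h2 : |parametrix z s y| ≤ gauss d s (sqDist z y) * (1 + d / s * sqDist z y / 8) := by
    have h3 := abs_sub_abs_le_abs_sub (parametrix z s y) (gauss d s (sqDist z y))
    rw [abs_of_nonneg hg0] at h3
    have h4 : gauss d s (sqDist z y) * (d / s * (d / s * sqDist z y / 8)) ≤
        gauss d s (sqDist z y) * (1 * (d / s * sqDist z y / 8)) := by gcongr
    linarith
  refine h2.trans ?_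
  have h5 : 1 + d / s * sqDist z y / 8 ≤ Real.exp (d / s * sqDist z y / 2) := by
    have := Real.add_one_le_exp (d / s * sqDist z y / 2)
    have : 0 ≤ d / s * sqDist z y := by positivity
    linarith
  calc _ ≤ gauss d s (sqDist z y) * Real.exp (d / s * sqDist z y / 2) := by gcongr
    _ = _ := by
      rw [gauss, mul_assoc, ← Real.exp_add, neg_add_cancel, Real.exp_zero, mul_one]

theorem inv_sqrt_anti {s t : ℝ} (hs : 0 < s) (h : s ≤ t) : (√t)⁻¹ ≤ (√s)⁻¹ :=
  inv_anti₀ (Real.sqrt_pos.2 hs) (Real.sqrt_le_sqrt h)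

/-- The recursive inequality for the mass of cubes: a bound of order `N t ^ (-d/2)` up to time `T`
reappears at time `T` with a factor that is small when the scale `A` is large. -/
theorem IsHeatKernel.parametrix_step {d : ℕ} (hd : 1 ≤ d) {p : ℝ → Point d → Point d → ℝ}
    (hp : IsHeatKernel d p) (x : Point d) {K : ℝ} (hK1 : 1 ≤ K)
    (hK : ∀ (κ : Measure (Point d)) [IsFiniteMeasure κ] (L σ : ℝ), 0 < L →
      (∀ z, κ.real (cube z L) ≤ σ) → ∀ (z : Fin d → ℝ) (s : ℝ), L ^ 2 ≤ s →
      ∫ y, Real.exp (-(sqDist z y / (4 * s))) ∂κ ≤ K * (√s / L) ^ d * σ)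
    {A N T : ℝ} (hA : 1 ≤ A) (hN : 0 ≤ N) (hT : 0 < T)
    (hle : ∀ r ∈ Ioc 0 T, ∀ z, (transition p r x).real (cube z (√A)) ≤ N * (√r)⁻¹ ^ d)
    (z : Fin d → ℝ) :
    (transition p T x).real (cube z (√A)) * (Real.exp (-(d / 2)) * (√(d * A))⁻¹ ^ d) ≤
      (√T)⁻¹ ^ d + 2 * (256 * √d ^ 3 * (√(T / 2))⁻¹ ^ d * (1 + K * ((√d * √A)⁻¹ ^ d * N))) *
        (√(d * A))⁻¹ + A⁻¹ * (√(d * A))⁻¹ ^ d * (K * (N * (√T)⁻¹ ^ d)) := by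
  have hd' : (1 : ℝ) ≤ d := by exact_mod_cast hd
  have hd0 : d ≠ 0 := by omega
  have hA0 : 0 < A := by linarith
  set s₁ : ℝ := d * A with hs₁
  have hs₁0 : 0 < s₁ := by positivity
  have hds : (d : ℝ) ≤ s₁ := le_mul_of_one_le_right (by linarith) hA
  -- `D (√s)⁻¹ ^ 3` bounds the error of the parametrix, integrated in space; its integral over the times
  -- `s ≥ s₁` converges.
  set D := 256 * √d ^ 3 * (√(T / 2))⁻¹ ^ d * (1 + K * ((√d * √A)⁻¹ ^ d * N)) with hD
  have hsA : 0 < √A := Real.sqrt_pos.2 hA0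
  have hfin : ∀ r > 0, IsFiniteMeasure (transition p r x) := fun r hr =>
    hp.isFiniteMeasure_transition hr x
  have hexpc : ∀ c : ℝ, Continuous fun y : Point d => Real.exp (-(sqDist z y / c)) := fun c => by
    have := continuous_sqDist z
    fun_prop
  have hexp1 : ∀ c : ℝ, 0 < c → ∀ y : Point d, Real.exp (-(sqDist z y / c)) ≤ 1 := fun c hc y =>
    Real.exp_le_one_iff.2 (neg_nonpos.2 (div_nonneg (sqDist_nonneg z y) hc.le))
  have hexpi : ∀ r > 0, ∀ c > 0,
      Integrable (fun y => Real.exp (-(sqDist z y / c))) (transition p r x) := fun r hr c hc =>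
    hp.integrable_transition hr x (hexpc c) (B := 1) fun y => by
      rw [abs_of_pos (Real.exp_pos _)]; exact hexp1 c hc y
  have hgc : ∀ e : (Fin d → ℤ) × Fin d, ContinuousOn
      (fun q : ℝ × ℝ => gauss d q.1 (edgeSqDist z e q.2)) (Ioi 0 ×ˢ univ) := fun e => by
    have h1 := continuous_edgeSqDist z e
    have h2 : ∀ q ∈ (Ioi (0 : ℝ) ×ˢ (univ : Set ℝ)), √q.1 ≠ 0 := fun q hq =>
      (Real.sqrt_pos.2 hq.1).ne'
    have h3 : ∀ q ∈ (Ioi (0 : ℝ) ×ˢ (univ : Set ℝ)), q.1 ≠ 0 := fun q hq =>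
      (show (0 : ℝ) < q.1 from hq.1).ne'
    unfold gauss
    fun_prop (disch := assumption)
  have hcc : ∀ e : (Fin d → ℤ) × Fin d, ContinuousOn
      (fun q : ℝ × ℝ => corrector d q.1 (edgeSqDist z e q.2) (e.1 e.2 + q.2 - z e.2))
        (Ioi 0 ×ˢ univ) := fun e => by
    have h1 := continuous_edgeSqDist z e
    have h3 : ∀ q ∈ (Ioi (0 : ℝ) ×ˢ (univ : Set ℝ)), q.1 ≠ 0 := fun q hq =>
      (show (0 : ℝ) < q.1 from hq.1).ne'
    unfold corrector
    fun_prop (disch := assumption)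
  have hbc : ContinuousOn (fun q : ℝ × ℝ => (d : ℝ) / q.1) (Ioi 0 ×ˢ univ) := by
    have h3 : ∀ q ∈ (Ioi (0 : ℝ) ×ˢ (univ : Set ℝ)), q.1 ≠ 0 := fun q hq =>
      (show (0 : ℝ) < q.1 from hq.1).ne'
    fun_prop (disch := assumption)
  have hic : ContinuousOn (fun q : ℝ × ℝ => (q.1)⁻¹) (Ioi 0 ×ˢ univ) := by
    have h3 : ∀ q ∈ (Ioi (0 : ℝ) ×ˢ (univ : Set ℝ)), q.1 ≠ 0 := fun q hq =>
      (show (0 : ℝ) < q.1 from hq.1).ne'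
    fun_prop (disch := assumption)
  set W : ℝ → Point d → ℝ := fun s y =>
    256 * √(d / s) ^ 3 * ((√s)⁻¹ ^ d * Real.exp (-(sqDist z y / (4 * (s / d))))) with hW
  have hmain := hp.integral_le_of_backward x hT hs₁0 (h := fun s => parametrix z s)
    (F := fun e s u => gauss d s (edgeSqDist z e u) *
      (1 + corrector d s (edgeSqDist z e u) (e.1 e.2 + u - z e.2) * (u * (1 - u))))
    (F₁ := fun e => parametrixDeriv z e) (F₂ := fun e => parametrixDeriv₂ z e)
    (Fs := fun e => parametrixDerivTime z e)
    (B := 1024 * (√s₁)⁻¹ ^ d) (W := W) (B' := 256 * √(d / s₁) ^ 3 * (√s₁)⁻¹ ^ d)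
    (Ξ := fun r => 2 * D * (√(s₁ + T - r))⁻¹) (ε := fun r => D * (√(s₁ + T - r))⁻¹ ^ 3)
    (fun s _ => continuous_parametrix z s) (fun s _ v => parametrix_kirchhoff z s v)
    (fun e s _ u => hasDerivAt_parametrix z e s u)
    (fun e s _ u => hasDerivAt_parametrixDeriv z e s u)
    (fun e s hs u => hasDerivAt_parametrix_time z e hd0 hs u)
    (fun e => ?_) (fun e => ?_) (fun e => ?_) (fun e => ?_)
    (fun s _ e u hu => parametrix_edgePoint z s e hu) ?_ (fun s _ => ?_) ?_ ?_ ?_ ?_ ?_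
  · -- reading the bound off from the behaviour on the cube at the initial time
    have hup : parametrix z (s₁ + T) x ≤ (√T)⁻¹ ^ d :=
      (le_abs_self _).trans ((abs_parametrix_le hd z (by linarith) x).trans
        (pow_le_pow_left₀ (by positivity) (inv_sqrt_anti hT (by linarith)) _))
    have hΞ : 2 * D * (√(s₁ + T - T))⁻¹ - 2 * D * (√(s₁ + T - 0))⁻¹ ≤ 2 * D * (√s₁)⁻¹ := by
      rw [add_sub_cancel_right]
      have : 0 ≤ 2 * D * (√(s₁ + T - 0))⁻¹ := by positivity
      linarith
    have hβ : (d : ℝ) / s₁ = A⁻¹ := by rw [hs₁]; field_simp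
    -- the Gaussian exceeds the parametrix by at most a Gaussian with the small factor `A⁻¹`
    have hlow : ∀ y, gauss d s₁ (sqDist z y) ≤ parametrix z s₁ y +
        A⁻¹ * (√s₁)⁻¹ ^ d * Real.exp (-(sqDist z y / (4 * A))) := fun y => by
      have h1 := abs_parametrix_sub_gauss_le z hd s₁ y
      have h2 := gauss_mul_le (d := d) (s := s₁) (q := sqDist z y)
        (mul_nonneg (by positivity) (sqDist_nonneg z y))
      have h3 : gauss d s₁ (sqDist z y) * (d / s₁ * (d / s₁ * sqDist z y / 8)) ≤
          d / s₁ * ((√s₁)⁻¹ ^ d * Real.exp (-(d / s₁ * sqDist z y / 4))) := by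
        rw [mul_left_comm]
        gcongr
      have h4 : d / s₁ * sqDist z y / 4 = sqDist z y / (4 * A) := by
        rw [hβ]; field_simp
      rw [h4] at h3
      rw [hβ] at h3
      have h5 := (abs_le.1 h1).1
      rw [hβ] at h5
      linarith
    have hpi : Integrable (parametrix z s₁) (transition p T x) :=
      hp.integrable_transition hT x (continuous_parametrix z s₁) (abs_parametrix_le hd z hds)
    have hgi : Integrable (fun y => gauss d s₁ (sqDist z y)) (transition p T x) :=
      hp.integrable_transition hT x ((continuous_gauss d s₁).comp (continuous_sqDist z))
        (B := (√s₁)⁻¹ ^ d) fun y => by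
        have : 0 ≤ d / s₁ * sqDist z y := mul_nonneg (by positivity) (sqDist_nonneg z y)
        rw [gauss, abs_of_nonneg (by positivity)]
        exact mul_le_of_le_one_right (by positivity) (Real.exp_le_one_iff.2 (by linarith))
    have hcube : (transition p T x).real (cube z (√A)) * (Real.exp (-(d / 2)) * (√s₁)⁻¹ ^ d) ≤
        ∫ y, gauss d s₁ (sqDist z y) ∂(transition p T x) := by
      have := hfin T hT
      have h1 := measureReal_le_integral (κ := transition p T x)
        (f := fun y => gauss d s₁ (sqDist z y) / (Real.exp (-(d / 2)) * (√s₁)⁻¹ ^ d))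
        (measurableSet_cube z (√A)) (fun y => by unfold gauss; positivity) (hgi.div_const _)
        fun y hy => by
          rw [one_le_div (by positivity), gauss, mul_comm]
          gcongr
          rw [hβ]
          have h2 : sqDist z y ≤ d * A := by
            calc sqDist z y ≤ ∑ _j : Fin d, A := Finset.sum_le_sum fun j _ => by
                  have := pow_le_pow_left₀ (abs_nonneg _) (hy j) 2
                  rwa [sq_abs, Real.sq_sqrt hA0.le] at this
              _ = d * A := by simp
          calc A⁻¹ * sqDist z y ≤ A⁻¹ * (d * A) := by gcongr
            _ = d := by field_simp
      rw [integral_div, le_div_iff₀ (by positivity)] at h1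
      exact h1
    refine hcube.trans ((integral_mono hgi
      (hpi.add ((hexpi T hT (4 * A) (by positivity)).const_mul _)) hlow).trans ?_)
    rw [integral_add' hpi ((hexpi T hT (4 * A) (by positivity)).const_mul _), integral_const_mul]
    have := hfin T hT
    have h6 := hK (transition p T x) (√A) (N * (√T)⁻¹ ^ d) hsA (hle T ⟨hT, le_rfl⟩) z A
      (Real.sq_sqrt hA0.le).le
    rw [div_self hsA.ne', one_pow, mul_one] at h6
    have h7 : A⁻¹ * (√s₁)⁻¹ ^ d * ∫ y, Real.exp (-(sqDist z y / (4 * A))) ∂(transition p T x) ≤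
        A⁻¹ * (√s₁)⁻¹ ^ d * (K * (N * (√T)⁻¹ ^ d)) := by gcongr
    linarith
  · have := hgc e
    have := hcc e
    simp only [Function.uncurry_def]
    fun_prop
  · have := hgc e
    have := hcc e
    unfold parametrixDeriv
    simp only [Function.uncurry_def]
    fun_prop
  · have := hgc e
    have := hcc e
    unfold parametrixDeriv₂
    simp only [Function.uncurry_def]
    fun_prop
  · have := hgc e
    have := hcc e
    have := continuous_edgeSqDist z e
    unfold parametrixDerivTime
    simp only [Function.uncurry_def, div_eq_mul_inv _ (Prod.fst _)]
    simp only [div_eq_mul_inv] at hbc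
    fun_prop
  · intro s hs e u hu
    have hds' : (d : ℝ) ≤ s := hds.trans hs.1
    have hss : (√s)⁻¹ ^ d ≤ (√s₁)⁻¹ ^ d :=
      pow_le_pow_left₀ (by positivity) (inv_sqrt_anti hs₁0 hs.1) _
    refine ⟨?_, ?_⟩
    · rw [← parametrix_edgePoint z s e hu]
      refine (abs_parametrix_le hd z hds' _).trans ?_
      have : 0 ≤ (√s₁)⁻¹ ^ d := by positivity
      linarith
    · refine (abs_parametrixDeriv_le z e hd hds' hu).trans ?_
      gcongr
  · have := hexpc (4 * (s / d))
    simp only [hW]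
    fun_prop
  · intro s hs y
    have hs0 : 0 < s := hs₁0.trans hs.1
    refine ⟨by simp only [hW]; positivity, ?_⟩
    simp only [hW]
    rw [← mul_assoc]
    refine (mul_le_of_le_one_right (by positivity) (hexp1 _ (by positivity) y)).trans ?_
    have hss : (√s)⁻¹ ≤ (√s₁)⁻¹ := inv_sqrt_anti hs₁0 hs.1.le
    have : √(d / s) ≤ √(d / s₁) := Real.sqrt_le_sqrt (by gcongr; exact hs.1.le)
    gcongr
  · intro s hs e u hu
    have h1 := abs_parametrix_error_le z e hd (hds.trans hs.1.le) hu
    exact (le_abs_self _).trans h1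
  · have h3 : ∀ r ∈ Icc 0 T, √(s₁ + T - r) ≠ 0 := fun r hr =>
      (Real.sqrt_pos.2 (by linarith [hr.2])).ne'
    fun_prop (disch := assumption)
  · intro r hr
    have hpos : 0 < s₁ + T - r := by linarith [hr.2]
    have hpos' := Real.sqrt_pos.2 hpos
    have h1 : HasDerivAt (fun r : ℝ => s₁ + T - r) (-1) r := by
      simpa using (hasDerivAt_id r).const_sub (s₁ + T)
    have h2 := (((h1.sqrt hpos.ne').fun_inv hpos'.ne').const_mul (2 * D))
    refine h2.congr_deriv ?_
    field_simp
  · intro r hr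
    have hfin' := hfin r hr.1
    set s := s₁ + T - r with hs
    have hss : s₁ ≤ s := by linarith [hr.2]
    have hs0 : 0 < s := by linarith
    have hsq0 : 0 < √s := Real.sqrt_pos.2 hs0
    simp only [hW, integral_const_mul]
    set J := ∫ y, Real.exp (-(sqDist z y / (4 * (s / d)))) ∂(transition p r x) with hJ
    have hJ0 : 0 ≤ J := integral_nonneg fun y => (Real.exp_pos _).le
    have hDs : √(d / s) ^ 3 = √d ^ 3 * (√s)⁻¹ ^ 3 := by
      rw [Real.sqrt_div (by positivity), div_pow, inv_pow, div_eq_mul_inv]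
    have hcore : (√s)⁻¹ ^ d * J ≤ (√(T / 2))⁻¹ ^ d * (1 + K * ((√d * √A)⁻¹ ^ d * N)) := by
      -- For `r ≥ T / 2` the mass of cubes under `p r x` is controlled; for `r < T / 2` the time `s` left is
      -- at least `T / 2`, and the total mass suffices.
      rcases le_or_gt (T / 2) r with h | h
      · have hrN : ∀ z', (transition p r x).real (cube z' (√A)) ≤ N * (√(T / 2))⁻¹ ^ d :=
          fun z' => (hle r ⟨hr.1, hr.2.le⟩ z').trans (by
            have := inv_sqrt_anti (half_pos hT) h
            gcongr)
        have h6 := hK (transition p r x) (√A) _ hsA hrN z (s / d) (by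
          rw [Real.sq_sqrt hA0.le, le_div_iff₀ (by positivity)]
          linarith)
        calc (√s)⁻¹ ^ d * J ≤ (√s)⁻¹ ^ d * (K * (√(s / d) / √A) ^ d * (N * (√(T / 2))⁻¹ ^ d)) := by
              gcongr
          _ = (√(T / 2))⁻¹ ^ d * (K * ((√d * √A)⁻¹ ^ d * N)) := by
              rw [Real.sqrt_div hs0.le, div_div, div_eq_mul_inv, mul_pow, inv_pow]
              field_simp
          _ ≤ _ := by gcongr; linarith
      · have hJ1 : J ≤ 1 := by
          have hc : 0 < 4 * (s / d) := by positivity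
          exact (integral_le_measureReal (κ := transition p r x) MeasurableSet.univ
            (hexp1 _ hc) (hexpi r hr.1 _ hc) (fun y hy => absurd (mem_univ y) hy)).trans
            (hp.transition_real_le_one hr.1 x _)
        calc (√s)⁻¹ ^ d * J ≤ (√(T / 2))⁻¹ ^ d * 1 := by
              have := inv_sqrt_anti (half_pos hT) (show T / 2 ≤ s by linarith)
              gcongr
          _ ≤ _ := by
              gcongr
              have : 0 ≤ K * ((√d * √A)⁻¹ ^ d * N) := by positivity
              linarith
    calc _ = 256 * √d ^ 3 * (√s)⁻¹ ^ 3 * ((√s)⁻¹ ^ d * J) := by rw [hDs]; ring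
      _ ≤ 256 * √d ^ 3 * (√s)⁻¹ ^ 3 *
          ((√(T / 2))⁻¹ ^ d * (1 + K * ((√d * √A)⁻¹ ^ d * N))) := by gcongr
      _ = D * (√s)⁻¹ ^ 3 := by rw [hD]; ring

/-- The mass of a cube of half-side `ρ ≥ 1` at time `t` is at most of order `ρ ^ d * t ^ (-d/2)`. -/
theorem exists_transition_cube_bound {d : ℕ} (hd : 1 ≤ d) : ∃ C : ℝ, 1 ≤ C ∧
    ∀ p : ℝ → Point d → Point d → ℝ, IsHeatKernel d p → ∀ t > 0, ∀ x z (ρ : ℝ), 1 ≤ ρ →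
      (transition p t x).real (cube z ρ) ≤ C * ρ ^ d * (√t)⁻¹ ^ d := by
  obtain ⟨K, hK1, hK⟩ := exists_integral_gaussian_le d
  have hd' : (1 : ℝ) ≤ d := by exact_mod_cast hd
  have hsd : 0 < √(d : ℝ) := Real.sqrt_pos.2 (by linarith)
  set q := Real.exp (d / 2) * K * (512 * √d ^ 3 * √2 ^ d / √d + 1) with hq
  have hq1 : 1 ≤ q := by
    have h1 : 1 ≤ Real.exp ((d : ℝ) / 2) := Real.one_le_exp (by positivity)
    have h2 : 1 ≤ 512 * √(d : ℝ) ^ 3 * √2 ^ d / √d + 1 := by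
      have : 0 ≤ 512 * √(d : ℝ) ^ 3 * √2 ^ d / √d := by positivity
      linarith
    calc (1 : ℝ) = 1 * 1 * 1 := by norm_num
      _ ≤ q := by rw [hq]; gcongr
  -- the scale of the cubes is chosen such that the recursion contracts by a factor of two
  set a := 2 * q with ha
  have ha1 : 1 ≤ a := by linarith
  have ha0 : 0 < a := by linarith
  set A := a ^ 2 with hA
  have hA1 : 1 ≤ A := one_le_pow₀ ha1
  have hsA : √A = a := Real.sqrt_sq ha0.le
  have hsdA : √(d * A) = √d * a := by rw [Real.sqrt_mul (by positivity), hsA]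
  set c := Real.exp (d / 2) * (√d * a) ^ d with hc
  have hc0 : 0 < c := by positivity
  set c₀ := c + c * (512 * √d ^ 3 * √2 ^ d / (√d * a)) with hc₀
  have hc₀0 : 0 ≤ c₀ := by positivity
  have key : ∀ p : ℝ → Point d → Point d → ℝ, IsHeatKernel d p → ∀ t > 0, ∀ x z,
      (transition p t x).real (cube z a) ≤ 2 * c₀ * (√t)⁻¹ ^ d := by
    intro p hp T hT x
    -- The trivial bound `1 ≤ √T ^ d (√r)⁻¹ ^ d` starts the iteration, each step of which halves the
    -- part of the constant depending on `T`.
    have hind : ∀ n : ℕ, ∀ r ∈ Ioc 0 T, ∀ z, (transition p r x).real (cube z a) ≤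
        (2 * c₀ + √T ^ d / 2 ^ n) * (√r)⁻¹ ^ d := by
      intro n
      induction n with
      | zero =>
        intro r hr z
        have hr0 := Real.sqrt_pos.2 hr.1
        have h1 : 1 ≤ √T ^ d * (√r)⁻¹ ^ d := by
          rw [← mul_pow, ← div_eq_mul_inv]
          exact one_le_pow₀ ((one_le_div hr0).2 (Real.sqrt_le_sqrt hr.2))
        refine (hp.transition_real_le_one hr.1 x _).trans (h1.trans ?_)
        gcongr
        simp only [pow_zero, div_one]
        linarith
      | succ n ih =>
        intro r hr z
        have hr0 := Real.sqrt_pos.2 hr.1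
        set M := 2 * c₀ + √T ^ d / 2 ^ n with hM
        have hM0 : 0 ≤ M := by positivity
        have h1 := hp.parametrix_step hd x hK1 hK hA1 hM0 hr.1
          (fun r' hr' z' => by rw [hsA]; exact ih r' ⟨hr'.1, hr'.2.trans hr.2⟩ z') z
        have hr2 : (√(r / 2))⁻¹ = √2 * (√r)⁻¹ := by
          rw [Real.sqrt_div hr.1.le, inv_div, div_eq_mul_inv]
        rw [hsdA, hsA, hr2, Real.exp_neg] at h1
        have h2 : (transition p r x).real (cube z a) ≤ c * ((√r)⁻¹ ^ d +
            2 * (256 * √d ^ 3 * (√2 * (√r)⁻¹) ^ d * (1 + K * ((√d * a)⁻¹ ^ d * M))) * (√d * a)⁻¹ +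
            A⁻¹ * (√d * a)⁻¹ ^ d * (K * (M * (√r)⁻¹ ^ d))) := by
          rw [← div_le_iff₀' hc0]
          refine le_trans (le_of_eq ?_) h1
          rw [hc, div_eq_mul_inv, mul_inv, inv_pow]
        refine h2.trans ?_
        have h3 : c * ((√r)⁻¹ ^ d +
            2 * (256 * √d ^ 3 * (√2 * (√r)⁻¹) ^ d * (1 + K * ((√d * a)⁻¹ ^ d * M))) * (√d * a)⁻¹ +
            A⁻¹ * (√d * a)⁻¹ ^ d * (K * (M * (√r)⁻¹ ^ d))) =
            (c₀ + Real.exp (d / 2) * K * (512 * √d ^ 3 * √2 ^ d / √d * a⁻¹ + A⁻¹) * M) *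
              (√r)⁻¹ ^ d := by
          have h4 : c * (√d * a)⁻¹ ^ d = Real.exp (d / 2) := by
            rw [hc, mul_assoc, ← mul_pow, mul_inv_cancel₀ (by positivity), one_pow, mul_one]
          rw [hc₀, ← h4, mul_pow]
          simp only [div_eq_mul_inv, mul_inv]
          ring
        rw [h3]
        have h5 : Real.exp (d / 2) * K * (512 * √d ^ 3 * √2 ^ d / √d * a⁻¹ + A⁻¹) ≤ 1 / 2 := by
          have h6 : A⁻¹ ≤ a⁻¹ := inv_anti₀ ha0 (by rw [hA]; nlinarith)
          calc _ ≤ Real.exp (d / 2) * K * (512 * √d ^ 3 * √2 ^ d / √d * a⁻¹ + a⁻¹) := by gcongr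
            _ = q * a⁻¹ := by rw [hq]; ring
            _ = 1 / 2 := by rw [ha]; field_simp
        calc _ ≤ (c₀ + 1 / 2 * M) * (√r)⁻¹ ^ d := by gcongr
          _ = _ := by rw [hM, pow_succ]; ring
    intro z
    refine ge_of_tendsto' (x := atTop)
      (f := fun n : ℕ => (2 * c₀ + √T ^ d / 2 ^ n) * (√T)⁻¹ ^ d) ?_
      fun n => hind n T ⟨hT, le_rfl⟩ z
    have h1 : Tendsto (fun n : ℕ => √T ^ d * (1 / 2 : ℝ) ^ n) atTop (𝓝 (√T ^ d * 0)) :=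
      (tendsto_pow_atTop_nhds_zero_of_lt_one (by norm_num) (by norm_num)).const_mul _
    have h2 := (h1.const_add (2 * c₀)).mul_const ((√T)⁻¹ ^ d)
    simpa [div_eq_mul_inv] using h2
  refine ⟨max 1 (4 ^ d * (2 * c₀)), le_max_left _ _, fun p hp t ht x z ρ hρ => ?_⟩
  have := hp.isFiniteMeasure_transition ht x
  have h1 := measureReal_cube_le ha0 (key p hp t ht x) z (ρ := ρ) (by linarith)
  refine h1.trans ?_
  have h2 : 2 * (ρ / a) + 2 ≤ 4 * ρ := by
    have := div_le_self (by linarith : 0 ≤ ρ) ha1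
    linarith
  calc (2 * (ρ / a) + 2) ^ d * (2 * c₀ * (√t)⁻¹ ^ d) ≤
        (4 * ρ) ^ d * (2 * c₀ * (√t)⁻¹ ^ d) := by gcongr
    _ = 4 ^ d * (2 * c₀) * ρ ^ d * (√t)⁻¹ ^ d := by rw [mul_pow]; ring
    _ ≤ _ := by gcongr; exact le_max_right _ _

/-! ### Pointwise bounds for the heat kernel -/

/-- The sum of the heat kernels of the line centred at `a` and `-a`, up to normalization. Being
even, it solves the heat equation on a star-shaped graph. -/
def evenKernel (a s x : ℝ) : ℝ := gauss 1 s ((x - a) ^ 2) + gauss 1 s ((x + a) ^ 2)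

/-- The space derivative of `evenKernel`. -/
def evenKernelDeriv (a s x : ℝ) : ℝ :=
  -((x - a) / s * gauss 1 s ((x - a) ^ 2)) - (x + a) / s * gauss 1 s ((x + a) ^ 2)

/-- The second space derivative of `evenKernel`. -/
def evenKernelDeriv₂ (a s x : ℝ) : ℝ :=
  ((x - a) ^ 2 / s ^ 2 - 1 / s) * gauss 1 s ((x - a) ^ 2) +
    ((x + a) ^ 2 / s ^ 2 - 1 / s) * gauss 1 s ((x + a) ^ 2)

theorem hasDerivAt_gauss_sq (b s x : ℝ) : HasDerivAt (fun x => gauss 1 s ((x - b) ^ 2))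
    (-((x - b) / s * gauss 1 s ((x - b) ^ 2))) x := by
  have h1 : HasDerivAt (fun x : ℝ => (x - b) ^ 2) (2 * (x - b)) x := by
    simpa using ((hasDerivAt_id x).sub_const b).fun_pow 2
  refine ((hasDerivAt_gauss 1 s _).comp x h1).congr_deriv ?_
  push_cast
  ring

theorem hasDerivAt_gauss_sq_deriv (b s x : ℝ) :
    HasDerivAt (fun x => -((x - b) / s * gauss 1 s ((x - b) ^ 2)))
      (((x - b) ^ 2 / s ^ 2 - 1 / s) * gauss 1 s ((x - b) ^ 2)) x := by
  refine (((((hasDerivAt_id x).sub_const b).div_const s).fun_mul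
    (hasDerivAt_gauss_sq b s x)).fun_neg).congr_deriv ?_
  simp only [id]
  ring

theorem hasDerivAt_evenKernel (a s x : ℝ) :
    HasDerivAt (evenKernel a s) (evenKernelDeriv a s x) x := by
  have h2 := hasDerivAt_gauss_sq (-a) s x
  simp only [sub_neg_eq_add] at h2
  exact (hasDerivAt_gauss_sq a s x).fun_add h2

theorem hasDerivAt_evenKernelDeriv (a s x : ℝ) :
    HasDerivAt (evenKernelDeriv a s) (evenKernelDeriv₂ a s x) x := by
  have h2 := hasDerivAt_gauss_sq_deriv (-a) s x
  simp only [sub_neg_eq_add] at h2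
  exact (hasDerivAt_gauss_sq_deriv a s x).fun_add h2

theorem hasDerivAt_evenKernel_time (a x : ℝ) {s : ℝ} (hs : 0 < s) :
    HasDerivAt (fun s => evenKernel a s x) (evenKernelDeriv₂ a s x / 2) s := by
  refine ((hasDerivAt_gauss_time one_ne_zero hs _).fun_add
    (hasDerivAt_gauss_time one_ne_zero hs _)).congr_deriv ?_
  rw [evenKernelDeriv₂]
  push_cast
  ring

theorem gauss_one_nonneg (s q : ℝ) : 0 ≤ gauss 1 s q := by unfold gauss; positivity

theorem evenKernel_nonneg (a s x : ℝ) : 0 ≤ evenKernel a s x :=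
  add_nonneg (gauss_one_nonneg _ _) (gauss_one_nonneg _ _)

theorem gauss_one_le {s q : ℝ} (hs : 0 < s) (hq : 0 ≤ q) : gauss 1 s q ≤ (√s)⁻¹ := by
  rw [gauss, pow_one]
  refine mul_le_of_le_one_right (by positivity) (Real.exp_le_one_iff.2 ?_)
  have : 0 ≤ ((1 : ℕ) : ℝ) / s * q := by positivity
  linarith

theorem evenKernel_le (a x : ℝ) {s : ℝ} (hs : 0 < s) : evenKernel a s x ≤ 2 * (√s)⁻¹ := by
  have h1 := gauss_one_le hs (sq_nonneg (x - a))
  have h2 := gauss_one_le hs (sq_nonneg (x + a))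
  unfold evenKernel
  linarith

/-- Away from its centre, the heat kernel of the line and its derivative are bounded, uniformly in
time. -/
theorem gauss_one_bounded {s w : ℝ} (hs : 0 < s) (hw : 1 / 5 ≤ |w|) (hw2 : |w| ≤ 2) :
    gauss 1 s (w ^ 2) ≤ 320000 ∧ |w / s * gauss 1 s (w ^ 2)| ≤ 320000 := by
  set a := w ^ 2 / (2 * s) with ha
  have ha0 : 0 ≤ a := by positivity
  have hw1 : 1 / 25 ≤ w ^ 2 := by
    rw [← sq_abs]; nlinarith
  have hsi : s⁻¹ ≤ 50 * (1 + a) := by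
    have : s⁻¹ ≤ 50 * a := by
      rw [ha, inv_eq_one_div, mul_div_assoc', div_le_div_iff₀ hs (by positivity)]
      nlinarith
    linarith
  have hsq : (√s)⁻¹ ≤ 50 * (1 + a) := by
    rcases le_total 1 s with h | h
    · have : (√s)⁻¹ ≤ 1 := inv_le_one_of_one_le₀ (Real.one_le_sqrt.2 h)
      linarith
    · refine le_trans ?_ hsi
      refine inv_anti₀ hs (Real.le_sqrt_of_sq_le ?_)
      nlinarith
  have hg : gauss 1 s (w ^ 2) = (√s)⁻¹ * Real.exp (-a) := by
    rw [gauss, pow_one, ha]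
    congr 3
    push_cast
    field_simp
  have h2 : (1 + a) ^ 2 * Real.exp (-a) ≤ 64 := by
    calc (1 + a) ^ 2 * Real.exp (-a) ≤ 64 * Real.exp (a / 4) * Real.exp (-a) := by
          gcongr; exact sq_one_add_le_exp ha0
      _ = 64 * Real.exp (-(3 / 4 * a)) := by
          rw [mul_assoc, ← Real.exp_add]; ring_nf
      _ ≤ 64 * 1 := by
          gcongr
          exact Real.exp_le_one_iff.2 (by linarith)
      _ = 64 := by norm_num
  have he := Real.exp_pos (-a)
  constructor
  · rw [hg]
    calc _ ≤ 50 * (1 + a) * Real.exp (-a) := by gcongr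
      _ ≤ 50 * ((1 + a) ^ 2 * Real.exp (-a)) := by
          have : 1 + a ≤ (1 + a) ^ 2 := by nlinarith
          rw [mul_assoc]
          gcongr
      _ ≤ _ := by linarith
  · rw [hg, abs_mul, abs_div, abs_of_pos hs, abs_of_pos (by positivity : 0 < (√s)⁻¹ * Real.exp (-a)),
      div_eq_mul_inv]
    calc _ ≤ 2 * (50 * (1 + a)) * (50 * (1 + a) * Real.exp (-a)) := by gcongr
      _ = 5000 * ((1 + a) ^ 2 * Real.exp (-a)) := by ring
      _ ≤ _ := by linarith

/-- At distance less than one of a vertex there are only the `2 d` edges adjacent to it. -/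
theorem edgeSqDist_eq_sq {d : ℕ} {v : Fin d → ℤ} {e : (Fin d → ℤ) × Fin d} {u : ℝ}
    (h : edgeSqDist (fun j => (v j : ℝ)) e u < 1) :
    (∀ j, j ≠ e.2 → e.1 j = v j) ∧
      edgeSqDist (fun j => (v j : ℝ)) e u = (e.1 e.2 + u - v e.2) ^ 2 := by
  have h1 : ∀ j, j ≠ e.2 → e.1 j = v j := fun j hj => by
    have h2 := (Finset.single_le_sum
      (f := fun j => ((e.1 j : ℝ) + (if j = e.2 then u else 0) - v j) ^ 2)
      (fun _ _ => sq_nonneg _) (Finset.mem_univ j)).trans_lt h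
    simp only [hj, if_false, add_zero] at h2
    have h3 : (e.1 j - v j) ^ 2 < 1 := by exact_mod_cast h2
    have h4 : |e.1 j - v j| < 1 := (sq_lt_one_iff_abs_lt_one _).1 h3
    have h5 := Int.abs_lt_one_iff.1 h4
    omega
  refine ⟨h1, ?_⟩
  rw [edgeSqDist, Finset.sum_eq_single e.2]
  · simp
  · intro j _ hj
    simp [hj, h1 j hj]
  · simp

/-- The local approximate solution around a vertex: an even heat kernel, cut off at a distance less
than one. -/
def localKernel {d : ℕ} (v : Fin d → ℤ) (a s : ℝ) (y : Point d) : ℝ :=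
  Real.smoothTransition (3 - 4 * sqDist (fun j => (v j : ℝ)) y) *
    (∑ i, evenKernel a s ((y : EuclideanSpace ℝ (Fin d)) i - v i) - (d - 1) * evenKernel a s 0)

theorem continuous_localKernel {d : ℕ} (v : Fin d → ℤ) (a s : ℝ) :
    Continuous (localKernel v a s) := by
  have h1 := continuous_sqDist fun j => (v j : ℝ)
  have h2 := continuous_coord (d := d)
  have h3 : Continuous (evenKernel a s) :=
    continuous_iff_continuousAt.2 fun x => (hasDerivAt_evenKernel a s x).continuousAt
  have h4 := Real.smoothTransition.continuous
  unfold localKernel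
  fun_prop

theorem localKernel_edgePoint {d : ℕ} (v : Fin d → ℤ) (a s : ℝ) (e : (Fin d → ℤ) × Fin d) (u : ℝ) :
    localKernel v a s (edgePoint e.1 e.2 u) =
      Real.smoothTransition (3 - 4 * edgeSqDist (fun j => (v j : ℝ)) e u) *
        evenKernel a s (e.1 e.2 + u - v e.2) := by
  rw [localKernel, sqDist_edgePoint]
  rcases lt_or_ge (edgeSqDist (fun j => (v j : ℝ)) e u) 1 with h | h
  · congr 1
    obtain ⟨h1, -⟩ := edgeSqDist_eq_sq h
    have h2 : ∀ j, j ≠ e.2 → evenKernel a s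
        ((edgePoint e.1 e.2 u : EuclideanSpace ℝ (Fin d)) j - v j) = evenKernel a s 0 :=
      fun j hj => by rw [edgePoint_apply, if_neg hj, h1 j hj]; simp
    have h3 := Finset.sum_erase_add Finset.univ
      (fun j => evenKernel a s ((edgePoint e.1 e.2 u : EuclideanSpace ℝ (Fin d)) j - v j))
      (Finset.mem_univ e.2)
    have h4 : 1 ≤ d := Fin.pos e.2
    rw [← h3, Finset.sum_congr rfl fun j hj => h2 j (Finset.ne_of_mem_erase hj), Finset.sum_const,
      Finset.card_erase_of_mem (Finset.mem_univ _), Finset.card_univ, Fintype.card_fin,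
      nsmul_eq_mul, Nat.cast_sub h4, edgePoint_apply, if_pos rfl, Nat.cast_one,
      add_sub_cancel_left]
  · rw [Real.smoothTransition.zero_of_nonpos (by linarith), zero_mul, zero_mul]

set_option maxHeartbeats 2000000 in
/-- The integral of the local approximate solution at small time is bounded by the mass of a cube
during the last `2 δ` time units. -/
theorem exists_integral_localKernel_le (d : ℕ) : ∃ C : ℝ, 1 ≤ C ∧
    ∀ p : ℝ → Point d → Point d → ℝ, IsHeatKernel d p → ∀ (x : Point d) (v : Fin d → ℤ) (a : ℝ),
      0 ≤ a → a ≤ 1 / 2 → ∀ s₁ > 0, ∀ t δ σ : ℝ, 0 < δ → 4 * δ ≤ t → δ ≤ 1 →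
      (∀ r ∈ Ico (t - 2 * δ) t, (transition p r x).real (cube (fun j => (v j : ℝ)) 2) ≤ σ) →
        ∫ y, localKernel v a s₁ y ∂(transition p t x) ≤ C * (√δ)⁻¹ * σ := by
  obtain ⟨C, hC1, hC⟩ := exists_stepDeriv_bound
  refine ⟨9 * (88 * C * 320000 + 2 * C), by linarith, fun p hp x v a ha0 ha s₁ hs₁ t δ σ hδ hδt hδ1
    hσ => ?_⟩
  have ht : 0 < t := by linarith
  have hσ0 : 0 ≤ σ := measureReal_nonneg.trans (hσ (t - 2 * δ) ⟨le_rfl, by linarith⟩)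
  have hsδ : 0 < √δ := Real.sqrt_pos.2 hδ
  set c : Fin d → ℝ := fun j => (v j : ℝ) with hc
  -- the cutoff in space, `1` at squared distance `1 / 2` and `0` at squared distance `3 / 4`
  set φ : ℝ → ℝ := fun z => Real.smoothTransition (3 - 4 * z) with hφ
  set φ₁ : ℝ → ℝ := fun z => stepDeriv (3 - 4 * z) * (-4) with hφ₁
  set φ₂ : ℝ → ℝ := fun z => stepDeriv₂ (3 - 4 * z) * (-4) * (-4) with hφ₂
  have hlin : ∀ z : ℝ, HasDerivAt (fun z : ℝ => 3 - 4 * z) (-4) z := fun z => by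
    simpa using ((hasDerivAt_id z).const_mul 4).const_sub 3
  have hd1 : ∀ z, HasDerivAt φ (φ₁ z) z := fun z => (hasDerivAt_smoothTransition _).comp z (hlin z)
  have hd2 : ∀ z, HasDerivAt φ₁ (φ₂ z) z := fun z =>
    ((hasDerivAt_stepDeriv _).comp z (hlin z)).mul_const _
  have hφ0 : ∀ z, 0 ≤ φ z ∧ φ z ≤ 1 := fun z =>
    ⟨Real.smoothTransition.nonneg _, Real.smoothTransition.le_one _⟩
  have hφ₁b : ∀ z, |φ₁ z| ≤ 4 * C := fun z => by
    have := (hC (3 - 4 * z)).1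
    simp only [hφ₁, abs_mul, abs_neg, Nat.abs_ofNat]
    linarith
  have hφ₂b : ∀ z, |φ₂ z| ≤ 16 * C := fun z => by
    have := (hC (3 - 4 * z)).2
    simp only [hφ₂, abs_mul, abs_neg, Nat.abs_ofNat]
    linarith
  have hφz : ∀ z, z < 1 / 2 ∨ 3 / 4 < z → φ₁ z = 0 ∧ φ₂ z = 0 := fun z hz => by
    have h2 : 3 - 4 * z ∉ Icc (0 : ℝ) 1 := by
      rintro ⟨h3, h4⟩
      rcases hz with hz | hz <;> linarith
    simp only [hφ₁, hφ₂, stepDeriv_eq_zero h2, stepDeriv₂_eq_zero h2, zero_mul, and_self]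
  have hφz0 : ∀ z, 3 / 4 < z → φ z = 0 := fun z hz =>
    Real.smoothTransition.zero_of_nonpos (by linarith)
  -- the cutoff in time, `1` up to `s₁ + δ` and `0` from `s₁ + 2 δ` on
  set ψ : ℝ → ℝ := fun s => Real.smoothTransition (2 - (s - s₁) / δ) with hψ
  set ψ₁ : ℝ → ℝ := fun s => stepDeriv (2 - (s - s₁) / δ) * (-1 / δ) with hψ₁
  have hψd : ∀ s, HasDerivAt ψ (ψ₁ s) s := fun s => by
    have h1 : HasDerivAt (fun s : ℝ => 2 - (s - s₁) / δ) (-1 / δ) s := by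
      simpa [neg_div] using (((hasDerivAt_id s).sub_const s₁).div_const δ).const_sub 2
    exact (hasDerivAt_smoothTransition _).comp s h1
  have hψ0 : ∀ s, 0 ≤ ψ s ∧ ψ s ≤ 1 := fun s =>
    ⟨Real.smoothTransition.nonneg _, Real.smoothTransition.le_one _⟩
  have hψ₁b : ∀ s, |ψ₁ s| ≤ C / δ := fun s => by
    have := (hC (2 - (s - s₁) / δ)).1
    simp only [hψ₁, abs_mul, abs_div, abs_neg, abs_one, abs_of_pos hδ]
    rw [mul_one_div]
    gcongr
  have hψz : ∀ s, s₁ + 2 * δ < s → ψ s = 0 ∧ ψ₁ s = 0 := fun s hs => by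
    have h1 : 2 - (s - s₁) / δ < 0 := by
      have : 2 < (s - s₁) / δ := by rw [lt_div_iff₀ hδ]; linarith
      linarith
    refine ⟨Real.smoothTransition.zero_of_nonpos h1.le, ?_⟩
    simp only [hψ₁, stepDeriv_eq_zero fun h : _ ∈ Icc (0 : ℝ) 1 => absurd h.1 (not_le.2 h1),
      zero_mul]
  have hψ₁z : ∀ s, s < s₁ + δ → ψ₁ s = 0 := fun s hs => by
    have h1 : 1 < 2 - (s - s₁) / δ := by
      have : (s - s₁) / δ < 1 := by rw [div_lt_iff₀ hδ]; linarith
      linarith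
    simp only [hψ₁, stepDeriv_eq_zero fun h : _ ∈ Icc (0 : ℝ) 1 => absurd h.2 (not_le.2 h1),
      zero_mul]
  have hdc : ∀ e u, _ := fun (e : (Fin d → ℤ) × Fin d) u => hasDerivAt_comp_edgeSqDist c e hd1 hd2 u
  have hdE : ∀ (e : (Fin d → ℤ) × Fin d) (s u : ℝ),
      HasDerivAt (fun u => evenKernel a s (e.1 e.2 + u - c e.2))
        (evenKernelDeriv a s (e.1 e.2 + u - c e.2)) u := fun e s u => by
    simpa [Function.comp_def] using
      (hasDerivAt_evenKernel a s _).comp u (hasDerivAt_edgeCoord c e u)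
  have hdE₁ : ∀ (e : (Fin d → ℤ) × Fin d) (s u : ℝ),
      HasDerivAt (fun u => evenKernelDeriv a s (e.1 e.2 + u - c e.2))
        (evenKernelDeriv₂ a s (e.1 e.2 + u - c e.2)) u := fun e s u => by
    simpa [Function.comp_def] using
      (hasDerivAt_evenKernelDeriv a s _).comp u (hasDerivAt_edgeCoord c e u)
  have hgc : ∀ (e : (Fin d → ℤ) × Fin d) (b : ℝ), ContinuousOn
      (fun q : ℝ × ℝ => gauss 1 q.1 ((e.1 e.2 + q.2 - c e.2 + b) ^ 2)) (Ioi 0 ×ˢ univ) :=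
    fun e b => by
    have h2 : ∀ q ∈ (Ioi (0 : ℝ) ×ˢ (univ : Set ℝ)), √q.1 ≠ 0 := fun q hq =>
      (Real.sqrt_pos.2 hq.1).ne'
    have h3 : ∀ q ∈ (Ioi (0 : ℝ) ×ˢ (univ : Set ℝ)), q.1 ≠ 0 := fun q hq =>
      (show (0 : ℝ) < q.1 from hq.1).ne'
    unfold gauss
    fun_prop (disch := assumption)
  have hic : ContinuousOn (fun q : ℝ × ℝ => (q.1)⁻¹) (Ioi 0 ×ˢ univ) := by
    have h3 : ∀ q ∈ (Ioi (0 : ℝ) ×ˢ (univ : Set ℝ)), q.1 ≠ 0 := fun q hq =>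
      (show (0 : ℝ) < q.1 from hq.1).ne'
    fun_prop (disch := assumption)
  have hEc : ∀ e : (Fin d → ℤ) × Fin d, ContinuousOn
      (fun q : ℝ × ℝ => evenKernel a q.1 (e.1 e.2 + q.2 - c e.2)) (Ioi 0 ×ˢ univ) := fun e =>
    (hgc e (-a)).add (hgc e a)
  have hEc₁ : ∀ e : (Fin d → ℤ) × Fin d, ContinuousOn
      (fun q : ℝ × ℝ => evenKernelDeriv a q.1 (e.1 e.2 + q.2 - c e.2)) (Ioi 0 ×ˢ univ) := fun e => by
    have h1 := hgc e (-a)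
    have h2 := hgc e a
    simp only [← sub_eq_add_neg] at h1
    unfold evenKernelDeriv
    simp only [div_eq_mul_inv]
    fun_prop
  have hEc₂ : ∀ e : (Fin d → ℤ) × Fin d, ContinuousOn
      (fun q : ℝ × ℝ => evenKernelDeriv₂ a q.1 (e.1 e.2 + q.2 - c e.2)) (Ioi 0 ×ˢ univ) :=
    fun e => by
    have h1 := hgc e (-a)
    have h2 := hgc e a
    simp only [← sub_eq_add_neg] at h1
    unfold evenKernelDeriv₂
    simp only [div_eq_mul_inv, ← inv_pow]
    fun_prop
  have hφc : Continuous φ := continuous_iff_continuousAt.2 fun z => (hd1 z).continuousAt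
  have hφ₁c : Continuous φ₁ := continuous_iff_continuousAt.2 fun z => (hd2 z).continuousAt
  have hφ₂c : Continuous φ₂ := by
    have := continuous_stepDeriv₂
    simp only [hφ₂]; fun_prop
  have hψc : Continuous ψ := continuous_iff_continuousAt.2 fun z => (hψd z).continuousAt
  have hψ₁c : Continuous ψ₁ := by
    have := continuous_stepDeriv
    simp only [hψ₁]; fun_prop
  clear_value φ₁ φ₂ ψ₁
  -- on the support of the cutoff
  have hsupp : ∀ (e : (Fin d → ℤ) × Fin d) (u : ℝ), edgeSqDist c e u ≤ 3 / 4 →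
      |(e.1 e.2 : ℝ) + u - c e.2| ≤ 1 ∧ (1 / 2 ≤ edgeSqDist c e u →
        7 / 10 ≤ |(e.1 e.2 : ℝ) + u - c e.2|) := fun e u hq => by
    obtain ⟨-, h1⟩ := edgeSqDist_eq_sq (v := v) (e := e) (u := u) (by simp only [hc] at hq; linarith)
    change edgeSqDist c e u = (e.1 e.2 + u - c e.2) ^ 2 at h1
    rw [h1] at hq ⊢
    refine ⟨abs_le_of_sq_le_sq (by linarith) zero_le_one, fun h2 => ?_⟩
    exact le_abs.2 (by
      by_contra! h3
      nlinarith [h3.1, h3.2])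
  have hE₁b : ∀ s > 0, ∀ y : ℝ, |y| ≤ 1 → |evenKernelDeriv a s y| ≤ 4 * s⁻¹ * (√s)⁻¹ :=
    fun s hs y hy => by
    obtain ⟨hy1, hy2⟩ := abs_le.1 hy
    have hk : ∀ w : ℝ, |w| ≤ 2 → |w / s * gauss 1 s (w ^ 2)| ≤ 2 * s⁻¹ * (√s)⁻¹ := fun w hw => by
      rw [abs_mul, abs_div, abs_of_pos hs, abs_of_nonneg (gauss_one_nonneg _ _), div_eq_mul_inv]
      have := gauss_one_le hs (sq_nonneg w)
      have := gauss_one_nonneg s (w ^ 2)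
      gcongr
    have h1 := hk (y - a) (abs_le.2 ⟨by linarith, by linarith⟩)
    have h2 := hk (y + a) (abs_le.2 ⟨by linarith, by linarith⟩)
    rw [evenKernelDeriv]
    refine (abs_sub _ _).trans ?_
    rw [abs_neg]
    linarith
  -- The error comes from the derivatives of the two cutoffs. It is bounded by `D` during `2 δ` units of
  -- time, with `D δ` of order `(√δ)⁻¹`, and supported near `v`: there `κ` is a continuous substitute for the
  -- indicator function of a cube.
  set ω : ℝ → ℝ := fun s => if s ≤ s₁ + 2 * δ then 1 else 0 with hω
  set D := 88 * C * 320000 + 2 * C * δ⁻¹ * (√δ)⁻¹ with hD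
  have hD0 : 0 ≤ D := by positivity
  set κ : ℝ → ℝ := fun q => max 0 (min 1 (2 - q)) with hκ
  have hκ0 : ∀ q, 0 ≤ κ q ∧ κ q ≤ 1 := fun q =>
    ⟨le_max_left _ _, max_le zero_le_one (min_le_left _ _)⟩
  -- `Ξ` is at most a bounded multiple of `D σ δ`;
  -- its derivative `ε` is at least `D σ` for `t - r ≤ 2 δ`.
  have hmain := hp.integral_le_of_backward x ht hs₁ (h := fun s y => ψ s * localKernel v a s y)
    (F := fun e s u => ψ s * (φ (edgeSqDist c e u) * evenKernel a s (e.1 e.2 + u - c e.2)))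
    (F₁ := fun e s u => ψ s * (φ₁ (edgeSqDist c e u) * (2 * (e.1 e.2 + u - c e.2)) *
      evenKernel a s (e.1 e.2 + u - c e.2) +
      φ (edgeSqDist c e u) * evenKernelDeriv a s (e.1 e.2 + u - c e.2)))
    (F₂ := fun e s u => ψ s * (((φ₂ (edgeSqDist c e u) * (2 * (e.1 e.2 + u - c e.2)) ^ 2 +
      2 * φ₁ (edgeSqDist c e u)) * evenKernel a s (e.1 e.2 + u - c e.2) +
      φ₁ (edgeSqDist c e u) * (2 * (e.1 e.2 + u - c e.2)) *
        evenKernelDeriv a s (e.1 e.2 + u - c e.2)) +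
      (φ₁ (edgeSqDist c e u) * (2 * (e.1 e.2 + u - c e.2)) *
        evenKernelDeriv a s (e.1 e.2 + u - c e.2) +
      φ (edgeSqDist c e u) * evenKernelDeriv₂ a s (e.1 e.2 + u - c e.2))))
    (Fs := fun e s u => ψ₁ s * (φ (edgeSqDist c e u) * evenKernel a s (e.1 e.2 + u - c e.2)) +
      ψ s * (φ (edgeSqDist c e u) * (evenKernelDeriv₂ a s (e.1 e.2 + u - c e.2) / 2)))
    (B := 2 * (√s₁)⁻¹ + 4 * C * 2 * (2 * (√s₁)⁻¹) + 4 * s₁⁻¹ * (√s₁)⁻¹)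
    (W := fun s y => D * ω s * κ (sqDist c y)) (B' := D)
    (Ξ := fun r => 9 * (D * σ) * δ / (1 + (t - r) / δ))
    (ε := fun r => 9 * (D * σ) / (1 + (t - r) / δ) ^ 2)
    (fun s _ => (continuous_localKernel v a s).const_mul _) ?_
    (fun e s _ u => ((hdc e u).1.fun_mul (hdE e s u)).const_mul _)
    (fun e s _ u => (((hdc e u).2.fun_mul (hdE e s u)).fun_add
      ((hdc e u).1.fun_mul (hdE₁ e s u))).const_mul _)
    (fun e s hs u => (hψd s).fun_mul ((hasDerivAt_evenKernel_time a _ hs).const_mul _))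
    (fun e => ?_) (fun e => ?_) (fun e => ?_) (fun e => ?_)
    (fun s _ e u _ => ?_) ?_ (fun s _ => ?_) ?_ ?_ ?_ ?_ ?_
  · have h1 : ψ s₁ = 1 := Real.smoothTransition.one_of_one_le (by simp)
    have h2 : ψ (s₁ + t) = 0 := (hψz _ (by linarith)).1
    simp only [h1, one_mul, h2, zero_mul, zero_add, sub_self, zero_div, add_zero, div_one,
      sub_zero] at hmain
    refine hmain.trans ?_
    have h3 : 0 ≤ 9 * (D * σ) * δ / (1 + t / δ) := by positivity
    have h4 : D * δ ≤ (88 * C * 320000 + 2 * C) * (√δ)⁻¹ := by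
      have h5 : δ * δ⁻¹ = 1 := mul_inv_cancel₀ hδ.ne'
      have h6 : 1 ≤ (√δ)⁻¹ := (one_le_inv₀ hsδ).2 (Real.sqrt_le_one.2 hδ1)
      have h7 : 88 * C * 320000 * δ ≤ 88 * C * 320000 * (√δ)⁻¹ := by
        gcongr
        linarith
      calc D * δ = 88 * C * 320000 * δ + 2 * C * (√δ)⁻¹ * (δ * δ⁻¹) := by rw [hD]; ring
        _ ≤ _ := by rw [h5]; linarith
    calc _ ≤ 9 * (D * δ) * σ := by linarith
      _ ≤ 9 * ((88 * C * 320000 + 2 * C) * (√δ)⁻¹) * σ := by gcongr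
      _ = _ := by ring
  · intro s _ w
    refine Finset.sum_eq_zero fun i _ => ?_
    have h1 : edgeSqDist c (w - Pi.single i 1, i) 1 = edgeSqDist c (w, i) 0 := by
      rw [← sqDist_edgePoint, ← sqDist_edgePoint, edgePoint_sub_single]
    simp [h1]
  · have := continuous_edgeSqDist c e
    have := hEc e
    simp only [Function.uncurry_def]
    fun_prop
  · have := continuous_edgeSqDist c e
    have := hEc e
    have := hEc₁ e
    simp only [Function.uncurry_def]
    fun_prop
  · have := continuous_edgeSqDist c e
    have := hEc e
    have := hEc₁ e
    have := hEc₂ e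
    simp only [Function.uncurry_def]
    fun_prop
  · have := continuous_edgeSqDist c e
    have := hEc e
    have := hEc₂ e
    simp only [Function.uncurry_def]
    fun_prop
  · simp only [localKernel_edgePoint, hφ, hc]
  · intro s hs e u hu
    have hs0 : 0 < s := hs₁.trans_le hs.1
    have hss := inv_sqrt_anti hs₁ hs.1
    have hsi : s⁻¹ ≤ s₁⁻¹ := inv_anti₀ hs₁ hs.1
    have hsp : 0 < (√s₁)⁻¹ := inv_pos.2 (Real.sqrt_pos.2 hs₁)
    have hsp' : 0 < s₁⁻¹ := inv_pos.2 hs₁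
    have hE0 := evenKernel_nonneg a s (e.1 e.2 + u - c e.2)
    have hEb : evenKernel a s (e.1 e.2 + u - c e.2) ≤ 2 * (√s₁)⁻¹ :=
      (evenKernel_le a _ hs0).trans (by gcongr)
    obtain ⟨hψa, hψb⟩ := hψ0 s
    obtain ⟨hφa, hφb⟩ := hφ0 (edgeSqDist c e u)
    have hp1 : 0 ≤ 4 * C * 2 * (2 * (√s₁)⁻¹) := by positivity
    have hp2 : 0 ≤ 4 * s₁⁻¹ * (√s₁)⁻¹ := by positivity
    refine ⟨?_, ?_⟩
    · rw [abs_of_nonneg (by positivity)]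
      calc _ ≤ 1 * (1 * (2 * (√s₁)⁻¹)) := by gcongr
        _ ≤ _ := by linarith
    · rcases le_or_gt (edgeSqDist c e u) (3 / 4) with hq | hq
      · obtain ⟨hx, -⟩ := hsupp e u hq
        rw [abs_mul, abs_of_nonneg hψa]
        have t1 : |φ₁ (edgeSqDist c e u) * (2 * (e.1 e.2 + u - c e.2)) *
            evenKernel a s (e.1 e.2 + u - c e.2)| ≤ 4 * C * 2 * (2 * (√s₁)⁻¹) := by
          rw [abs_mul, abs_mul, abs_mul, abs_two, abs_of_nonneg hE0]
          have := hφ₁b (edgeSqDist c e u)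
          gcongr
          linarith
        have t2 : |φ (edgeSqDist c e u) * evenKernelDeriv a s (e.1 e.2 + u - c e.2)| ≤
            1 * (4 * s₁⁻¹ * (√s₁)⁻¹) := by
          rw [abs_mul, abs_of_nonneg hφa]
          gcongr
          exact (hE₁b s hs0 _ hx).trans (by gcongr)
        calc _ ≤ 1 * (4 * C * 2 * (2 * (√s₁)⁻¹) + 1 * (4 * s₁⁻¹ * (√s₁)⁻¹)) := by
              gcongr
              exact (abs_add_le _ _).trans (add_le_add t1 t2)
          _ ≤ _ := by linarith
      · rw [(hφz _ (Or.inr hq)).1, hφz0 _ hq]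
        simp only [zero_mul, add_zero, mul_zero, abs_zero]
        positivity
  · have := continuous_sqDist c
    simp only [hκ]
    fun_prop
  · intro s _ y
    have hω0 : 0 ≤ ω s ∧ ω s ≤ 1 := by
      simp only [hω]; split_ifs <;> norm_num
    obtain ⟨h1, h2⟩ := hκ0 (sqDist c y)
    refine ⟨mul_nonneg (mul_nonneg hD0 hω0.1) h1, ?_⟩
    calc D * ω s * κ (sqDist c y) ≤ D * 1 * 1 := by
          have := hω0.1
          have := hω0.2
          gcongr
      _ = D := by ring
  · intro s hs e u hu
    have hs0 : 0 < s := hs₁.trans hs.1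
    rw [sqDist_edgePoint]
    have hω0 : 0 ≤ ω s := by
      simp only [hω]; split_ifs <;> norm_num
    have hrhs := mul_nonneg (mul_nonneg hD0 hω0) (hκ0 (edgeSqDist c e u)).1
    rcases le_or_gt (edgeSqDist c e u) (3 / 4) with hq | hq
    · rcases le_or_gt s (s₁ + 2 * δ) with hsδ' | hsδ'
      · obtain ⟨hx, hx'⟩ := hsupp e u hq
        have hκ1 : κ (edgeSqDist c e u) = 1 := by
          simp only [hκ]
          rw [min_eq_left (by linarith), max_eq_right zero_le_one]
        have hω1 : ω s = 1 := if_pos hsδ'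
        rw [hκ1, hω1, mul_one, mul_one]
        obtain ⟨hψa, hψb⟩ := hψ0 s
        obtain ⟨hφa, hφb⟩ := hφ0 (edgeSqDist c e u)
        set y := (e.1 e.2 : ℝ) + u - c e.2 with hy
        set q := edgeSqDist c e u with hqdef
        have hE0 := evenKernel_nonneg a s y
        have t1 : -(ψ₁ s * (φ q * evenKernel a s y)) ≤ 2 * C * δ⁻¹ * (√δ)⁻¹ := by
          rcases lt_or_ge s (s₁ + δ) with h | h
          · rw [hψ₁z s h, zero_mul, neg_zero]
            positivity
          · have h1 : evenKernel a s y ≤ 2 * (√δ)⁻¹ :=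
              (evenKernel_le a y hs0).trans (by
                have := inv_sqrt_anti hδ (show δ ≤ s by linarith)
                gcongr)
            refine (neg_le_abs _).trans ?_
            rw [abs_mul, abs_of_nonneg (mul_nonneg hφa hE0)]
            calc _ ≤ C / δ * (1 * (2 * (√δ)⁻¹)) := by
                  have := hψ₁b s
                  gcongr
              _ = _ := by ring
        have t2 : (1 / 2) * ((φ₂ q * (2 * y) ^ 2 + 2 * φ₁ q) * evenKernel a s y) +
            φ₁ q * (2 * y) * evenKernelDeriv a s y ≤ 88 * C * 320000 := by
          rcases lt_or_ge q (1 / 2) with h | h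
          · rw [(hφz q (Or.inl h)).1, (hφz q (Or.inl h)).2]
            simp only [zero_mul, mul_zero, add_zero]
            positivity
          · have hy7 := hx' h
            obtain ⟨hxa, hxb⟩ := abs_le.1 hx
            have hw1 : 1 / 5 ≤ |y - a| ∧ 1 / 5 ≤ |y + a| := by
              rcases le_abs.1 hy7 with h7 | h7
              · exact ⟨le_abs.2 (Or.inl (by linarith)), le_abs.2 (Or.inl (by linarith))⟩
              · exact ⟨le_abs.2 (Or.inr (by linarith)), le_abs.2 (Or.inr (by linarith))⟩
            have g1 := gauss_one_bounded hs0 hw1.1 (abs_le.2 ⟨by linarith, by linarith⟩)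
            have g2 := gauss_one_bounded hs0 hw1.2 (abs_le.2 ⟨by linarith, by linarith⟩)
            have hEb : evenKernel a s y ≤ 2 * 320000 := by
              rw [evenKernel]; linarith [g1.1, g2.1]
            have hE₁b' : |evenKernelDeriv a s y| ≤ 2 * 320000 := by
              rw [evenKernelDeriv]
              refine (abs_sub _ _).trans ?_
              rw [abs_neg]
              linarith [g1.2, g2.2]
            have a1 : |φ₂ q * (2 * y) ^ 2 + 2 * φ₁ q| ≤ 72 * C := by
              refine (abs_add_le _ _).trans ?_
              rw [abs_mul, abs_mul, abs_pow, abs_mul, abs_two]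
              calc _ ≤ 16 * C * (2 * 1) ^ 2 + 2 * (4 * C) := by
                    have := hφ₂b q
                    have := hφ₁b q
                    gcongr
                _ = _ := by ring
            have a2 : |(φ₂ q * (2 * y) ^ 2 + 2 * φ₁ q) * evenKernel a s y| ≤
                72 * C * (2 * 320000) := by
              rw [abs_mul, abs_of_nonneg hE0]
              gcongr
            have a3 : |φ₁ q * (2 * y) * evenKernelDeriv a s y| ≤
                4 * C * (2 * 1) * (2 * 320000) := by
              rw [abs_mul, abs_mul, abs_mul, abs_two]
              have := hφ₁b q
              gcongr
            have b2 := (abs_le.1 a2).2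
            have b3 := (abs_le.1 a3).2
            linarith
        have t3 : ψ s * ((1 / 2) * ((φ₂ q * (2 * y) ^ 2 + 2 * φ₁ q) * evenKernel a s y) +
            φ₁ q * (2 * y) * evenKernelDeriv a s y) ≤ 88 * C * 320000 := by
          calc _ ≤ ψ s * (88 * C * 320000) := by gcongr
            _ ≤ 1 * (88 * C * 320000) := by gcongr
            _ = _ := one_mul _
        calc _ = ψ s * ((1 / 2) * ((φ₂ q * (2 * y) ^ 2 + 2 * φ₁ q) * evenKernel a s y) +
            φ₁ q * (2 * y) * evenKernelDeriv a s y) + -(ψ₁ s * (φ q * evenKernel a s y)) := by ring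
          _ ≤ D := by rw [hD]; exact add_le_add t3 t1
      · rw [(hψz s hsδ').1, (hψz s hsδ').2]
        simpa using hrhs
    · rw [(hφz _ (Or.inr hq)).1, (hφz _ (Or.inr hq)).2, hφz0 _ hq]
      simpa using hrhs
  · have h3 : ∀ r ∈ Icc 0 t, 1 + (t - r) / δ ≠ 0 := fun r hr => by
      have : 0 ≤ (t - r) / δ := div_nonneg (by linarith [hr.2]) hδ.le
      linarith
    fun_prop (disch := assumption)
  · intro r hr
    have h0 : 1 + (t - r) / δ ≠ 0 := by
      have : 0 ≤ (t - r) / δ := div_nonneg (by linarith [hr.2]) hδ.le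
      linarith
    have h1 : HasDerivAt (fun r : ℝ => 1 + (t - r) / δ) (-1 / δ) r := by
      simpa using (((hasDerivAt_id r).const_sub t).div_const δ).const_add 1
    have h2 := (h1.fun_inv h0).const_mul (9 * (D * σ) * δ)
    simp only [← div_eq_mul_inv] at h2
    refine h2.congr_deriv ?_
    field_simp
  · intro r hr
    have hfin := hp.isFiniteMeasure_transition hr.1 x
    rw [integral_const_mul]
    have hpos : 0 < 1 + (t - r) / δ := by
      have : 0 ≤ (t - r) / δ := div_nonneg (by linarith [hr.2]) hδ.le
      linarith
    by_cases hrδ : s₁ + t - r ≤ s₁ + 2 * δ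
    · have hω1 : ω (s₁ + t - r) = 1 := if_pos hrδ
      rw [hω1, mul_one]
      have h1 : ∫ y, κ (sqDist c y) ∂(transition p r x) ≤ σ := by
        refine (integral_le_measureReal (measurableSet_cube c 2) (fun y => (hκ0 _).2)
          (hp.integrable_transition hr.1 x (f := fun y => κ (sqDist c y)) (B := 1) ?_ fun y => ?_)
          fun y hy => ?_).trans (hσ r ⟨by linarith, hr.2⟩)
        · have := continuous_sqDist c
          simp only [hκ]
          fun_prop
        · rw [abs_of_nonneg (hκ0 _).1]; exact (hκ0 _).2
        · simp only [hκ]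
          refine max_le le_rfl ((min_le_right _ _).trans ?_)
          simp only [cube, mem_ofPred_eq, not_forall, not_le] at hy
          obtain ⟨j, hj⟩ := hy
          have h2 : ((y : EuclideanSpace ℝ (Fin d)) j - c j) ^ 2 ≤ sqDist c y :=
            Finset.single_le_sum (f := fun j => ((y : EuclideanSpace ℝ (Fin d)) j - c j) ^ 2)
              (fun _ _ => sq_nonneg _) (Finset.mem_univ j)
          have h3 := pow_le_pow_left₀ (by norm_num) hj.le 2
          rw [sq_abs] at h3
          linarith
      have h2 : (1 + (t - r) / δ) ^ 2 ≤ 9 := by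
        have : (t - r) / δ ≤ 2 := by rw [div_le_iff₀ hδ]; linarith
        nlinarith
      rw [le_div_iff₀ (by positivity)]
      calc _ ≤ D * σ * 9 := by gcongr
        _ = _ := by ring
    · have hω1 : ω (s₁ + t - r) = 0 := if_neg hrδ
      rw [hω1, mul_zero, zero_mul]
      positivity

theorem localKernel_nonneg {d : ℕ} (v : Fin d → ℤ) (a s : ℝ) (y : Point d) :
    0 ≤ localKernel v a s y := by
  obtain ⟨w, i, u, hu, rfl⟩ := exists_edgePoint y
  rw [localKernel_edgePoint v a s (w, i)]
  exact mul_nonneg (Real.smoothTransition.nonneg _) (evenKernel_nonneg _ _ _)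

theorem IsHeatKernel.integrable_localKernel {d : ℕ} {p : ℝ → Point d → Point d → ℝ}
    (hp : IsHeatKernel d p) {t : ℝ} (ht : 0 < t) (x : Point d) (v : Fin d → ℤ) (a : ℝ) {s : ℝ}
    (hs : 0 < s) : Integrable (localKernel v a s) (transition p t x) := by
  refine hp.integrable_transition ht x (continuous_localKernel v a s) (B := 2 * (√s)⁻¹)
    fun y => ?_
  rw [abs_of_nonneg (localKernel_nonneg v a s y)]
  obtain ⟨w, i, u, hu, rfl⟩ := exists_edgePoint y
  rw [localKernel_edgePoint v a s (w, i)]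
  calc _ ≤ 1 * (2 * (√s)⁻¹) := by
        gcongr
        · exact evenKernel_nonneg _ _ _
        · exact Real.smoothTransition.le_one _
        · exact evenKernel_le _ _ hs
    _ = _ := one_mul _

theorem le_lengthMeasure_image_edgePoint {d : ℕ} (w : Fin d → ℤ) (i : Fin d) {α β : ℝ}
    (hα : 0 ≤ α) (hβ : β ≤ 1) :
    ENNReal.ofReal (β - α) ≤ lengthMeasure d (edgePoint w i '' Icc α β) := by
  have hm : MeasurableSet (edgePoint w i '' Icc α β) :=
    (isCompact_Icc.image (continuous_edgePoint w i)).measurableSet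
  rw [lengthMeasure, Measure.sum_apply _ hm]
  refine le_trans ?_ (ENNReal.le_tsum (w, i))
  rw [Measure.map_apply (continuous_edgePoint w i).measurable hm,
    Measure.restrict_apply ((continuous_edgePoint w i).measurable hm), ← Real.volume_Icc]
  exact measure_mono fun u hu =>
    ⟨mem_image_of_mem _ hu, hα.trans hu.1, hu.2.trans hβ⟩

/-- The value of the heat kernel at a point is recovered from integrals of the local approximate
solution at small times. -/
theorem IsHeatKernel.le_of_integral_localKernel_le {d : ℕ} {p : ℝ → Point d → Point d → ℝ}
    (hp : IsHeatKernel d p) {t : ℝ} (ht : 0 < t) (x y : Point d) {M : ℝ}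
    (h : ∀ (v : Fin d → ℤ) (a : ℝ), 0 ≤ a → a ≤ 1 / 2 → ∀ s > 0,
      ∫ y, localKernel v a s y ∂(transition p t x) ≤ M) :
    p t x y ≤ Real.exp (1 / 2) * M := by
  obtain ⟨w, i, u₀, hu₀, rfl⟩ := exists_edgePoint y
  -- Otherwise `p t x` exceeds some `c > exp (1 / 2) M` on a short interval of an edge, of length `ρ`. An
  -- even kernel at time `ρ ^ 2` is of order `ρ⁻¹` there.
  by_contra! hlt
  obtain ⟨c, hc1, hc2⟩ := exists_between hlt
  have hM0 : 0 ≤ M := (integral_nonneg fun y => localKernel_nonneg 0 0 1 y).trans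
    (h 0 0 le_rfl (by norm_num) 1 one_pos)
  have hc0 : 0 < c := lt_of_le_of_lt (by positivity) hc1
  have hcont : Continuous fun u => p t x (edgePoint w i u) :=
    (hp.continuous_right ht x).comp (continuous_edgePoint w i)
  obtain ⟨ε, hε, hεc⟩ := Metric.eventually_nhds_iff.1
    (hcont.continuousAt.eventually (lt_mem_nhds hc2) : ∀ᶠ u in 𝓝 u₀, c < p t x (edgePoint w i u))
  set ρ := min (ε / 2) (min (1 - u₀) (1 / 20)) with hρ
  have hρ0 : 0 < ρ := lt_min (by linarith) (lt_min (by linarith [hu₀.2]) (by norm_num))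
  have hρε : ρ < ε := (min_le_left _ _).trans_lt (by linarith)
  have hρu : ρ ≤ 1 - u₀ := (min_le_right _ _).trans (min_le_left _ _)
  have hρ20 : ρ ≤ 1 / 20 := (min_le_right _ _).trans (min_le_right _ _)
  set S := edgePoint w i '' Icc u₀ (u₀ + ρ) with hS
  have hSm : MeasurableSet S := (isCompact_Icc.image (continuous_edgePoint w i)).measurableSet
  have hfin := hp.isFiniteMeasure_transition ht x
  have hκ : c * ρ ≤ (transition p t x).real S := by
    have h1 : ENNReal.ofReal (c * ρ) ≤ transition p t x S := by
      rw [transition, withDensity_apply _ hSm, ENNReal.ofReal_mul hc0.le]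
      calc ENNReal.ofReal c * ENNReal.ofReal ρ ≤ ENNReal.ofReal c * lengthMeasure d S := by
            gcongr
            have := le_lengthMeasure_image_edgePoint w i (α := u₀) (β := u₀ + ρ) hu₀.1 (by linarith)
            rwa [add_sub_cancel_left] at this
        _ = ∫⁻ _ in S, ENNReal.ofReal c ∂(lengthMeasure d) := by rw [setLIntegral_const]
        _ ≤ _ := by
            refine setLIntegral_mono' hSm ?_
            rintro _ ⟨u, hu, rfl⟩
            refine ENNReal.ofReal_le_ofReal (hεc ?_).le
            rw [Real.dist_eq, abs_of_nonneg (by linarith [hu.1])]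
            linarith [hu.2]
    rw [measureReal_def]
    exact (ENNReal.ofReal_le_iff_le_toReal (measure_ne_top _ _)).1 h1
  -- the vertex nearest to `y`
  obtain ⟨v, a, ha0, ha, hv⟩ : ∃ (v : Fin d → ℤ) (a : ℝ), 0 ≤ a ∧ a ≤ 1 / 2 ∧
      ∀ u ∈ Icc u₀ (u₀ + ρ), ρ⁻¹ * Real.exp (-(1 / 2)) ≤
        localKernel v a (ρ ^ 2) (edgePoint w i u) := by
    have hker : ∀ u ∈ Icc u₀ (u₀ + ρ), ρ⁻¹ * Real.exp (-(1 / 2)) ≤ gauss 1 (ρ ^ 2) ((u - u₀) ^ 2) :=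
      fun u hu => by
      rw [gauss, pow_one, Real.sqrt_sq hρ0.le]
      gcongr
      have : (u - u₀) ^ 2 ≤ ρ ^ 2 := pow_le_pow_left₀ (by linarith [hu.1]) (by linarith [hu.2]) 2
      push_cast
      rw [one_div_mul_eq_div]
      exact (div_le_one (by positivity)).2 this
    rcases le_or_gt u₀ (1 / 2) with h2 | h2
    · refine ⟨w, u₀, hu₀.1, h2, fun u hu => ?_⟩
      have hq : edgeSqDist (fun j => (w j : ℝ)) (w, i) u = u ^ 2 := by simp [edgeSqDist]
      have hu0 : 0 ≤ u := hu₀.1.trans hu.1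
      have hu1 : u ≤ 11 / 20 := by linarith [hu.2]
      rw [localKernel_edgePoint w u₀ (ρ ^ 2) (w, i), hq, Real.smoothTransition.one_of_one_le
        (by nlinarith), one_mul, evenKernel, add_sub_cancel_left]
      have := gauss_one_nonneg (ρ ^ 2) ((u + u₀) ^ 2)
      linarith [hker u hu]
    · obtain ⟨v, hv⟩ : ∃ v : Fin d → ℤ, v = w + Pi.single i 1 := ⟨_, rfl⟩
      refine ⟨v, 1 - u₀, by linarith [hu₀.2], by linarith, fun u hu => ?_⟩
      have hq : edgeSqDist (fun j => (v j : ℝ)) (w, i) u = (1 - u) ^ 2 := by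
        rw [edgeSqDist, Finset.sum_eq_single i]
        · simp [hv]; ring
        · intro j _ hj
          simp [hj, hv]
        · simp
      have hu1 : u ≤ 1 := by linarith [hu.2]
      have hu0 : 1 / 2 ≤ u := by linarith [hu.1]
      have hx : (w i : ℝ) + u - v i = u - 1 := by simp [hv]
      rw [localKernel_edgePoint v (1 - u₀) (ρ ^ 2) (w, i), hq,
        Real.smoothTransition.one_of_one_le (by nlinarith), one_mul]
      simp only [hx, evenKernel]
      rw [show u - 1 + (1 - u₀) = u - u₀ by ring]
      have := gauss_one_nonneg (ρ ^ 2) ((u - 1 - (1 - u₀)) ^ 2)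
      linarith [hker u hu]
  have hmain := h v a ha0 ha (ρ ^ 2) (by positivity)
  have hcm : 0 < ρ⁻¹ * Real.exp (-(1 / 2)) := by positivity
  have h3 := measureReal_le_integral (κ := transition p t x)
    (f := fun y => localKernel v a (ρ ^ 2) y / (ρ⁻¹ * Real.exp (-(1 / 2)))) hSm
    (fun y => div_nonneg (localKernel_nonneg _ _ _ _) hcm.le)
    ((hp.integrable_localKernel ht x v a (by positivity)).div_const _) (by
      rintro _ ⟨u, hu, rfl⟩
      exact (one_le_div hcm).2 (hv u hu))
  rw [integral_div, le_div_iff₀ hcm] at h3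
  have h4 : c * ρ * (ρ⁻¹ * Real.exp (-(1 / 2))) ≤ M :=
    (mul_le_mul_of_nonneg_right hκ hcm.le).trans (h3.trans hmain)
  have h5 : c * ρ * (ρ⁻¹ * Real.exp (-(1 / 2))) = c * Real.exp (-(1 / 2)) := by
    field_simp
  rw [h5, Real.exp_neg, ← div_eq_mul_inv, div_le_iff₀ (Real.exp_pos _)] at h4
  linarith

/-- The heat kernel on the cable graph is at most of order `t ^ (-d/2)` at all times. At times less
than one this is weaker than the true order `t ^ (-1/2)`. -/
theorem exists_heatKernel_bound {d : ℕ} (hd : 1 ≤ d) : ∃ C : ℝ, 1 ≤ C ∧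
    ∀ p : ℝ → Point d → Point d → ℝ, IsHeatKernel d p → ∀ t > 0, ∀ x y,
      p t x y ≤ C * (√t)⁻¹ ^ d := by
  obtain ⟨C₁, hC₁, h₁⟩ := exists_transition_cube_bound hd
  obtain ⟨C₂, hC₂, h₂⟩ := exists_integral_localKernel_le d
  have h2d : (1 : ℝ) ≤ 2 ^ d * √2 ^ d := by
    rw [← mul_pow]
    refine one_le_pow₀ ?_
    have : 1 ≤ √(2 : ℝ) := Real.one_le_sqrt.2 (by norm_num)
    linarith
  have hC₃ : 1 ≤ C₂ * 2 * (C₁ * (2 ^ d * √2 ^ d)) := by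
    calc (1 : ℝ) ≤ 1 * 2 * (1 * 1) := by norm_num
      _ ≤ _ := by gcongr
  refine ⟨Real.exp (1 / 2) * (C₂ * 2 * (C₁ * (2 ^ d * √2 ^ d))), ?_, fun p hp t ht x y => ?_⟩
  · calc (1 : ℝ) = 1 * 1 := by norm_num
      _ ≤ _ := by
        gcongr
        exact Real.one_le_exp (by norm_num)
  rw [mul_assoc]
  refine hp.le_of_integral_localKernel_le ht x y fun v a ha0 ha s hs => ?_
  have hst : 0 < (√t)⁻¹ := inv_pos.2 (Real.sqrt_pos.2 ht)
  rcases le_or_gt 1 t with h | h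
  · refine (h₂ p hp x v a ha0 ha s hs t (1 / 4) (C₁ * 2 ^ d * (√(t / 2))⁻¹ ^ d) (by norm_num)
      (by linarith) (by norm_num) fun r hr => ?_).trans (le_of_eq ?_)
    · have hr2 : t / 2 ≤ r := by linarith [hr.1]
      have := inv_sqrt_anti (half_pos ht) hr2
      refine (h₁ p hp r (by linarith) x _ 2 (by norm_num)).trans ?_
      gcongr
    · have e1 : √(1 / 4 : ℝ) = 1 / 2 := by
        rw [show (1 / 4 : ℝ) = (1 / 2) ^ 2 by norm_num, Real.sqrt_sq (by norm_num)]
      have e2 : (√(t / 2))⁻¹ = √2 * (√t)⁻¹ := by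
        rw [Real.sqrt_div ht.le, inv_div, div_eq_mul_inv]
      rw [e1, e2, mul_pow]
      ring
  · refine (h₂ p hp x v a ha0 ha s hs t (t / 4) 1 (by linarith) (by linarith) (by linarith)
      fun r hr => hp.transition_real_le_one (by linarith [hr.1]) x _).trans ?_
    have e1 : (√(t / 4))⁻¹ = 2 * (√t)⁻¹ := by
      rw [Real.sqrt_div ht.le, inv_div, show (4 : ℝ) = 2 ^ 2 by norm_num,
        Real.sqrt_sq (by norm_num), div_eq_mul_inv]
    have e2 : 1 ≤ (√t)⁻¹ := (one_le_inv₀ (Real.sqrt_pos.2 ht)).2 (Real.sqrt_le_one.2 h.le)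
    have e3 : (√t)⁻¹ ≤ (√t)⁻¹ ^ d := le_self_pow₀ e2 (by omega)
    rw [e1, mul_one]
    calc C₂ * (2 * (√t)⁻¹) = C₂ * 2 * (1 * 1) * (√t)⁻¹ := by ring
      _ ≤ C₂ * 2 * (C₁ * (2 ^ d * √2 ^ d)) * (√t)⁻¹ ^ d := by gcongr

/-! ### Finite-dimensional laws of the loop measure -/

/-- The heat kernel, extended by zero to nonpositive times so as to be measurable. -/
def posKernel {d : ℕ} (p : ℝ → Point d → Point d → ℝ) (t : ℝ) (x y : Point d) : ℝ≥0∞ :=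
  if 0 < t then ENNReal.ofReal (p t x y) else 0

theorem IsHeatKernel.measurable_posKernel {d : ℕ} {p : ℝ → Point d → Point d → ℝ}
    (hp : IsHeatKernel d p) :
    Measurable fun q : ℝ × Point d × Point d => posKernel p q.1 q.2.1 q.2.2 := by
  classical
  have h : Measurable ((Ioi (0 : ℝ) ×ˢ (univ : Set (Point d × Point d))).piecewise
      (fun q : ℝ × Point d × Point d => p q.1 q.2.1 q.2.2) 0) :=
    hp.continuousOn.measurable_piecewise continuousOn_const
      (measurableSet_Ioi.prod MeasurableSet.univ)
  convert h.ennreal_ofReal using 1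
  funext q
  by_cases hq : 0 < q.1
  · simp [posKernel, hq, Set.piecewise]
  · simp [posKernel, hq, Set.piecewise]

theorem IsHeatKernel.measurable_posKernel_comp {d : ℕ} {p : ℝ → Point d → Point d → ℝ}
    (hp : IsHeatKernel d p) {X : Type*} [MeasurableSpace X] {f : X → ℝ} {g h : X → Point d}
    (hf : Measurable f) (hg : Measurable g) (hh : Measurable h) :
    Measurable fun a => posKernel p (f a) (g a) (h a) :=
  hp.measurable_posKernel.comp (hf.prodMk (hg.prodMk hh))

/-- The property of the loop measure which defines it from the heat kernel `p`. -/
def HasLoopMarginals {d : ℕ} (p : ℝ → Point d → Point d → ℝ) (μ : Measure (Loop d)) : Prop :=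
  ∀ (n : ℕ) (s : Fin (n + 2) → ℝ), StrictMono s → s 0 = 0 → s (Fin.last (n + 1)) = 1 →
    ∀ I : Set ℝ, MeasurableSet I → I ⊆ Ioi 0 →
    ∀ A : Fin (n + 1) → Set (Point d), (∀ k, MeasurableSet (A k)) →
      μ {l | l.duration ∈ I ∧ ∀ k, l.path (s k.castSucc * l.duration) ∈ A k} =
        ∫⁻ t in I, ENNReal.ofReal (1 / t) *
          ∫⁻ x, ∏ k, ENNReal.ofReal (p ((s k.succ - s k.castSucc) * t) (x k) (x (k + 1)))
            ∂(Measure.pi fun k => (lengthMeasure d).restrict (A k))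

/-- The density of the positions of the loop at the fractions `s` of its duration, for the loops of
duration in `[T, 2T)`. -/
def loopDensity {d n : ℕ} (p : ℝ → Point d → Point d → ℝ) (s : Fin (n + 2) → ℝ) (T : ℝ)
    (x : Fin (n + 1) → Point d) : ℝ≥0∞ :=
  ∫⁻ t in Ico T (2 * T), ENNReal.ofReal (1 / t) *
    ∏ k, posKernel p ((s k.succ - s k.castSucc) * t) (x k) (x (k + 1))

/-- The loops of duration in `[T, 2T)`. -/
def loopsOfDuration (d : ℕ) (T : ℝ) : Set (Loop d) := {l | l.duration ∈ Ico T (2 * T)}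

theorem measurable_duration {d : ℕ} : Measurable (Loop.duration (d := d)) :=
  measurable_fst.comp (comap_measurable fun l : Loop d => (l.duration, l.path))

theorem measurable_path {d : ℕ} (t : ℝ) : Measurable fun l : Loop d => l.path t :=
  (measurable_pi_apply t).comp
    (measurable_snd.comp (comap_measurable fun l : Loop d => (l.duration, l.path)))

/-- The position of a loop at the fraction `s` of its duration. -/
def Loop.pos {d : ℕ} (l : Loop d) (s : ℝ) : Point d := l.path (s * l.duration)

theorem measurable_pos {d : ℕ} (s : ℝ) : Measurable fun l : Loop d => l.pos s := by
  have h : Measurable (Function.uncurry fun (t : ℝ) (l : Loop d) => l.path t) :=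
    measurable_uncurry_of_continuous_of_measurable (fun l => l.continuous_path) measurable_path
  exact h.comp ((measurable_duration.const_mul s).prodMk measurable_id)

theorem Loop.pos_add_one {d : ℕ} (l : Loop d) (s : ℝ) : l.pos (s + 1) = l.pos s := by
  rw [Loop.pos, add_mul, one_mul, l.periodic_path, Loop.pos]

theorem Loop.continuous_pos {d : ℕ} (l : Loop d) : Continuous l.pos :=
  l.continuous_path.comp (continuous_id.mul continuous_const)

section Law

variable {d : ℕ} {p : ℝ → Point d → Point d → ℝ} {μ : Measure (Loop d)}

theorem IsHeatKernel.measurable_loopDensity_integrand (hp : IsHeatKernel d p) {n : ℕ}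
    (s : Fin (n + 2) → ℝ) : Measurable fun q : (Fin (n + 1) → Point d) × ℝ =>
      ENNReal.ofReal (1 / q.2) *
        ∏ k, posKernel p ((s k.succ - s k.castSucc) * q.2) (q.1 k) (q.1 (k + 1)) := by
  refine (ENNReal.measurable_ofReal.comp (measurable_const.div measurable_snd)).mul
    (Finset.measurable_prod _ fun k _ => ?_)
  exact hp.measurable_posKernel_comp (measurable_snd.const_mul _)
    ((measurable_pi_apply k).comp measurable_fst) ((measurable_pi_apply _).comp measurable_fst)

theorem IsHeatKernel.measurable_loopDensity (hp : IsHeatKernel d p) {n : ℕ}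
    (s : Fin (n + 2) → ℝ) (T : ℝ) : Measurable (loopDensity p s T) :=
  (hp.measurable_loopDensity_integrand s).lintegral_prod_right'

theorem lintegral_one_div_Ico_le {T : ℝ} (hT : 0 < T) :
    ∫⁻ t in Ico T (2 * T), ENNReal.ofReal (1 / t) ≤ 1 := by
  calc ∫⁻ t in Ico T (2 * T), ENNReal.ofReal (1 / t)
      ≤ ∫⁻ _ in Ico T (2 * T), ENNReal.ofReal (1 / T) := by
        refine setLIntegral_mono' measurableSet_Ico fun t ht => ENNReal.ofReal_le_ofReal ?_
        exact one_div_le_one_div_of_le hT ht.1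
    _ = 1 := by
        rw [setLIntegral_const, Real.volume_Ico, ← ENNReal.ofReal_mul (by positivity)]
        rw [show 1 / T * (2 * T - T) = 1 by field_simp; ring, ENNReal.ofReal_one]

theorem strictMono_gap_pos {n : ℕ} {s : Fin (n + 2) → ℝ} (hs : StrictMono s) (k : Fin (n + 1)) :
    0 < s k.succ - s k.castSucc := sub_pos.2 (hs k.castSucc_lt_succ)

/-- The positions of a loop at given fractions of its duration have the expected density. -/
theorem HasLoopMarginals.map_eq_withDensity (hμ : HasLoopMarginals p μ) (hp : IsHeatKernel d p)
    (hd : 1 ≤ d) {n : ℕ} {s : Fin (n + 2) → ℝ} (hs : StrictMono s) (hs0 : s 0 = 0)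
    (hs1 : s (Fin.last (n + 1)) = 1) {T : ℝ} (hT : 0 < T) :
    (μ.restrict (loopsOfDuration d T)).map (fun l k => l.pos (s k.castSucc)) =
      (Measure.pi fun _ : Fin (n + 1) => lengthMeasure d).withDensity (loopDensity p s T) := by
  have hX : Measurable fun (l : Loop d) (k : Fin (n + 1)) => l.pos (s k.castSucc) :=
    measurable_pi_lambda _ fun k => measurable_pos _
  have hIpos : Ico T (2 * T) ⊆ Ioi 0 := fun t ht => hT.trans_le ht.1
  -- the two measures agree on products, by definition of the loop measure
  have hrect : ∀ A : Fin (n + 1) → Set (Point d), (∀ k, MeasurableSet (A k)) →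
      (μ.restrict (loopsOfDuration d T)).map (fun l k => l.pos (s k.castSucc)) (univ.pi A) =
        (Measure.pi fun _ : Fin (n + 1) => lengthMeasure d).withDensity (loopDensity p s T)
          (univ.pi A) := by
    intro A hA
    have hAm : MeasurableSet (univ.pi A) := MeasurableSet.univ_pi hA
    rw [Measure.map_apply hX hAm, Measure.restrict_apply (hX hAm), withDensity_apply _ hAm]
    have h1 : (fun (l : Loop d) (k : Fin (n + 1)) => l.pos (s k.castSucc)) ⁻¹' univ.pi A ∩
        loopsOfDuration d T =
        {l | l.duration ∈ Ico T (2 * T) ∧ ∀ k, l.path (s k.castSucc * l.duration) ∈ A k} := by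
      ext l
      simp [loopsOfDuration, Loop.pos, and_comm]
    rw [h1, hμ n s hs hs0 hs1 _ measurableSet_Ico hIpos A hA, Measure.restrict_pi_pi]
    simp only [loopDensity]
    rw [lintegral_lintegral_swap (hp.measurable_loopDensity_integrand s).aemeasurable]
    refine setLIntegral_congr_fun measurableSet_Ico fun t ht => ?_
    have ht0 : 0 < t := hT.trans_le ht.1
    simp only [posKernel, mul_pos (strictMono_gap_pos hs _) ht0, if_true]
    rw [lintegral_const_mul]
    refine Finset.measurable_prod _ fun k _ => ?_
    have h2 := hp.measurable_posKernel_comp (X := Fin (n + 1) → Point d)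
      (f := fun _ => (s k.succ - s k.castSucc) * t) measurable_const (measurable_pi_apply k)
      (measurable_pi_apply (k + 1))
    simpa only [posKernel, mul_pos (strictMono_gap_pos hs _) ht0, if_true] using h2
  refine Measure.ext_of_generateFrom_of_iUnion _ (fun m : ℕ => univ.pi fun _ => cube 0 m)
    generateFrom_pi.symm isPiSystem_pi ?_ (fun m => ?_) (fun m => ?_) ?_
  · refine eq_univ_of_forall fun x => mem_iUnion.2 ?_
    obtain ⟨m, hm⟩ := exists_nat_ge (∑ k, ∑ j, |(x k : EuclideanSpace ℝ (Fin d)) j|)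
    refine ⟨m, fun k _ j => ?_⟩
    simp only [Pi.zero_apply, sub_zero]
    have h1 := Finset.single_le_sum (f := fun j => |(x k : EuclideanSpace ℝ (Fin d)) j|)
      (fun _ _ => abs_nonneg _) (Finset.mem_univ j)
    have h2 := Finset.single_le_sum (f := fun k => ∑ j, |(x k : EuclideanSpace ℝ (Fin d)) j|)
      (fun _ _ => Finset.sum_nonneg fun _ _ => abs_nonneg _) (Finset.mem_univ k)
    exact h1.trans (h2.trans hm)
  · exact mem_image_of_mem _ fun k _ => measurableSet_cube 0 m
  -- the density is bounded, hence the measure of bounded sets is finite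
  · obtain ⟨C, hC1, hC⟩ := exists_heatKernel_bound hd
    rw [hrect _ fun k => measurableSet_cube 0 m,
      withDensity_apply _ (MeasurableSet.univ_pi fun k => measurableSet_cube 0 m)]
    set D : ℝ≥0∞ := ∏ k : Fin (n + 1),
      ENNReal.ofReal (C * (√((s k.succ - s k.castSucc) * T))⁻¹ ^ d) with hD
    have hDtop : D ≠ ∞ := ENNReal.prod_ne_top fun k _ => ENNReal.ofReal_ne_top
    have hle : ∀ x, loopDensity p s T x ≤ D := fun x => by
      calc loopDensity p s T x ≤ ∫⁻ t in Ico T (2 * T), ENNReal.ofReal (1 / t) * D := by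
            refine setLIntegral_mono' measurableSet_Ico fun t ht => ?_
            refine mul_le_mul_right (Finset.prod_le_prod' fun k _ => ?_) _
            have hk := strictMono_gap_pos hs k
            have ht0 : 0 < t := hT.trans_le ht.1
            rw [posKernel, if_pos (mul_pos hk ht0)]
            refine ENNReal.ofReal_le_ofReal ((hC p hp _ (mul_pos hk ht0) _ _).trans ?_)
            have := inv_sqrt_anti (mul_pos hk hT) (mul_le_mul_of_nonneg_left ht.1 hk.le)
            gcongr
        _ ≤ 1 * D := by
            rw [lintegral_mul_const' _ _ hDtop]
            gcongr
            exact lintegral_one_div_Ico_le hT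
        _ = D := one_mul D
    refine ((setLIntegral_mono' (MeasurableSet.univ_pi fun k => measurableSet_cube 0 m)
      fun x _ => hle x).trans_lt ?_).ne
    rw [setLIntegral_const, Measure.pi_pi]
    refine ENNReal.mul_lt_top hDtop.lt_top (ENNReal.prod_lt_top fun k _ => ?_)
    exact (lengthMeasure_cube_le 0 m.cast_nonneg).trans_lt ENNReal.ofReal_lt_top
  · rintro _ ⟨A, hA, rfl⟩
    exact hrect A fun k => hA k (mem_univ k)

/-- The regular grid of fractions with `n + 1` steps. -/
def gridFraction (n : ℕ) (k : Fin (n + 2)) : ℝ := (k : ℕ) / ((n : ℝ) + 1)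

theorem strictMono_gridFraction (n : ℕ) : StrictMono (gridFraction n) := fun j k hjk => by
  have h : (j : ℕ) < (k : ℕ) := hjk
  have h' : ((j : ℕ) : ℝ) < (k : ℕ) := by exact_mod_cast h
  unfold gridFraction
  gcongr

/-- The density of the positions along a regular grid is invariant under cyclic shifts. -/
theorem loopDensity_gridFraction_shift {n : ℕ} (T : ℝ) (i : Fin (n + 1))
    (x : Fin (n + 1) → Point d) :
    loopDensity p (gridFraction n) T (fun k => x (k + i)) = loopDensity p (gridFraction n) T x := by
  have hgap : ∀ k : Fin (n + 1), gridFraction n k.succ - gridFraction n k.castSucc =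
      1 / ((n : ℝ) + 1) := fun k => by
    simp only [gridFraction, Fin.val_succ, Fin.val_castSucc]
    push_cast
    ring
  simp only [loopDensity, hgap]
  refine lintegral_congr fun t => ?_
  congr 1
  refine Fintype.prod_equiv (Equiv.addRight i) _ _ fun k => ?_
  simp only [Equiv.coe_addRight]
  rw [add_right_comm]

theorem measurePreserving_shift {ι X : Type*} [Fintype ι] [MeasurableSpace X] (ν : Measure X)
    [SigmaFinite ν] (e : ι ≃ ι) : MeasurePreserving (fun (x : ι → X) k => x (e k))
      (Measure.pi fun _ => ν) (Measure.pi fun _ => ν) := by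
  have h := measurePreserving_piCongrLeft (α := fun _ : ι => X) (fun _ : ι => ν) e.symm
  convert h using 1
  funext x k
  obtain ⟨j, rfl⟩ := e.symm.surjective k
  rw [MeasurableEquiv.coe_piCongrLeft, Equiv.piCongrLeft_apply_apply, Equiv.apply_symm_apply]

/-- The law of the positions along a regular grid is invariant under cyclic shifts. -/
theorem HasLoopMarginals.map_shift (hμ : HasLoopMarginals p μ) (hp : IsHeatKernel d p) (hd : 1 ≤ d)
    {n : ℕ} (i : Fin (n + 1)) {T : ℝ} (hT : 0 < T) :
    (μ.restrict (loopsOfDuration d T)).map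
        (fun l (k : Fin (n + 1)) => l.pos (gridFraction n (k + i).castSucc)) =
      (μ.restrict (loopsOfDuration d T)).map
        (fun l (k : Fin (n + 1)) => l.pos (gridFraction n k.castSucc)) := by
  have hX : Measurable fun (l : Loop d) (k : Fin (n + 1)) => l.pos (gridFraction n k.castSucc) :=
    measurable_pi_lambda _ fun k => measurable_pos _
  have hsh := measurePreserving_shift (lengthMeasure d) (Equiv.addRight i)
  simp only [Equiv.coe_addRight] at hsh
  have h := hμ.map_eq_withDensity hp hd (strictMono_gridFraction n) (by simp [gridFraction])
    (by
      simp only [gridFraction, Fin.val_last]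
      push_cast
      exact div_self (by positivity)) hT
  have h2 : (fun (l : Loop d) (k : Fin (n + 1)) => l.pos (gridFraction n (k + i).castSucc)) =
      (fun (x : Fin (n + 1) → Point d) k => x (k + i)) ∘
        fun l k => l.pos (gridFraction n k.castSucc) := rfl
  rw [h2, ← Measure.map_map hsh.measurable hX, h]
  ext B hB
  rw [Measure.map_apply hsh.measurable hB, withDensity_apply _ (hsh.measurable hB),
    withDensity_apply _ hB, ← hsh.setLIntegral_comp_preimage hB (hp.measurable_loopDensity _ _)]
  simp only [loopDensity_gridFraction_shift]

theorem Loop.pos_natMod {d : ℕ} (l : Loop d) {g : ℕ} (hg : 0 < g) (j : ℕ) :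
    l.pos (((j % g : ℕ) : ℝ) / g) = l.pos ((j : ℝ) / g) := by
  have hg' : (g : ℝ) ≠ 0 := by exact_mod_cast hg.ne'
  have h1 : ∀ (m : ℕ) (s : ℝ), l.pos (s + m) = l.pos s := fun m s => by
    induction m with
    | zero => simp
    | succ m ih => rw [Nat.cast_succ, ← add_assoc, l.pos_add_one, ih]
  have h2 : (j : ℝ) / g = ((j % g : ℕ) : ℝ) / g + (j / g : ℕ) := by
    field_simp
    have := Nat.mod_add_div j g
    have h3 : ((j % g : ℕ) : ℝ) + g * (j / g : ℕ) = j := by exact_mod_cast this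
    linarith
  rw [h2, h1]

/-- Rotation invariance of the loop measure, for times on a regular grid. -/
theorem HasLoopMarginals.map_rotate (hμ : HasLoopMarginals p μ) (hp : IsHeatKernel d p)
    (hd : 1 ≤ d) {g : ℕ} (hg : 0 < g) (i : ℕ) {m : ℕ} (o : Fin m → ℕ) {T : ℝ} (hT : 0 < T) :
    (μ.restrict (loopsOfDuration d T)).map (fun l k => l.pos (((i + o k : ℕ) : ℝ) / g)) =
      (μ.restrict (loopsOfDuration d T)).map (fun l k => l.pos ((o k : ℝ) / g)) := by
  obtain ⟨n, rfl⟩ := Nat.exists_eq_succ_of_ne_zero hg.ne'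
  have h := hμ.map_shift hp hd (Fin.ofNat (n + 1) i) hT
  set c : Fin m → Fin (n + 1) := fun k => Fin.ofNat (n + 1) (o k) with hc
  have hproj : Measurable fun (x : Fin (n + 1) → Point d) (k : Fin m) => x (c k) :=
    measurable_pi_lambda _ fun k => measurable_pi_apply _
  have h2 := congrArg (Measure.map fun (x : Fin (n + 1) → Point d) (k : Fin m) => x (c k)) h
  rw [Measure.map_map hproj (measurable_pi_lambda _ fun k => measurable_pos _),
    Measure.map_map hproj (measurable_pi_lambda _ fun k => measurable_pos _)] at h2
  convert h2 using 2
  · funext l k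
    simp only [Function.comp_apply, gridFraction, hc, Fin.val_castSucc, Fin.val_add, Fin.val_ofNat]
    rw [← Nat.cast_succ, l.pos_natMod (Nat.succ_pos n), ← l.pos_natMod (Nat.succ_pos n) (i + o k),
      ← l.pos_natMod (Nat.succ_pos n) (_ + _)]
    congr 3
    rw [Nat.add_comm, Nat.succ_eq_add_one]
    simp [Nat.add_mod]
  · funext l k
    simp only [Function.comp_apply, gridFraction, hc, Fin.val_castSucc, Fin.val_ofNat]
    rw [← Nat.cast_succ, l.pos_natMod (Nat.succ_pos n)]

end Law

/-! ### Four points on a loop -/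

theorem lintegral_pi_fin_succ {X : Type*} [MeasurableSpace X] (ν : Measure X) [SigmaFinite ν]
    {n : ℕ} {f : (Fin (n + 1) → X) → ℝ≥0∞} (hf : Measurable f) :
    ∫⁻ x, f x ∂(Measure.pi fun _ => ν) =
      ∫⁻ a, ∫⁻ y, f (Fin.cons a y) ∂(Measure.pi fun _ => ν) ∂ν := by
  have h := (measurePreserving_piFinSuccAbove (fun _ : Fin (n + 1) => ν) 0).symm
  rw [← h.lintegral_comp hf]
  refine (lintegral_prod (μ := ν) (ν := Measure.pi fun _ : Fin n => ν)
    (fun z => f ((MeasurableEquiv.piFinSuccAbove (fun _ => X) 0).symm z))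
    (hf.comp h.measurable).aemeasurable).trans
    (lintegral_congr fun a => lintegral_congr fun y => congrArg f ?_)
  exact Fin.insertNth_zero' a y

theorem measurable_cons {X : Type*} [MeasurableSpace X] {n : ℕ} (a : X) :
    Measurable fun y : Fin n → X => (Fin.cons a y : Fin (n + 1) → X) := by
  refine measurable_pi_lambda _ fun k => ?_
  refine Fin.cases ?_ (fun j => ?_) k
  · simp only [Fin.cons_zero]; exact measurable_const
  · simp only [Fin.cons_succ]; exact measurable_pi_apply j

theorem lintegral_pi_fin_four {X : Type*} [MeasurableSpace X] (ν : Measure X) [SigmaFinite ν]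
    {f : (Fin 4 → X) → ℝ≥0∞} (hf : Measurable f) :
    ∫⁻ x, f x ∂(Measure.pi fun _ => ν) =
      ∫⁻ a, ∫⁻ b, ∫⁻ c, ∫⁻ e, f ![a, b, c, e] ∂ν ∂ν ∂ν ∂ν := by
  rw [lintegral_pi_fin_succ ν hf]
  refine lintegral_congr fun a => ?_
  have h1 := hf.comp (measurable_cons a)
  refine (lintegral_pi_fin_succ ν h1).trans (lintegral_congr fun b => ?_)
  have h2 := h1.comp (measurable_cons b)
  refine (lintegral_pi_fin_succ ν h2).trans (lintegral_congr fun c => ?_)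
  have h3 := h2.comp (measurable_cons c)
  refine (lintegral_pi_fin_succ ν h3).trans (lintegral_congr fun e => ?_)
  rw [Measure.pi_of_empty, lintegral_dirac]
  rfl

section FourPoint

variable {d : ℕ} {p : ℝ → Point d → Point d → ℝ} {μ : Measure (Loop d)}

theorem posKernel_ne_top (t : ℝ) (x y : Point d) : posKernel p t x y ≠ ∞ := by
  unfold posKernel
  split_ifs <;> simp

theorem IsHeatKernel.lintegral_posKernel_le (hp : IsHeatKernel d p) (t : ℝ) (x : Point d) :
    ∫⁻ y, posKernel p t x y ∂(lengthMeasure d) ≤ 1 := by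
  by_cases ht : 0 < t
  · simpa only [posKernel, if_pos ht] using hp.mass_le t ht x
  · simp [posKernel, if_neg ht]

open scoped Classical in
/-- The law of four points `x₀, x₁, x₂, x₃` of a loop, in cyclic order: when the transitions from
`x₂` to `x₃` and from `x₃` to `x₀` are replaced by their supremum, what remains is a product of two
transitions and of the volume left to `x₃` once the others are given. -/
theorem HasLoopMarginals.four_point_le (hμ : HasLoopMarginals p μ) (hp : IsHeatKernel d p)
    (hd : 1 ≤ d) {C : ℝ} (hC0 : 0 ≤ C) (hC : ∀ t > 0, ∀ x y, p t x y ≤ C * (√t)⁻¹ ^ d)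
    {g : ℕ} (i : ℕ) {o₁ o₂ o₃ : ℕ} (h₁ : 0 < o₁) (h₂ : o₁ < o₂) (h₃ : o₂ < o₃) (hg : o₃ < g)
    {T : ℝ} (hT : 0 < T) {B : Set (Fin 4 → Point d)} (hB : MeasurableSet B)
    {A : Set (Point d)} (hA : MeasurableSet A) {R₀ R₁ : Set (Point d × Point d)}
    {Q : Point d → Point d → Set (Point d)} (hQ : ∀ x y, MeasurableSet (Q x y))
    (hBsub : ∀ x ∈ B, x 0 ∈ A ∧ (x 0, x 1) ∈ R₀ ∧ (x 1, x 2) ∈ R₁ ∧ x 3 ∈ Q (x 0) (x 2))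
    {θ₀ θ₁ V : ℝ≥0∞} (hθ₀t : θ₀ ≠ ∞) (hθ₁t : θ₁ ≠ ∞) (hVt : V ≠ ∞)
    (hθ₀ : ∀ t ∈ Ico T (2 * T), ∀ x, ∫⁻ y, (if (x, y) ∈ R₀ then
      posKernel p ((o₁ : ℝ) / g * t) x y else 0) ∂(lengthMeasure d) ≤ θ₀)
    (hθ₁ : ∀ t ∈ Ico T (2 * T), ∀ x, ∫⁻ y, (if (x, y) ∈ R₁ then
      posKernel p (((o₂ : ℝ) - o₁) / g * t) x y else 0) ∂(lengthMeasure d) ≤ θ₁)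
    (hV : ∀ x y, lengthMeasure d (Q x y) ≤ V) :
    μ {l | l ∈ loopsOfDuration d T ∧
        (fun k => l.pos (((i + ![0, o₁, o₂, o₃] k : ℕ) : ℝ) / g)) ∈ B} ≤
      ENNReal.ofReal (C * (√(((o₃ : ℝ) - o₂) / g * T))⁻¹ ^ d) *
        ENNReal.ofReal (C * (√(((g : ℝ) - o₃) / g * T))⁻¹ ^ d) *
          (lengthMeasure d A * θ₀ * θ₁ * V) := by
  have hg0 : 0 < g := by omega
  have hgR : (0 : ℝ) < g := by exact_mod_cast hg0
  have c₁ : (0 : ℝ) < o₁ := by exact_mod_cast h₁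
  have c₂ : (o₁ : ℝ) < o₂ := by exact_mod_cast h₂
  have c₃ : (o₂ : ℝ) < o₃ := by exact_mod_cast h₃
  have c₄ : (o₃ : ℝ) < g := by exact_mod_cast hg
  -- the times, once the loop is rotated to start at the first point
  set s : Fin 5 → ℝ := ![0, (o₁ : ℝ) / g, (o₂ : ℝ) / g, (o₃ : ℝ) / g, 1] with hs
  have hsm : StrictMono s := by
    rw [Fin.strictMono_iff_lt_succ]
    intro k
    fin_cases k
    · change (0 : ℝ) < (o₁ : ℝ) / g
      positivity
    · change (o₁ : ℝ) / g < (o₂ : ℝ) / g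
      gcongr
    · change (o₂ : ℝ) / g < (o₃ : ℝ) / g
      gcongr
    · change (o₃ : ℝ) / g < 1
      exact (div_lt_one hgR).2 c₄
  set σ := ENNReal.ofReal (C * (√(((o₃ : ℝ) - o₂) / g * T))⁻¹ ^ d) *
        ENNReal.ofReal (C * (√(((g : ℝ) - o₃) / g * T))⁻¹ ^ d) with hσ
  have hσt : σ ≠ ∞ := ENNReal.mul_ne_top ENNReal.ofReal_ne_top ENNReal.ofReal_ne_top
  have hX : ∀ i : ℕ, Measurable fun (l : Loop d) (k : Fin 4) =>
      l.pos (((i + ![0, o₁, o₂, o₃] k : ℕ) : ℝ) / g) := fun i =>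
    measurable_pi_lambda _ fun k => measurable_pos _
  have e1 : μ {l | l ∈ loopsOfDuration d T ∧
        (fun k => l.pos (((i + ![0, o₁, o₂, o₃] k : ℕ) : ℝ) / g)) ∈ B} =
      ∫⁻ x in B, loopDensity p s T x ∂(Measure.pi fun _ => lengthMeasure d) := by
    rw [← withDensity_apply _ hB, ← hμ.map_eq_withDensity hp hd hsm rfl rfl hT]
    have h4 : (fun (l : Loop d) (k : Fin 4) => l.pos (s k.castSucc)) =
        fun l k => l.pos (((![0, o₁, o₂, o₃] k : ℕ) : ℝ) / g) := by
      funext l k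
      congr 1
      fin_cases k
      · simp [hs]
      · rfl
      · rfl
      · rfl
    rw [h4, ← hμ.map_rotate hp hd hg0 i ![0, o₁, o₂, o₃] hT, Measure.map_apply (hX i) hB,
      Measure.restrict_apply (hX i hB), inter_comm]
    rfl
  have hk : ∀ t ∈ Ico T (2 * T), ∀ (c : ℝ) (x y : Point d), 0 < c →
      posKernel p (c * t) x y ≤ ENNReal.ofReal (C * (√(c * T))⁻¹ ^ d) := fun t ht c x y hc => by
    have ht0 : 0 < t := hT.trans_le ht.1
    rw [posKernel, if_pos (mul_pos hc ht0)]
    refine ENNReal.ofReal_le_ofReal ((hC _ (mul_pos hc ht0) x y).trans ?_)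
    have := inv_sqrt_anti (mul_pos hc hT) (mul_le_mul_of_nonneg_left ht.1 hc.le)
    gcongr
  have hm2 : ∀ t : ℝ, Measurable fun x : Fin 4 → Point d =>
      posKernel p ((o₁ : ℝ) / g * t) (x 0) (x 1) *
        posKernel p (((o₂ : ℝ) - o₁) / g * t) (x 1) (x 2) := fun t =>
    (hp.measurable_posKernel_comp measurable_const (measurable_pi_apply 0)
      (measurable_pi_apply 1)).mul (hp.measurable_posKernel_comp measurable_const
        (measurable_pi_apply 1) (measurable_pi_apply 2))
  -- the integral for a given duration
  have hinner : ∀ t ∈ Ico T (2 * T), ∫⁻ x in B, posKernel p ((o₁ : ℝ) / g * t) (x 0) (x 1) *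
        posKernel p (((o₂ : ℝ) - o₁) / g * t) (x 1) (x 2) ∂(Measure.pi fun _ => lengthMeasure d) ≤
      lengthMeasure d A * θ₀ * θ₁ * V := by
    intro t ht
    set P₀ : Point d → Point d → ℝ≥0∞ := fun a b =>
      if (a, b) ∈ R₀ then posKernel p ((o₁ : ℝ) / g * t) a b else 0 with hP₀
    set P₁ : Point d → Point d → ℝ≥0∞ := fun b c =>
      if (b, c) ∈ R₁ then posKernel p (((o₂ : ℝ) - o₁) / g * t) b c else 0 with hP₁
    have hP₀t : ∀ a b, P₀ a b ≠ ∞ := fun a b => by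
      simp only [hP₀]
      split_ifs
      · exact posKernel_ne_top _ _ _
      · simp
    have hAt : ∀ a, A.indicator (1 : Point d → ℝ≥0∞) a ≠ ∞ := fun a => by
      by_cases ha : a ∈ A <;> simp [ha]
    have hP₁t : ∀ a b, P₁ a b ≠ ∞ := fun a b => by
      simp only [hP₁]
      split_ifs
      · exact posKernel_ne_top _ _ _
      · simp
    rw [← lintegral_indicator hB, lintegral_pi_fin_four _ ((hm2 t).indicator hB)]
    calc _ ≤ ∫⁻ a, ∫⁻ b, ∫⁻ c, ∫⁻ e, A.indicator 1 a * P₀ a b * P₁ b c *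
          (Q a c).indicator 1 e ∂(lengthMeasure d) ∂(lengthMeasure d) ∂(lengthMeasure d)
            ∂(lengthMeasure d) := by
          refine lintegral_mono fun a => lintegral_mono fun b => lintegral_mono fun c =>
            lintegral_mono fun e => ?_
          by_cases hx : ![a, b, c, e] ∈ B
          · obtain ⟨q1, q2, q3, q4⟩ := hBsub _ hx
            change a ∈ A at q1
            change (a, b) ∈ R₀ at q2
            change (b, c) ∈ R₁ at q3
            change e ∈ Q a c at q4
            rw [indicator_of_mem hx]
            simp only [hP₀, hP₁, if_pos q2, if_pos q3, indicator_of_mem q1, indicator_of_mem q4,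
              Pi.one_apply, one_mul, mul_one]
            exact le_rfl
          · rw [indicator_of_notMem hx]
            exact zero_le
      _ ≤ ∫⁻ a, ∫⁻ b, ∫⁻ c, A.indicator 1 a * P₀ a b * P₁ b c * V ∂(lengthMeasure d)
            ∂(lengthMeasure d) ∂(lengthMeasure d) := by
          refine lintegral_mono fun a => lintegral_mono fun b => lintegral_mono fun c => ?_
          rw [lintegral_const_mul' _ _ (ENNReal.mul_ne_top (ENNReal.mul_ne_top (hAt a) (hP₀t a b))
            (hP₁t b c)), lintegral_indicator_one (hQ a c)]
          gcongr
          exact hV a c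
      _ ≤ ∫⁻ a, ∫⁻ b, A.indicator 1 a * P₀ a b * (θ₁ * V) ∂(lengthMeasure d)
            ∂(lengthMeasure d) := by
          refine lintegral_mono fun a => lintegral_mono fun b => ?_
          rw [lintegral_mul_const' _ _ hVt,
            lintegral_const_mul' _ _ (ENNReal.mul_ne_top (hAt a) (hP₀t a b)), mul_assoc]
          gcongr
          exact hθ₁ t ht b
      _ ≤ ∫⁻ a, A.indicator 1 a * (θ₀ * (θ₁ * V)) ∂(lengthMeasure d) := by
          refine lintegral_mono fun a => ?_
          rw [lintegral_mul_const' _ _ (ENNReal.mul_ne_top hθ₁t hVt),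
            lintegral_const_mul' _ _ (hAt a), mul_assoc]
          gcongr
          exact hθ₀ t ht a
      _ = lengthMeasure d A * θ₀ * θ₁ * V := by
          rw [lintegral_mul_const' _ _
            (ENNReal.mul_ne_top hθ₀t (ENNReal.mul_ne_top hθ₁t hVt)), lintegral_indicator_one hA]
          ring
  rw [e1]
  have hden : ∀ x, loopDensity p s T x ≤ ∫⁻ t in Ico T (2 * T), ENNReal.ofReal (1 / t) * (σ *
      (posKernel p ((o₁ : ℝ) / g * t) (x 0) (x 1) *
        posKernel p (((o₂ : ℝ) - o₁) / g * t) (x 1) (x 2))) := fun x => by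
    refine setLIntegral_mono' measurableSet_Ico fun t ht => ?_
    refine mul_le_mul_right ?_ _
    rw [Fin.prod_univ_four]
    have k1 := hk t ht (((o₃ : ℝ) - o₂) / g) (x 2) (x 3) (div_pos (by linarith) hgR)
    have k2 := hk t ht (((g : ℝ) - o₃) / g) (x 3) (x 0) (div_pos (by linarith) hgR)
    have g0 : s (Fin.succ 0) - s (Fin.castSucc 0) = (o₁ : ℝ) / g := sub_zero _
    have g1 : s (Fin.succ 1) - s (Fin.castSucc 1) = ((o₂ : ℝ) - o₁) / g := by
      rw [sub_div]; rfl
    have g2 : s (Fin.succ 2) - s (Fin.castSucc 2) = ((o₃ : ℝ) - o₂) / g := by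
      rw [sub_div]; rfl
    have g3 : s (Fin.succ 3) - s (Fin.castSucc 3) = ((g : ℝ) - o₃) / g := by
      rw [sub_div, div_self hgR.ne']; rfl
    rw [g0, g1, g2, g3, hσ]
    calc _ = posKernel p (((o₃ : ℝ) - o₂) / g * t) (x 2) (x 3) *
          posKernel p (((g : ℝ) - o₃) / g * t) (x 3) (x 0) *
          (posKernel p ((o₁ : ℝ) / g * t) (x 0) (x 1) *
            posKernel p (((o₂ : ℝ) - o₁) / g * t) (x 1) (x 2)) := by
          have hcomm : ∀ a b c e : ℝ≥0∞, a * b * c * e = c * e * (a * b) := fun a b c e => by ring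
          exact hcomm _ _ _ _
      _ ≤ _ := by gcongr
  have hjm : Measurable fun q : (Fin 4 → Point d) × ℝ => ENNReal.ofReal (1 / q.2) * (σ *
      (posKernel p ((o₁ : ℝ) / g * q.2) (q.1 0) (q.1 1) *
        posKernel p (((o₂ : ℝ) - o₁) / g * q.2) (q.1 1) (q.1 2))) :=
    (ENNReal.measurable_ofReal.comp (measurable_const.div measurable_snd)).mul
      (measurable_const.mul ((hp.measurable_posKernel_comp (measurable_snd.const_mul _)
        ((measurable_pi_apply 0).comp measurable_fst)
        ((measurable_pi_apply 1).comp measurable_fst)).mul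
          (hp.measurable_posKernel_comp (measurable_snd.const_mul _)
        ((measurable_pi_apply 1).comp measurable_fst)
        ((measurable_pi_apply 2).comp measurable_fst))))
  calc _ ≤ ∫⁻ x in B, (∫⁻ t in Ico T (2 * T), ENNReal.ofReal (1 / t) * (σ *
      (posKernel p ((o₁ : ℝ) / g * t) (x 0) (x 1) *
        posKernel p (((o₂ : ℝ) - o₁) / g * t) (x 1) (x 2))))
          ∂(Measure.pi fun _ => lengthMeasure d) := lintegral_mono fun x => hden x
    _ = ∫⁻ t in Ico T (2 * T), (∫⁻ x in B, ENNReal.ofReal (1 / t) * (σ *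
      (posKernel p ((o₁ : ℝ) / g * t) (x 0) (x 1) *
        posKernel p (((o₂ : ℝ) - o₁) / g * t) (x 1) (x 2)))
          ∂(Measure.pi fun _ => lengthMeasure d)) := lintegral_lintegral_swap hjm.aemeasurable
    _ ≤ ∫⁻ t in Ico T (2 * T), ENNReal.ofReal (1 / t) *
          (σ * (lengthMeasure d A * θ₀ * θ₁ * V)) := by
        refine setLIntegral_mono' measurableSet_Ico fun t ht => ?_
        rw [lintegral_const_mul' _ _ ENNReal.ofReal_ne_top, lintegral_const_mul' _ _ hσt]
        gcongr
        exact hinner t ht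
    _ ≤ 1 * (σ * (lengthMeasure d A * θ₀ * θ₁ * V)) := by
        rw [lintegral_mul_const]
        · gcongr
          exact lintegral_one_div_Ico_le hT
        · exact ENNReal.measurable_ofReal.comp (measurable_const.div measurable_id)
    _ = _ := one_mul _

end FourPoint

/-! ### Loops returning close to a point -/

theorem lengthMeasure_ball_le {d : ℕ} (y : Point d) {ρ : ℝ} (hρ : 1 ≤ ρ) :
    lengthMeasure d {e | dist e y ≤ ρ} ≤ ENNReal.ofReal (d * 4 ^ d * ρ ^ d) := by
  have h1 : {e : Point d | dist e y ≤ ρ} ⊆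
      cube (fun j => (y : EuclideanSpace ℝ (Fin d)) j) ρ := fun e he j =>
    (abs_coord_sub_le_dist e y j).trans he
  refine (measure_mono h1).trans ((lengthMeasure_cube_le _ (by linarith)).trans
    (ENNReal.ofReal_le_ofReal ?_))
  rw [mul_assoc, ← mul_pow]
  gcongr
  linarith

theorem measurableSet_dist_le {d : ℕ} (y : Point d) (ρ : ℝ) :
    MeasurableSet {e : Point d | dist e y ≤ ρ} :=
  measurableSet_le (continuous_id.dist continuous_const).measurable measurable_const

theorem mem_cube_of_mem_loopsInBox {d N : ℕ} {l : Loop d} (hl : l ∈ loopsInBox d N) (s : ℝ) :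
    l.pos s ∈ cube 0 (N : ℝ) := fun j => by
  simpa [Loop.pos] using hl (s * l.duration) j

/-- The basic estimate: loops in the box which come back within distance `ρ` after the fraction
`k / g` of their duration, with a condition on the increment between two times in between. The two
arcs produce the two factors with exponent `d / 2`, and the condition the factor `θ`. -/
theorem exists_near_bound {d : ℕ} (hd : 1 ≤ d) : ∃ K : ℝ, 1 ≤ K ∧
    ∀ (p : ℝ → Point d → Point d → ℝ) (μ : Measure (Loop d)), IsHeatKernel d p →
      HasLoopMarginals p μ → ∀ T > 0, ∀ N : ℕ, 1 ≤ N → ∀ ρ : ℝ, 1 ≤ ρ →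
      ∀ g i u v k : ℕ, 0 < u → u < v → v < k → k < g → 4 * v ≤ k + 4 * u →
      ∀ (R : Set (Point d × Point d)) (θ : ℝ≥0∞), MeasurableSet R → θ ≠ ∞ →
      (∀ t ∈ Ico T (2 * T), ∀ x, ∫⁻ y, R.indicator (fun q => posKernel p
        (((v : ℝ) - u) / g * t) q.1 q.2) (x, y) ∂(lengthMeasure d) ≤ θ) →
      μ {l | l ∈ loopsOfDuration d T ∧ l ∈ loopsInBox d N ∧
          dist (l.pos ((i : ℝ) / g)) (l.pos (((i + k : ℕ) : ℝ) / g)) ≤ ρ ∧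
          (l.pos (((i + u : ℕ) : ℝ) / g), l.pos (((i + v : ℕ) : ℝ) / g)) ∈ R} ≤
        ENNReal.ofReal (K * ((N : ℝ) ^ d * ρ ^ d *
          ((√((k : ℝ) / g * T))⁻¹ ^ d * (√(((g : ℝ) - k) / g * T))⁻¹ ^ d))) * θ := by
  classical
  obtain ⟨C, hC1, hC⟩ := exists_heatKernel_bound hd
  have hd' : (1 : ℝ) ≤ d := by exact_mod_cast hd
  have h4d : (1 : ℝ) ≤ d * 4 ^ d := by
    have : (1 : ℝ) ≤ 4 ^ d := one_le_pow₀ (by norm_num)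
    nlinarith
  refine ⟨(C * 2 ^ d) * C * ((d * 4 ^ d) * (d * 4 ^ d)), ?_, ?_⟩
  · have : (1 : ℝ) ≤ 2 ^ d := one_le_pow₀ (by norm_num)
    calc (1 : ℝ) = (1 * 1) * 1 * (1 * 1) := by norm_num
      _ ≤ _ := by gcongr
  intro p μ hp hμ T hT N hN ρ hρ g i u v k hu huv hvk hkg h4 R θ hR hθt hθ
  have hC0 : 0 ≤ C := by linarith
  have hgR : (0 : ℝ) < g := by exact_mod_cast (by omega : 0 < g)
  have c₁ : (0 : ℝ) < u := by exact_mod_cast hu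
  have c₂ : (u : ℝ) < v := by exact_mod_cast huv
  have c₃ : (v : ℝ) < k := by exact_mod_cast hvk
  have c₄ : (k : ℝ) < g := by exact_mod_cast hkg
  have c₅ : 4 * (v : ℝ) ≤ k + 4 * u := by exact_mod_cast h4
  have hN' : (1 : ℝ) ≤ N := by exact_mod_cast hN
  have hcube : lengthMeasure d (cube 0 (N : ℝ)) ≤ ENNReal.ofReal (d * 4 ^ d * (N : ℝ) ^ d) := by
    refine (lengthMeasure_cube_le _ (by linarith)).trans (ENNReal.ofReal_le_ofReal ?_)
    rw [mul_assoc, ← mul_pow]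
    gcongr
    linarith
  -- a transition over at least a quarter of the first arc has a kernel of the same order as over the arc
  have hquarter : ∀ w : ℝ, (k : ℝ) ≤ 4 * w →
      C * (√(w / g * T))⁻¹ ^ d ≤ C * 2 ^ d * (√((k : ℝ) / g * T))⁻¹ ^ d := fun w hw => by
    have hk0 : 0 < (k : ℝ) := by linarith
    have h1 : (√(w / g * T))⁻¹ ≤ 2 * (√((k : ℝ) / g * T))⁻¹ := by
      have h2 := inv_sqrt_anti (s := (k : ℝ) / g * T / 2 ^ 2) (t := w / g * T) (by positivity) (by
        rw [div_mul_eq_mul_div, div_mul_eq_mul_div, div_div, div_le_div_iff₀ (by positivity) hgR]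
        nlinarith [mul_pos hT hgR])
      rwa [Real.sqrt_div (by positivity), Real.sqrt_sq (by norm_num), inv_div, div_eq_mul_inv] at h2
    calc C * (√(w / g * T))⁻¹ ^ d ≤ C * (2 * (√((k : ℝ) / g * T))⁻¹) ^ d := by gcongr
      _ = _ := by rw [mul_pow]; ring
  have hfinal : ∀ w : ℝ, (k : ℝ) ≤ 4 * w →
      ENNReal.ofReal (C * (√(w / g * T))⁻¹ ^ d) *
        ENNReal.ofReal (C * (√(((g : ℝ) - k) / g * T))⁻¹ ^ d) *
        (lengthMeasure d (cube 0 (N : ℝ)) * θ * 1 * ENNReal.ofReal (d * 4 ^ d * ρ ^ d)) ≤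
      ENNReal.ofReal ((C * 2 ^ d) * C * ((d * 4 ^ d) * (d * 4 ^ d)) * ((N : ℝ) ^ d * ρ ^ d *
          ((√((k : ℝ) / g * T))⁻¹ ^ d * (√(((g : ℝ) - k) / g * T))⁻¹ ^ d))) * θ := fun w hw => by
    have hρ0 : 0 ≤ ρ := by linarith
    calc _ ≤ ENNReal.ofReal (C * 2 ^ d * (√((k : ℝ) / g * T))⁻¹ ^ d) *
        ENNReal.ofReal (C * (√(((g : ℝ) - k) / g * T))⁻¹ ^ d) *
        (ENNReal.ofReal (d * 4 ^ d * (N : ℝ) ^ d) * θ * 1 *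
          ENNReal.ofReal (d * 4 ^ d * ρ ^ d)) := by
          exact mul_le_mul' (mul_le_mul' (ENNReal.ofReal_le_ofReal (hquarter w hw)) le_rfl)
            (by gcongr)
      _ = ENNReal.ofReal (C * 2 ^ d * (√((k : ℝ) / g * T))⁻¹ ^ d) *
        ENNReal.ofReal (C * (√(((g : ℝ) - k) / g * T))⁻¹ ^ d) *
        (ENNReal.ofReal (d * 4 ^ d * (N : ℝ) ^ d) *
          ENNReal.ofReal (d * 4 ^ d * ρ ^ d)) * θ := by ring
      _ = _ := by
          rw [← ENNReal.ofReal_mul (by positivity), ← ENNReal.ofReal_mul (by positivity),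
            ← ENNReal.ofReal_mul (by positivity)]
          congr 2
          ring
  have hc : ∀ j : Fin 4, Measurable fun x : Fin 4 → Point d => x j := measurable_pi_apply
  by_cases hcase : 3 * k ≤ 8 * u
  · -- the chain starts at the increment, and the first arc is cut before it
    have hBm : MeasurableSet {x : Fin 4 → Point d | x 0 ∈ cube 0 (N : ℝ) ∧ (x 0, x 1) ∈ R ∧
        dist (x 3) (x 2) ≤ ρ} :=
      (hc 0 (measurableSet_cube 0 N)).inter ((((hc 0).prodMk (hc 1)) hR).inter
        (measurableSet_le ((hc 3).dist (hc 2)) measurable_const))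
    have h := hμ.four_point_le hp hd hC0 (hC p hp) (g := g) (i + u) (o₁ := v - u) (o₂ := k - u)
      (o₃ := g - u) (by omega) (by omega) (by omega) (by omega) hT hBm (measurableSet_cube 0 N)
      (R₀ := R) (R₁ := univ) (Q := fun _ y => {e | dist e y ≤ ρ})
      (fun _ y => measurableSet_dist_le y ρ)
      (fun x hx => ⟨hx.1, hx.2.1, mem_univ _, hx.2.2⟩) hθt ENNReal.one_ne_top
      (V := ENNReal.ofReal (d * 4 ^ d * ρ ^ d))
      ENNReal.ofReal_ne_top (fun t ht x => by
        rw [Nat.cast_sub huv.le]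
        refine le_trans (le_of_eq (lintegral_congr fun y => ?_)) (hθ t ht x)
        by_cases hxy : (x, y) ∈ R <;> simp [hxy]) (fun t _ x => by simpa using hp.lintegral_posKernel_le _ x)
      (fun _ y => lengthMeasure_ball_le y hρ)
    refine le_trans (measure_mono ?_) (h.trans ?_)
    · rintro l ⟨hl1, hl2, hl3, hl4⟩
      refine ⟨hl1, mem_cube_of_mem_loopsInBox hl2 _, ?_, ?_⟩
      · change (l.pos (((i + u + 0 : ℕ) : ℝ) / g), l.pos (((i + u + (v - u) : ℕ) : ℝ) / g)) ∈ R
        rw [add_zero, show i + u + (v - u) = i + v by omega]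
        exact hl4
      · change dist (l.pos (((i + u + (g - u) : ℕ) : ℝ) / g))
          (l.pos (((i + u + (k - u) : ℕ) : ℝ) / g)) ≤ ρ
        rw [show i + u + (k - u) = i + k by omega, show i + u + (g - u) = i + g by omega,
          Nat.cast_add i g, add_div, div_self hgR.ne', l.pos_add_one]
        exact hl3
    · rw [Nat.cast_sub (by omega : u ≤ k), Nat.cast_sub (by omega : u ≤ g), sub_sub_sub_cancel_right,
        sub_sub_cancel, mul_comm (ENNReal.ofReal _) (ENNReal.ofReal _)]
      refine hfinal u ?_
      have : 3 * (k : ℝ) ≤ 8 * u := by exact_mod_cast hcase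
      linarith
  · have hBm : MeasurableSet {x : Fin 4 → Point d | x 0 ∈ cube 0 (N : ℝ) ∧ (x 1, x 2) ∈ R ∧
        dist (x 3) (x 0) ≤ ρ} :=
      (hc 0 (measurableSet_cube 0 N)).inter ((((hc 1).prodMk (hc 2)) hR).inter
        (measurableSet_le ((hc 3).dist (hc 0)) measurable_const))
    have h := hμ.four_point_le hp hd hC0 (hC p hp) (g := g) i hu huv hvk hkg hT hBm
      (measurableSet_cube 0 N)
      (R₀ := univ) (R₁ := R) (Q := fun x _ => {e | dist e x ≤ ρ})
      (fun x _ => measurableSet_dist_le x ρ)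
      (fun x hx => ⟨hx.1, mem_univ _, hx.2.1, hx.2.2⟩) ENNReal.one_ne_top hθt
      (V := ENNReal.ofReal (d * 4 ^ d * ρ ^ d))
      ENNReal.ofReal_ne_top (fun t _ x => by simpa using hp.lintegral_posKernel_le _ x) (fun t ht x => by
        refine le_trans (le_of_eq (lintegral_congr fun y => ?_)) (hθ t ht x)
        by_cases hxy : (x, y) ∈ R <;> simp [hxy])
      (fun x _ => lengthMeasure_ball_le x hρ)
    refine le_trans (measure_mono ?_) (h.trans ?_)
    · rintro l ⟨hl1, hl2, hl3, hl4⟩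
      refine ⟨hl1, mem_cube_of_mem_loopsInBox hl2 _, hl4, ?_⟩
      change dist (l.pos (((i + k : ℕ) : ℝ) / g)) (l.pos (((i + 0 : ℕ) : ℝ) / g)) ≤ ρ
      rw [add_zero, dist_comm]
      exact hl3
    · have h5 := hfinal ((k : ℝ) - v) (by
        have : 8 * (u : ℝ) ≤ 3 * k := by exact_mod_cast (by omega : 8 * u ≤ 3 * k)
        linarith)
      rwa [mul_right_comm _ θ 1] at h5

/-- The tail of the transition probabilities, as an integral of the kernel. -/
theorem exists_lintegral_tail_bound (d M : ℕ) : ∃ C : ℝ, 1 ≤ C ∧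
    ∀ p : ℝ → Point d → Point d → ℝ, IsHeatKernel d p → ∀ t > 0, ∀ (x : Point d), ∀ lam > 0,
      ∫⁻ y, {q : Point d × Point d | lam ≤ dist q.1 q.2}.indicator
        (fun q => posKernel p t q.1 q.2) (x, y) ∂(lengthMeasure d) ≤
          ENNReal.ofReal (C * (t / lam ^ 2) ^ M) := by
  obtain ⟨C, hC1, hC⟩ := exists_tail_bound d M
  refine ⟨C, hC1, fun p hp t ht x lam hlam => ?_⟩
  have hfin := hp.isFiniteMeasure_transition ht x
  have h1 := hC p hp t ht x lam hlam
  rw [measureReal_def] at h1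
  have h2 : transition p t x {y | lam ≤ dist x y} ≤ ENNReal.ofReal (C * (t / lam ^ 2) ^ M) :=
    (ENNReal.le_ofReal_iff_toReal_le (measure_ne_top _ _) (by positivity)).2 h1
  refine le_trans (le_of_eq ?_) h2
  rw [transition, withDensity_apply _ (measurableSet_le_dist x lam),
    ← lintegral_indicator (measurableSet_le_dist x lam)]
  refine lintegral_congr fun y => ?_
  by_cases hy : lam ≤ dist x y <;> simp [hy, posKernel, ht]

/-! ### Oscillation of arcs -/

/-- Chaining: a path of large diameter has a large dyadic increment at some level. The point `1/2` is
the anchor, so that the increments at both ends of the interval are not needed. -/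
theorem exists_large_dyadic_increment {X : Type*} [PseudoMetricSpace X] {f : ℝ → X}
    (hf : Continuous f) {Λ : ℝ} (hΛ : 0 < Λ) (hdiam : Λ < Metric.diam (f '' Icc 0 1)) :
    ∃ m j : ℕ, 1 ≤ j ∧ j + 2 ≤ 2 ^ (m + 2) ∧ (1 / 8 : ℝ) * (3 / 4) ^ m * Λ ≤
      dist (f ((j : ℝ) / 2 ^ (m + 2))) (f (((j + 1 : ℕ) : ℝ) / 2 ^ (m + 2))) := by
  by_contra! hcon
  -- at level `m`, the interior dyadic points are at a bounded distance from the anchor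
  have hlev : ∀ m j : ℕ, 1 ≤ j → j + 1 ≤ 2 ^ (m + 1) →
      dist (f ((j : ℝ) / 2 ^ (m + 1))) (f (1 / 2)) ≤
        ∑ i ∈ Finset.range m, (1 / 8 : ℝ) * (3 / 4) ^ i * Λ := by
    intro m
    induction m with
    | zero =>
      intro j hj1 hj2
      have : j = 1 := by omega
      subst this
      simp
    | succ m ih =>
      intro j hj1 hj2
      change j + 1 ≤ 2 ^ (m + 2) at hj2
      change dist (f ((j : ℝ) / 2 ^ (m + 2))) (f (1 / 2)) ≤ _
      rw [Finset.sum_range_succ]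
      have h2 : (2 : ℕ) ^ (m + 2) = 2 * 2 ^ (m + 1) := by ring
      have hhalf : ∀ a : ℕ, ((2 * a : ℕ) : ℝ) / 2 ^ (m + 2) = (a : ℝ) / 2 ^ (m + 1) := fun a => by
        push_cast
        field_simp
        ring
      have hc : 0 ≤ (1 / 8 : ℝ) * (3 / 4) ^ m * Λ := by positivity
      obtain ⟨a, ha | ha⟩ : ∃ a, j = 2 * a ∨ j = 2 * a + 1 := ⟨j / 2, by omega⟩
      · have h3 := ih a (by omega) (by omega)
        rw [ha, hhalf]
        linarith
      · rcases Nat.eq_zero_or_pos a with rfl | ha0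
        · have h3 := ih 1 le_rfl (by rw [pow_succ]; have := Nat.one_le_two_pow (n := m); omega)
          have h4 := hcon m 1 le_rfl (by rw [pow_add]; have := Nat.one_le_two_pow (n := m); omega)
          have h5 := hhalf 1
          rw [ha]
          simp only [mul_zero, zero_add, mul_one, Nat.cast_one, Nat.reduceAdd] at h3 h4 h5 ⊢
          rw [h5] at h4
          exact (dist_triangle _ (f (1 / 2 ^ (m + 1))) _).trans (by linarith)
        · have h3 := ih a ha0 (by omega)
          have h4 := hcon m (2 * a) (by omega) (by omega)
          rw [hhalf, dist_comm, ← ha] at h4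
          exact (dist_triangle _ (f ((a : ℝ) / 2 ^ (m + 1))) _).trans (by linarith)
  have hsum : ∀ m : ℕ, ∑ i ∈ Finset.range m, (1 / 8 : ℝ) * (3 / 4) ^ i * Λ ≤ Λ / 2 := fun m => by
    rw [← Finset.sum_mul, ← Finset.mul_sum]
    have h1 : ∑ i ∈ Finset.range m, (3 / 4 : ℝ) ^ i ≤ 4 := by
      have := (summable_geometric_of_lt_one (by norm_num : (0 : ℝ) ≤ 3 / 4)
        (by norm_num)).sum_le_tsum (Finset.range m) fun i _ => by positivity
      rw [tsum_geometric_of_lt_one (by norm_num) (by norm_num)] at this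
      norm_num at this ⊢
      exact this
    nlinarith
  have hall : ∀ t ∈ Icc (0 : ℝ) 1, dist (f t) (f (1 / 2)) ≤ Λ / 2 := by
    intro t ht
    -- a dyadic approximation of `t` at each level, which avoids the end points of the interval
    set c : ℕ → ℕ := fun m => ⌊t * (2 ^ (m + 1) - 2)⌋₊ + 1 with hc
    have hpow : ∀ m : ℕ, (2 : ℝ) ≤ 2 ^ (m + 1) := fun m => by
      rw [pow_succ]
      have : (1 : ℝ) ≤ 2 ^ m := one_le_pow₀ (by norm_num)
      linarith
    have hpos : ∀ m : ℕ, 0 ≤ t * (2 ^ (m + 1) - 2) := fun m =>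
      mul_nonneg ht.1 (by linarith [hpow m])
    have hcle : ∀ m, c m + 1 ≤ 2 ^ (m + 1) := fun m => by
      have h1 := Nat.floor_le (hpos m)
      have h2 : t * (2 ^ (m + 1) - 2) ≤ 2 ^ (m + 1) - 2 :=
        mul_le_of_le_one_left (by linarith [hpow m]) ht.2
      have h3 : ((c m + 1 : ℕ) : ℝ) ≤ ((2 ^ (m + 1) : ℕ) : ℝ) := by
        simp only [hc]
        push_cast
        linarith
      exact_mod_cast h3
    have hlim : Tendsto (fun m => (c m : ℝ) / 2 ^ (m + 1)) atTop (𝓝 t) := by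
      have h0 : Tendsto (fun m : ℕ => 3 * (1 / 2 : ℝ) ^ (m + 1)) atTop (𝓝 (3 * 0)) :=
        ((tendsto_pow_atTop_nhds_zero_of_lt_one (by norm_num) (by norm_num)).comp
          (tendsto_add_atTop_nat 1)).const_mul 3
      rw [mul_zero] at h0
      refine tendsto_iff_dist_tendsto_zero.2 (squeeze_zero (fun _ => dist_nonneg) (fun m => ?_) h0)
      have h1 := Nat.floor_le (hpos m)
      have h2 := Nat.lt_floor_add_one (t * (2 ^ (m + 1) - 2))
      have hp := pow_pos (two_pos (α := ℝ)) (m + 1)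
      rw [Real.dist_eq, div_sub' hp.ne', abs_div, abs_of_pos hp, one_div, inv_pow,
        ← div_eq_mul_inv]
      gcongr
      simp only [hc]
      push_cast
      rw [abs_le]
      constructor <;> nlinarith [ht.1, ht.2]
    refine le_of_tendsto ((hf.tendsto t).comp hlim |>.dist tendsto_const_nhds)
      (Eventually.of_forall fun m => ?_)
    exact (hlev m (c m) (by simp [hc]) (hcle m)).trans (hsum m)
  refine absurd hdiam (not_lt.2 (Metric.diam_le_of_forall_dist_le hΛ.le ?_))
  rintro _ ⟨s, hs, rfl⟩ _ ⟨t, ht, rfl⟩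
  have h1 := hall s hs
  have h2 := hall t ht
  rw [dist_comm] at h2
  exact (dist_triangle _ _ _).trans (by linarith)

/-- The loops in the box, with duration in `[T, 2T)`, which come back within distance `ρ` after `k` of
`n` steps of time, counted from the step `i`. -/
def nearLoops (d : ℕ) (T : ℝ) (N n i k : ℕ) (ρ : ℝ) : Set (Loop d) :=
  {l | l ∈ loopsOfDuration d T ∧ l ∈ loopsInBox d N ∧
    dist (l.pos ((i : ℝ) / n)) (l.pos (((i + k : ℕ) : ℝ) / n)) ≤ ρ}

/-- The order of magnitude of the measure of `nearLoops`. -/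
def nearWeight (d : ℕ) (T : ℝ) (N n k : ℕ) (ρ : ℝ) : ℝ :=
  (N : ℝ) ^ d * ρ ^ d * ((√((k : ℝ) / n * T))⁻¹ ^ d * (√(((n : ℝ) - k) / n * T))⁻¹ ^ d)

/-- The measure of the loops which nearly close up after `k` of `n` steps, and oscillate by `Λ` during
the first `w ≤ k` of these steps. -/
theorem exists_osc_bound {d : ℕ} (hd : 1 ≤ d) {M : ℕ} (hM : 8 ≤ M) : ∃ K : ℝ, 1 ≤ K ∧
    ∀ (p : ℝ → Point d → Point d → ℝ) (μ : Measure (Loop d)), IsHeatKernel d p →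
      HasLoopMarginals p μ → ∀ T > 0, ∀ N : ℕ, 1 ≤ N → ∀ ρ : ℝ, 1 ≤ ρ →
      ∀ n i w k : ℕ, 1 ≤ w → w ≤ k → k < n → ∀ Λ > 0,
      μ {l | l ∈ nearLoops d T N n i k ρ ∧
          Λ < Metric.diam (l.pos '' Icc ((i : ℝ) / n) (((i + w : ℕ) : ℝ) / n))} ≤
        ENNReal.ofReal (K * nearWeight d T N n k ρ * min 1 ((w : ℝ) / n * T / Λ ^ 2) ^ M) := by
  obtain ⟨K, hK1, hK⟩ := exists_near_bound hd
  obtain ⟨C, hC1, hC⟩ := exists_lintegral_tail_bound d M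
  refine ⟨K * (C * 32 ^ M * 20), ?_, ?_⟩
  · calc (1 : ℝ) ≤ 1 * (1 * 1 * 20) := by norm_num
      _ ≤ _ := by
        have : (1 : ℝ) ≤ 32 ^ M := one_le_pow₀ (by norm_num)
        gcongr
  intro p μ hp hμ T hT N hN ρ hρ n i w k hw hwk hkn Λ hΛ
  have hn0 : (0 : ℝ) < n := by exact_mod_cast (by omega : 0 < n)
  have hkn' : (k : ℝ) < n := by exact_mod_cast hkn
  have hW0 : 0 ≤ nearWeight d T N n k ρ := by unfold nearWeight; positivity
  have hw0 : (0 : ℝ) < w := by exact_mod_cast hw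
  have h32 : 1 ≤ C * 32 ^ M * 20 := by
    have : (1 : ℝ) ≤ 32 ^ M := one_le_pow₀ (by norm_num)
    calc (1 : ℝ) ≤ 1 * 1 * 20 := by norm_num
      _ ≤ _ := by gcongr
  set x := (w : ℝ) / n * T / Λ ^ 2 with hx
  have hx0 : 0 < x := by positivity
  rcases le_or_gt 1 x with h1 | h1
  · -- without any information on the oscillation
    have h2 := hK p μ hp hμ T hT N hN ρ hρ (4 * n) (4 * i) 1 2 (4 * k) one_pos one_lt_two (by omega)
      (by omega) (by omega) univ 1 MeasurableSet.univ ENNReal.one_ne_top (fun t _ y => by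
        simpa using hp.lintegral_posKernel_le _ y)
    have e1 : ∀ a : ℕ, ((4 * a : ℕ) : ℝ) / ((4 * n : ℕ) : ℝ) = (a : ℝ) / n := fun a => by
      push_cast; field_simp
    have e2 : (((4 * n : ℕ) : ℝ) - ((4 * k : ℕ) : ℝ)) / ((4 * n : ℕ) : ℝ) = ((n : ℝ) - k) / n := by
      push_cast; field_simp
    rw [min_eq_left h1, one_pow, mul_one]
    simp only [← mul_add, e1, e2, mul_one] at h2
    refine (measure_mono ?_).trans (h2.trans (ENNReal.ofReal_le_ofReal ?_))
    · rintro l ⟨⟨q1, q2, q3⟩, -⟩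
      exact ⟨q1, q2, q3, mem_univ _⟩
    · change K * nearWeight d T N n k ρ ≤ _
      have : K * 1 ≤ K * (C * 32 ^ M * 20) := by gcongr
      rw [mul_one] at this
      gcongr
  · rw [min_eq_right h1.le]
    -- the increment `j` at level `m + 2`
    set lam : ℕ → ℝ := fun m => (1 / 8 : ℝ) * (3 / 4) ^ m * Λ with hlam
    have hlam0 : ∀ m, 0 < lam m := fun m => by simp only [hlam]; positivity
    set E : ℕ → ℕ → Set (Loop d) := fun m j => {l | l ∈ loopsOfDuration d T ∧ l ∈ loopsInBox d N ∧
      dist (l.pos (((i * 2 ^ (m + 2) : ℕ) : ℝ) / ((n * 2 ^ (m + 2) : ℕ) : ℝ)))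
        (l.pos (((i * 2 ^ (m + 2) + k * 2 ^ (m + 2) : ℕ) : ℝ) / ((n * 2 ^ (m + 2) : ℕ) : ℝ))) ≤ ρ ∧
      (l.pos (((i * 2 ^ (m + 2) + w * j : ℕ) : ℝ) / ((n * 2 ^ (m + 2) : ℕ) : ℝ)),
        l.pos (((i * 2 ^ (m + 2) + w * (j + 1) : ℕ) : ℝ) / ((n * 2 ^ (m + 2) : ℕ) : ℝ))) ∈
          {q : Point d × Point d | lam m ≤ dist q.1 q.2}} with hE
    -- The increment has duration `w / (n 2 ^ (m + 2))`, so that the tail bound gains a factor `2 ^ (-M m)`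
    -- and loses `(4 / 3) ^ (2 M m)`: the product `(8 / 9) ^ (M m)` beats the number `2 ^ (m + 2)` of
    -- increments when `M` is large.
    have hEle : ∀ m j : ℕ, 1 ≤ j → j + 2 ≤ 2 ^ (m + 2) → μ (E m j) ≤
        ENNReal.ofReal (K * nearWeight d T N n k ρ * (C * 32 ^ M * x ^ M) * ((8 / 9) ^ M) ^ m) := by
      intro m j hj1 hj2
      set P := 2 ^ (m + 2) with hP
      have hP4 : 4 ≤ P := by
        rw [hP, pow_add]; have := Nat.one_le_two_pow (n := m); omega
      have hP0 : (0 : ℝ) < P := by exact_mod_cast (by omega : 0 < P)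
      have hwj : w * (j + 1) + w ≤ k * P := by
        calc w * (j + 1) + w = w * (j + 2) := by ring
          _ ≤ k * P := Nat.mul_le_mul hwk hj2
      have h4w : 4 * w ≤ k * P := by
        rw [mul_comm]; exact Nat.mul_le_mul hwk hP4
      have hθ : ∀ t ∈ Ico T (2 * T), ∀ y, ∫⁻ z, {q : Point d × Point d | lam m ≤ dist q.1 q.2}.indicator
          (fun q => posKernel p ((((w * (j + 1) : ℕ) : ℝ) - ((w * j : ℕ) : ℝ)) / ((n * P : ℕ) : ℝ) * t)
            q.1 q.2) (y, z) ∂(lengthMeasure d) ≤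
            ENNReal.ofReal (C * 32 ^ M * x ^ M * ((8 / 9) ^ M) ^ m) := by
        intro t ht y
        have ht0 : 0 < t := hT.trans_le ht.1
        have e1 : (((w * (j + 1) : ℕ) : ℝ) - ((w * j : ℕ) : ℝ)) / ((n * P : ℕ) : ℝ) =
            (w : ℝ) / (n * P) := by
          push_cast; ring_nf
        rw [e1]
        refine (hC p hp _ (by positivity) y (lam m) (hlam0 m)).trans (ENNReal.ofReal_le_ofReal ?_)
        rw [mul_assoc C, mul_assoc C, ← pow_mul, mul_comm M m, pow_mul, ← mul_pow, ← mul_pow]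
        gcongr
        have e2 : (8 / 9 : ℝ) ^ m = 4 * (1 / P) * ((3 / 4) ^ m)⁻¹ ^ 2 := by
          have hPr : (P : ℝ) = 4 * 2 ^ m := by rw [hP]; push_cast; ring
          rw [hPr, show (8 / 9 : ℝ) = (1 / 2) * ((3 / 4)⁻¹) ^ 2 by norm_num, mul_pow, ← pow_mul,
            mul_comm 2 m, pow_mul, inv_pow, one_div, inv_pow]
          field_simp
        calc (w : ℝ) / (n * P) * t / lam m ^ 2 ≤ (w : ℝ) / (n * P) * (2 * T) / lam m ^ 2 := by
              gcongr
              exact ht.2.le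
          _ = 32 * x * (8 / 9) ^ m := by
              rw [e2, hx]
              simp only [hlam]
              field_simp
              ring
      have h2 := hK p μ hp hμ T hT N hN ρ hρ (n * P) (i * P) (w * j) (w * (j + 1)) (k * P)
        (by positivity) (by nlinarith) (by omega) (by nlinarith) (by nlinarith)
        {q | lam m ≤ dist q.1 q.2} _
        (measurableSet_le measurable_const (measurable_fst.dist measurable_snd))
        ENNReal.ofReal_ne_top hθ
      have e3 : ((k * P : ℕ) : ℝ) / ((n * P : ℕ) : ℝ) = (k : ℝ) / n := by
        push_cast; field_simp
      have e4 : (((n * P : ℕ) : ℝ) - ((k * P : ℕ) : ℝ)) / ((n * P : ℕ) : ℝ) = ((n : ℝ) - k) / n := by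
        push_cast; field_simp
      rw [e3, e4, ← ENNReal.ofReal_mul (by positivity)] at h2
      refine h2.trans (le_of_eq ?_)
      congr 1
      simp only [nearWeight]
      ring
    have hsub : {l | l ∈ nearLoops d T N n i k ρ ∧
          Λ < Metric.diam (l.pos '' Icc ((i : ℝ) / n) (((i + w : ℕ) : ℝ) / n))} ⊆
        ⋃ m : ℕ, ⋃ j ∈ (Finset.range (2 ^ (m + 2))).filter (fun j => 1 ≤ j ∧ j + 2 ≤ 2 ^ (m + 2)),
          E m j := by
      rintro l ⟨⟨q1, q2, q3⟩, q4⟩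
      set f : ℝ → Point d := fun s => l.pos (((i : ℝ) + w * s) / n) with hf
      have hfc : Continuous f := by
        have := l.continuous_pos
        simp only [hf]
        fun_prop
      have him : l.pos '' Icc ((i : ℝ) / n) (((i + w : ℕ) : ℝ) / n) ⊆ f '' Icc 0 1 := by
        rintro _ ⟨s, hs, rfl⟩
        have hs1 := hs.1
        have hs2 := hs.2
        rw [div_le_iff₀ hn0] at hs1
        rw [le_div_iff₀ hn0] at hs2
        push_cast at hs2
        refine ⟨(s * n - i) / w, ⟨div_nonneg (by linarith) hw0.le,
          (div_le_one hw0).2 (by linarith)⟩, ?_⟩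
        simp only [hf]
        congr 1
        field_simp
        ring
      have hbdd : Bornology.IsBounded (f '' Icc 0 1) := (isCompact_Icc.image hfc).isBounded
      obtain ⟨m, j, hj1, hj2, hj3⟩ := exists_large_dyadic_increment hfc hΛ
        (q4.trans_le (Metric.diam_mono him hbdd))
      refine mem_iUnion.2 ⟨m, mem_biUnion (x := j) ?_ ?_⟩
      · simp only [Finset.coe_filter, Finset.mem_range, mem_ofPred_eq]
        omega
      · have e5 : ∀ a : ℕ, ((i * 2 ^ (m + 2) + a * 2 ^ (m + 2) : ℕ) : ℝ) /
            ((n * 2 ^ (m + 2) : ℕ) : ℝ) = ((i + a : ℕ) : ℝ) / n := fun a => by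
          push_cast; field_simp
        have e6 : ∀ a : ℕ, f ((a : ℝ) / 2 ^ (m + 2)) =
            l.pos (((i * 2 ^ (m + 2) + w * a : ℕ) : ℝ) / ((n * 2 ^ (m + 2) : ℕ) : ℝ)) := fun a => by
          simp only [hf]
          congr 1
          push_cast
          field_simp
        refine ⟨q1, q2, ?_, ?_⟩
        · have e7 := e5 0
          simp only [zero_mul, add_zero] at e7
          rw [e7, e5 k]
          exact q3
        · change lam m ≤ dist _ _
          rw [← e6, ← e6]
          exact hj3
    have hrate : (2 : ℝ) * (8 / 9) ^ M ≤ 4 / 5 := by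
      have h1 : (8 / 9 : ℝ) ^ M ≤ (8 / 9) ^ 8 := pow_le_pow_of_le_one (by norm_num) (by norm_num) hM
      have h2 : (8 / 9 : ℝ) ^ 8 ≤ 2 / 5 := by norm_num
      linarith
    set B := K * nearWeight d T N n k ρ * (C * 32 ^ M * x ^ M) with hB
    have hB0 : 0 ≤ B := by positivity
    calc _ ≤ μ (⋃ m : ℕ, ⋃ j ∈ (Finset.range (2 ^ (m + 2))).filter
          (fun j => 1 ≤ j ∧ j + 2 ≤ 2 ^ (m + 2)), E m j) := measure_mono hsub
      _ ≤ ∑' m : ℕ, μ (⋃ j ∈ (Finset.range (2 ^ (m + 2))).filter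
          (fun j => 1 ≤ j ∧ j + 2 ≤ 2 ^ (m + 2)), E m j) := measure_iUnion_le _
      _ ≤ ∑' m : ℕ, ENNReal.ofReal (4 * B * (4 / 5) ^ m) := by
          refine ENNReal.tsum_le_tsum fun m => ?_
          refine (measure_biUnion_finset_le _ _).trans ?_
          calc _ ≤ ∑ _j ∈ ((Finset.range (2 ^ (m + 2))).filter
              fun j => 1 ≤ j ∧ j + 2 ≤ 2 ^ (m + 2)), ENNReal.ofReal (B * ((8 / 9) ^ M) ^ m) := by
                refine Finset.sum_le_sum fun j hj => ?_
                obtain ⟨-, hj1, hj2⟩ := Finset.mem_filter.1 hj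
                exact hEle m j hj1 hj2
            _ ≤ ∑ _j ∈ Finset.range (2 ^ (m + 2)), ENNReal.ofReal (B * ((8 / 9) ^ M) ^ m) :=
                Finset.sum_le_sum_of_subset (Finset.filter_subset _ _)
            _ = ENNReal.ofReal ((2 ^ (m + 2) : ℕ) * (B * ((8 / 9) ^ M) ^ m)) := by
                rw [Finset.sum_const, Finset.card_range, nsmul_eq_mul,
                  ENNReal.ofReal_mul (p := ((2 ^ (m + 2) : ℕ) : ℝ)) (by positivity),
                  ENNReal.ofReal_natCast]
            _ ≤ _ := by
                refine ENNReal.ofReal_le_ofReal ?_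
                have e8 : ((2 ^ (m + 2) : ℕ) : ℝ) * (B * ((8 / 9) ^ M) ^ m) =
                    4 * B * (2 * (8 / 9) ^ M) ^ m := by
                  rw [mul_pow]; push_cast; ring
                rw [e8]
                gcongr
      _ = ENNReal.ofReal (∑' m : ℕ, 4 * B * (4 / 5 : ℝ) ^ m) :=
          (ENNReal.ofReal_tsum_of_nonneg (fun m => by positivity)
            ((summable_geometric_of_lt_one (by norm_num) (by norm_num)).mul_left _)).symm
      _ = _ := by
          rw [tsum_mul_left, tsum_geometric_of_lt_one (by norm_num) (by norm_num), hB]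
          congr 1
          ring

/-! ### Discretization of pinching loops -/

namespace Loop

variable {d : ℕ} (l : Loop d)

theorem periodic_pos : Function.Periodic l.pos 1 := l.pos_add_one

theorem isBounded_image_pos (a b : ℝ) : Bornology.IsBounded (l.pos '' Icc a b) :=
  (isCompact_Icc.image l.continuous_pos).isBounded

/-- The diameter of the arc of a loop between the steps `i` and `j`, in a grid of `n` steps. -/
def arcDiam (n i j : ℕ) : ℝ := Metric.diam (l.pos '' Icc ((i : ℝ) / n) ((j : ℝ) / n))

theorem arcDiam_add_period {n : ℕ} (hn : 0 < n) (i j : ℕ) :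
    l.arcDiam n (i + n) (j + n) = l.arcDiam n i j := by
  have hn' : (n : ℝ) ≠ 0 := by exact_mod_cast hn.ne'
  have h : ∀ a : ℕ, ((a + n : ℕ) : ℝ) / n = (a : ℝ) / n + 1 := fun a => by
    push_cast; field_simp
  rw [arcDiam, arcDiam, h, h, ← image_add_const_Icc, image_image]
  simp only [l.pos_add_one]

theorem arcDiam_mod {n : ℕ} (hn : 0 < n) {j : ℕ} (hj : j < 2 * n) :
    l.arcDiam n (j % n) (j % n + 1) = l.arcDiam n j (j + 1) := by
  rcases lt_or_ge j n with h | h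
  · rw [Nat.mod_eq_of_lt h]
  · have h2 : j = j % n + n := by
      rw [Nat.mod_eq_sub_mod h, Nat.mod_eq_of_lt (by omega)]
      omega
    conv_rhs => rw [h2, show j % n + n + 1 = (j % n + 1) + n by ring, l.arcDiam_add_period hn]

theorem diam_le_arcDiam {n : ℕ} (hn : 0 < n) {i j : ℕ} {s t : ℝ} (hs : (i : ℝ) ≤ s * n)
    (ht : t * n ≤ j) : Metric.diam (l.pos '' Icc s t) ≤ l.arcDiam n i j := by
  have hn' : (0 : ℝ) < n := by exact_mod_cast hn
  refine Metric.diam_mono (image_mono (Icc_subset_Icc ?_ ?_)) (l.isBounded_image_pos _ _)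
  · rwa [div_le_iff₀ hn']
  · rwa [le_div_iff₀ hn']

theorem arcDiam_le_add {n i j k : ℕ} (hij : i ≤ j) (hjk : j ≤ k) :
    l.arcDiam n i k ≤ l.arcDiam n i j + l.arcDiam n j k := by
  have h1 : (i : ℝ) / n ≤ (j : ℝ) / n := by gcongr
  have h2 : (j : ℝ) / n ≤ (k : ℝ) / n := by gcongr
  rw [arcDiam, arcDiam, arcDiam, ← Icc_union_Icc_eq_Icc h1 h2, image_union]
  exact Metric.diam_union' ⟨l.pos ((j : ℝ) / n), mem_image_of_mem _ ⟨h1, le_rfl⟩,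
    mem_image_of_mem _ ⟨le_rfl, h2⟩⟩

theorem dist_le_arcDiam {n : ℕ} (hn : 0 < n) {i : ℕ} {s : ℝ} (h1 : (i : ℝ) ≤ s * n)
    (h2 : s * n ≤ i + 1) : dist (l.pos ((i : ℝ) / n)) (l.pos s) ≤ l.arcDiam n i (i + 1) := by
  have hn' : (0 : ℝ) < n := by exact_mod_cast hn
  refine Metric.dist_le_diam_of_mem (l.isBounded_image_pos _ _) (mem_image_of_mem _ ⟨le_rfl, ?_⟩)
    (mem_image_of_mem _ ⟨?_, ?_⟩)
  · gcongr; omega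
  · rwa [div_le_iff₀ hn']
  · rw [le_div_iff₀ hn']; exact_mod_cast h2

/-- A pinching, with times counted as fractions of the duration of the loop. -/
theorem IsPinching.exists_fraction {l : Loop d} {R₁ R₂ r : ℝ} (h : l.IsPinching R₁ R₂ r) :
    ∃ s t : ℝ, 0 ≤ s ∧ s < 1 ∧ s ≤ t ∧ t ≤ s + 1 ∧ dist (l.pos s) (l.pos t) < r ∧
      R₁ < Metric.diam (l.pos '' Icc s t) ∧ R₂ < Metric.diam (l.pos '' Icc t (s + 1)) := by
  obtain ⟨i, j, hij, hj, hr, h1, h2⟩ := h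
  have hD := l.duration_pos
  set m := ⌊i / l.duration⌋ with hm
  have hpos : ∀ x : ℝ, l.path x = l.pos (x / l.duration - m) := fun x => by
    rw [(by simpa using l.periodic_pos.sub_int_mul_eq m : l.pos (x / l.duration - m) = _), pos,
      div_mul_cancel₀ _ hD.ne']
  have himg : ∀ a b : ℝ, l.path '' Icc a b ⊆
      l.pos '' Icc (a / l.duration - m) (b / l.duration - m) := by
    rintro a b _ ⟨x, hx, rfl⟩
    rw [hpos]
    refine mem_image_of_mem _ ⟨?_, ?_⟩
    · have := hx.1; gcongr
    · have := hx.2; gcongr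
  have hend : (i + l.duration) / l.duration - m = i / l.duration - m + 1 := by
    field_simp
    ring
  refine ⟨i / l.duration - m, j / l.duration - m, ?_, ?_, ?_, ?_, ?_, ?_, ?_⟩
  · linarith [Int.floor_le (i / l.duration)]
  · linarith [Int.lt_floor_add_one (i / l.duration)]
  · gcongr
  · rw [← hend]; gcongr
  · rwa [← hpos, ← hpos]
  · exact h1.trans_le (Metric.diam_mono (himg i j) (l.isBounded_image_pos _ _))
  · rw [← hend]
    exact h2.trans_le (Metric.diam_mono (himg j _) (l.isBounded_image_pos _ _))

/-- In a grid of `n` steps, either a single step has a large diameter, or a pinching is seen between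
two points of the grid. -/
theorem IsPinching.grid {l : Loop d} {R₁ R₂ r : ℝ} (h : l.IsPinching R₁ R₂ r) (hR : R₂ ≤ R₁)
    (hR₂ : 0 < R₂) {n : ℕ} (hn : 0 < n) :
    (∃ i < n, R₂ / 2 < l.arcDiam n i (i + 1)) ∨
    ∃ i < n, ∃ k, 1 ≤ k ∧ k < n ∧ dist (l.pos ((i : ℝ) / n)) (l.pos (((i + k : ℕ) : ℝ) / n)) ≤
        r + l.arcDiam n i (i + 1) + l.arcDiam n (i + k) (i + k + 1) ∧
      R₁ / 2 < l.arcDiam n i (i + k) ∧ R₂ / 2 < l.arcDiam n (i + k) (i + n) := by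
  obtain ⟨s, t, hs0, hs1, hst, hts, hr, h1, h2⟩ := h.exists_fraction
  have hn' : (0 : ℝ) < n := by exact_mod_cast hn
  set i := ⌊s * n⌋₊ with hi
  set j := ⌊t * n⌋₊ with hj
  have ht0 : 0 ≤ t := hs0.trans hst
  have hi1 : (i : ℝ) ≤ s * n := Nat.floor_le (by positivity)
  have hi2 : s * n ≤ i + 1 := (Nat.lt_floor_add_one _).le
  have hj1 : (j : ℝ) ≤ t * n := Nat.floor_le (by positivity)
  have hj2 : t * n ≤ j + 1 := (Nat.lt_floor_add_one _).le
  have hin : i < n := by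
    have : (i : ℝ) < n := hi1.trans_lt (by nlinarith)
    exact_mod_cast this
  have hij : i ≤ j := Nat.floor_le_floor (by gcongr)
  have hjn : j ≤ i + n := by
    have : j ≤ ⌊s * n + n⌋₊ := Nat.floor_le_floor (by nlinarith)
    rwa [Nat.floor_add_natCast (by positivity)] at this
  obtain ⟨k, hk⟩ := Nat.exists_eq_add_of_le hij
  have a1 : R₁ < l.arcDiam n i (j + 1) :=
    h1.trans_le (l.diam_le_arcDiam hn hi1 (by exact_mod_cast hj2))
  have a2 : R₂ < l.arcDiam n j (i + n + 1) :=
    h2.trans_le (l.diam_le_arcDiam hn hj1 (by push_cast; nlinarith))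
  have dper : l.arcDiam n (i + n) (i + n + 1) = l.arcDiam n i (i + 1) := by
    rw [← l.arcDiam_add_period hn i (i + 1)]; congr 1; ring
  have dmod : j < 2 * n → l.arcDiam n (j % n) (j % n + 1) = l.arcDiam n j (j + 1) :=
    l.arcDiam_mod hn
  by_contra! hcon
  obtain ⟨hc1, hc2⟩ := hcon
  have di := hc1 i hin
  rcases Nat.eq_zero_or_pos k with rfl | hk0
  · rw [add_zero] at hk
    rw [hk] at a1
    linarith
  rcases eq_or_lt_of_le (show k ≤ n by omega) with rfl | hkn
  · rw [hk, dper] at a2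
    linarith
  have dj := hc1 (j % n) (Nat.mod_lt _ hn)
  rw [dmod (by omega)] at dj
  have b1 := l.arcDiam_le_add (n := n) hij (Nat.le_succ j)
  have b2 := l.arcDiam_le_add (n := n) hjn (Nat.le_succ (i + n))
  rw [Nat.succ_eq_add_one] at b1 b2
  have hdist : dist (l.pos ((i : ℝ) / n)) (l.pos ((j : ℝ) / n)) ≤
      r + l.arcDiam n i (i + 1) + l.arcDiam n j (j + 1) := by
    have e1 := l.dist_le_arcDiam hn hi1 hi2
    have e2 := l.dist_le_arcDiam hn hj1 hj2
    rw [dist_comm] at e2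
    have e3 := dist_triangle4 (l.pos ((i : ℝ) / n)) (l.pos s) (l.pos t) (l.pos ((j : ℝ) / n))
    linarith
  rw [hk] at hdist
  have h3 := hc2 i hin k hk0 hkn hdist (by rw [← hk]; linarith)
  rw [← hk] at h3
  linarith

end Loop

theorem nearLoops_symm (d : ℕ) (T : ℝ) (N : ℕ) {n : ℕ} (i : ℕ) {k : ℕ} (hkn : k < n) (ρ : ℝ) :
    nearLoops d T N n (i + k) (n - k) ρ = nearLoops d T N n i k ρ := by
  have hn' : (n : ℝ) ≠ 0 := by exact_mod_cast (by omega : n ≠ 0)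
  ext l
  simp only [nearLoops, mem_ofPred_eq]
  rw [show i + k + (n - k) = i + n by omega, Nat.cast_add i n, add_div, div_self hn',
    l.pos_add_one, dist_comm]

theorem nearWeight_symm (d : ℕ) (T : ℝ) (N : ℕ) {n k : ℕ} (hkn : k < n) (ρ : ℝ) :
    nearWeight d T N n (n - k) ρ = nearWeight d T N n k ρ := by
  rw [nearWeight, nearWeight, Nat.cast_sub hkn.le, sub_sub_cancel]
  ring

/-- Choice of the scale of the steps adjacent to a pinching. -/
theorem exists_scale {r D D' : ℝ} (hr : 0 < r) :
    (r + D + D' ≤ 5 * r) ∨ ∃ m : ℕ, r + D + D' ≤ 5 * (2 ^ m * r) ∧ (2 ^ m * r < D ∨ 2 ^ m * r < D') := by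
  rcases le_or_gt (max D D') r with h | h
  · left
    have := le_max_left D D'
    have := le_max_right D D'
    linarith
  · right
    have h1 : 1 ≤ max D D' / r := (one_le_div hr).2 h.le
    have h2 : ∃ m : ℕ, (2 : ℝ) ^ m < max D D' / r ∧ max D D' / r ≤ 2 ^ (m + 1) := by
      have hex : ∃ m : ℕ, max D D' / r ≤ 2 ^ (m + 1) := by
        obtain ⟨m, hm⟩ := pow_unbounded_of_one_lt (max D D' / r) (one_lt_two (α := ℝ))
        exact ⟨m, hm.le.trans (pow_le_pow_right₀ one_le_two (Nat.le_succ m))⟩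
      classical
      refine ⟨Nat.find hex, ?_, Nat.find_spec hex⟩
      rcases Nat.eq_zero_or_pos (Nat.find hex) with h0 | h0
      · rw [h0, pow_zero]
        exact (one_lt_div hr).2 h
      · have h3 := Nat.find_min hex (m := Nat.find hex - 1) (by omega)
        rw [Nat.sub_add_cancel h0] at h3
        exact not_le.1 h3
    obtain ⟨m, hm1, hm2⟩ := h2
    rw [lt_div_iff₀ hr] at hm1
    rw [div_le_iff₀ hr, pow_succ] at hm2
    refine ⟨m, ?_, lt_max_iff.1 hm1⟩
    have := le_max_left D D'
    have := le_max_right D D'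
    have h4 : r ≤ 2 ^ m * r := le_mul_of_one_le_left hr.le (one_le_pow₀ one_le_two)
    linarith

/-- If a measure is bounded by `B X ^ 3`, `B Y ^ 3` and `B Z ^ 3`, it is bounded by `B X Y Z`. -/
theorem le_ofReal_mul_of_le_cubes {m : ℝ≥0∞} {B X Y Z : ℝ} (hB : 0 ≤ B) (hX : 0 ≤ X) (hY : 0 ≤ Y)
    (hZ : 0 ≤ Z) (h1 : m ≤ ENNReal.ofReal (B * X ^ 3)) (h2 : m ≤ ENNReal.ofReal (B * Y ^ 3))
    (h3 : m ≤ ENNReal.ofReal (B * Z ^ 3)) : m ≤ ENNReal.ofReal (B * (X * Y * Z)) := by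
  have hcube : ∀ a b c : ℝ, 0 ≤ a → a ≤ b → a ≤ c → a ^ 3 ≤ a * b * c := fun a b c ha hb hc => by
    calc a ^ 3 = a * a * a := by ring
      _ ≤ a * b * c := by
        have hab : 0 ≤ a * b := mul_nonneg ha (ha.trans hb)
        gcongr
  rcases le_total X Y with hXY | hXY
  · rcases le_total X Z with hXZ | hXZ
    · refine h1.trans (ENNReal.ofReal_le_ofReal ?_)
      gcongr
      exact hcube X Y Z hX hXY hXZ
    · refine h3.trans (ENNReal.ofReal_le_ofReal ?_)
      gcongr
      have := hcube Z X Y hZ hXZ (hXZ.trans hXY)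
      linarith
  · rcases le_total Y Z with hYZ | hYZ
    · refine h2.trans (ENNReal.ofReal_le_ofReal ?_)
      gcongr
      have := hcube Y X Z hY hXY hYZ
      linarith
    · refine h3.trans (ENNReal.ofReal_le_ofReal ?_)
      gcongr
      have := hcube Z X Y hZ (hYZ.trans hXY) hYZ
      linarith

/-! ### Sums over the scales -/

/-- The function `y ↦ min y y⁻¹`, small for `y` far from `1`. -/
def ramp (y : ℝ) : ℝ := min y y⁻¹

theorem ramp_nonneg {y : ℝ} (hy : 0 ≤ y) : 0 ≤ ramp y := le_min hy (inv_nonneg.2 hy)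

theorem ramp_le_one (y : ℝ) : ramp y ≤ 1 := by
  rcases le_total y 1 with h | h
  · exact (min_le_left _ _).trans h
  · exact (min_le_right _ _).trans (inv_le_one_of_one_le₀ h)

theorem sum_ramp_sq_le {K : ℝ} (hK : 0 < K) (n : ℕ) :
    ∑ k ∈ Finset.Ico 1 n, ramp (k / K) ^ 2 ≤ 4 * K := by
  -- comparison with a telescoping sum: `ramp (k / K) ^ 2 ≤ 4 K ^ 2 / ((K + k - 1) (K + k))`
  have hterm : ∀ k : ℕ, ramp (((k + 1 : ℕ) : ℝ) / K) ^ 2 ≤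
      4 * K ^ 2 * ((K + k)⁻¹ - (K + (k + 1 : ℕ))⁻¹) := fun k => by
    have hk : (0 : ℝ) ≤ k := k.cast_nonneg
    push_cast
    have h0 : 0 ≤ ((k : ℝ) + 1) / K := by positivity
    have h1 := ramp_nonneg h0
    have h2 : 4 * K ^ 2 * ((K + k)⁻¹ - (K + (k + 1))⁻¹) =
        4 * K ^ 2 / ((K + k) * (K + (k + 1))) := by
      have : K + k ≠ 0 := by positivity
      have : K + (k + 1) ≠ 0 := by positivity
      field_simp
      ring
    rw [h2, le_div_iff₀ (by positivity)]
    rcases le_total ((k : ℝ) + 1) K with h | h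
    · have h3 : ramp (((k : ℝ) + 1) / K) ^ 2 ≤ 1 := pow_le_one₀ h1 (ramp_le_one _)
      calc _ ≤ 1 * ((K + k) * (K + (k + 1))) := by gcongr
        _ ≤ 4 * K ^ 2 := by nlinarith
    · have h3 : ramp (((k : ℝ) + 1) / K) ≤ K / (k + 1) := by
        rw [ramp, inv_div]
        exact min_le_right _ _
      calc _ ≤ (K / (k + 1)) ^ 2 * ((K + k) * (K + (k + 1))) := by gcongr
        _ ≤ (K / (k + 1)) ^ 2 * (4 * (k + 1) ^ 2) :=
            mul_le_mul_of_nonneg_left (by nlinarith) (by positivity)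
        _ = 4 * K ^ 2 := by field_simp
  rw [Finset.sum_Ico_eq_sum_range]
  calc ∑ k ∈ Finset.range (n - 1), ramp (((1 + k : ℕ) : ℝ) / K) ^ 2
      ≤ ∑ k ∈ Finset.range (n - 1), 4 * K ^ 2 * ((K + k)⁻¹ - (K + (k + 1 : ℕ))⁻¹) :=
        Finset.sum_le_sum fun k _ => by rw [add_comm 1 k]; exact hterm k
    _ = 4 * K ^ 2 * ((K + (0 : ℕ))⁻¹ - (K + (n - 1 : ℕ))⁻¹) := by
        rw [← Finset.mul_sum, Finset.sum_range_sub' fun k : ℕ => (K + k)⁻¹]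
    _ ≤ 4 * K ^ 2 * (K⁻¹ - 0) := by
        gcongr
        · simp
        · positivity
    _ = 4 * K := by field_simp; ring

theorem sum_ramp_dyadic_le {K : ℝ} (hK : 0 < K) (n : ℕ) :
    ∑ m ∈ Finset.range n, ramp (2 ^ (m + 1) / K) ≤ 6 := by
  -- comparison with a telescoping sum, by means of `h y = y / (1 + y)`
  have hterm : ∀ y : ℝ, 0 < y → ramp y ≤ 6 * (2 * y / (1 + 2 * y) - y / (1 + y)) := fun y hy => by
    have h2 : 6 * (2 * y / (1 + 2 * y) - y / (1 + y)) = 6 * y / ((1 + 2 * y) * (1 + y)) := by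
      field_simp
      ring
    rw [h2, le_div_iff₀ (by positivity)]
    rcases le_total y 1 with h | h
    · calc _ ≤ y * ((1 + 2 * y) * (1 + y)) := by gcongr; exact min_le_left _ _
        _ ≤ y * 6 := mul_le_mul_of_nonneg_left (by nlinarith) hy.le
        _ = 6 * y := mul_comm _ _
    · calc _ ≤ y⁻¹ * ((1 + 2 * y) * (1 + y)) := by gcongr; exact min_le_right _ _
        _ ≤ y⁻¹ * (6 * y ^ 2) := mul_le_mul_of_nonneg_left (by nlinarith) (by positivity)
        _ = 6 * y := by field_simp
  set h : ℕ → ℝ := fun m => (2 ^ (m + 1) / K) / (1 + 2 ^ (m + 1) / K) with hh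
  have h0 : ∀ m, 0 ≤ h m := fun m => by positivity
  have h1 : ∀ m, h m ≤ 1 := fun m => by
    rw [hh, div_le_one (by positivity)]
    linarith
  calc ∑ m ∈ Finset.range n, ramp (2 ^ (m + 1) / K)
      ≤ ∑ m ∈ Finset.range n, 6 * (h (m + 1) - h m) := Finset.sum_le_sum fun m _ => by
        have := hterm (2 ^ (m + 1) / K) (by positivity)
        rwa [show 2 * (2 ^ (m + 1) / K) = 2 ^ (m + 1 + 1) / K by ring] at this
    _ = 6 * (h n - h 0) := by rw [← Finset.mul_sum, Finset.sum_range_sub]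
    _ ≤ 6 := by linarith [h1 n, h0 0]

/-- If `n / 2 ≤ k ≤ n`, then `n ψ(k / K) ≤ 4 K ramp (n / K)`, where `ψ = ramp ^ 2`. -/
theorem mul_ramp_sq_le {K : ℝ} (hK : 0 < K) {n k : ℝ} (hk : 0 < k) (hnk : n ≤ 2 * k) (hkn : k ≤ n) :
    n * ramp (k / K) ^ 2 ≤ 4 * K * ramp (n / K) := by
  have hn : 0 < n := hk.trans_le hkn
  have h0 : 0 ≤ k / K := by positivity
  have h1 := ramp_nonneg h0
  have h4 : n * ramp (k / K) ^ 2 ≤ 4 * K * (n / K) := by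
    have h3 : ramp (k / K) ^ 2 ≤ 1 := pow_le_one₀ h1 (ramp_le_one _)
    calc _ ≤ n * 1 := by gcongr
      _ ≤ 4 * n := by linarith
      _ = 4 * K * (n / K) := by field_simp
  have h5 : n * ramp (k / K) ^ 2 ≤ 4 * K * (n / K)⁻¹ := by
    have h3 : ramp (k / K) ≤ 2 * K / n := by
      calc ramp (k / K) ≤ (k / K)⁻¹ := min_le_right _ _
        _ = 2 * K / (2 * k) := by field_simp
        _ ≤ 2 * K / n := by gcongr
    calc _ ≤ n * (2 * K / n) ^ 2 := by gcongr
      _ = _ := by field_simp; ring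
  rw [show ramp (n / K) = min (n / K) (n / K)⁻¹ from rfl, mul_min_of_nonneg _ _ (by positivity)]
  exact le_min h4 h5

/-- The sum over the ways to divide the `n` steps of a loop between its two arcs. -/
theorem sum_ramp_convolution_le {K₁ K₂ : ℝ} (h₁ : 0 < K₁) (h₂ : 0 < K₂) (n : ℕ) :
    n * ∑ k ∈ Finset.Ico 1 n, ramp (k / K₁) ^ 2 * ramp (((n - k : ℕ) : ℝ) / K₂) ^ 2 ≤
      16 * (K₁ * K₂) * (ramp (n / K₁) + ramp (n / K₂)) := by
  have hn0 : (0 : ℝ) ≤ n := n.cast_nonneg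
  have r1 : 0 ≤ ramp (n / K₁) := ramp_nonneg (by positivity)
  have r2 : 0 ≤ ramp (n / K₂) := ramp_nonneg (by positivity)
  -- One of the two arcs takes at least half of the `n` steps, so that its factor is almost constant and
  -- the other one is summed.
  have hterm : ∀ k ∈ Finset.Ico 1 n,
      n * (ramp (k / K₁) ^ 2 * ramp (((n - k : ℕ) : ℝ) / K₂) ^ 2) ≤
      4 * K₂ * ramp (n / K₂) * ramp (k / K₁) ^ 2 +
        4 * K₁ * ramp (n / K₁) * ramp (((n - k : ℕ) : ℝ) / K₂) ^ 2 := fun k hk => by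
    obtain ⟨hk1, hkn⟩ := Finset.mem_Ico.1 hk
    have c1 : (1 : ℝ) ≤ k := by exact_mod_cast hk1
    have c2 : (k : ℝ) < n := by exact_mod_cast hkn
    rw [Nat.cast_sub hkn.le]
    rcases le_total (n : ℝ) (2 * k) with h | h
    · have := mul_ramp_sq_le h₁ (n := n) (k := k) (by linarith) h c2.le
      have e : 0 ≤ 4 * K₂ * ramp (n / K₂) * ramp (k / K₁) ^ 2 := by positivity
      calc _ = n * ramp (k / K₁) ^ 2 * ramp ((n - k) / K₂) ^ 2 := by ring
        _ ≤ 4 * K₁ * ramp (n / K₁) * ramp ((n - k) / K₂) ^ 2 := by gcongr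
        _ ≤ _ := by linarith
    · have := mul_ramp_sq_le h₂ (n := n) (k := n - k) (by linarith) (by linarith) (by linarith)
      have e : 0 ≤ 4 * K₁ * ramp (n / K₁) * ramp ((n - k) / K₂) ^ 2 := by positivity
      calc _ = n * ramp ((n - k) / K₂) ^ 2 * ramp (k / K₁) ^ 2 := by ring
        _ ≤ 4 * K₂ * ramp (n / K₂) * ramp (k / K₁) ^ 2 := by gcongr
        _ ≤ _ := by linarith
  have hrefl : ∑ k ∈ Finset.Ico 1 n, ramp (((n - k : ℕ) : ℝ) / K₂) ^ 2 =
      ∑ k ∈ Finset.Ico 1 n, ramp (k / K₂) ^ 2 := by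
    refine Finset.sum_nbij' (fun k => n - k) (fun k => n - k) ?_ ?_ ?_ ?_ ?_ <;>
      intro k hk <;> rw [Finset.mem_Ico] at * <;> omega
  rw [Finset.mul_sum]
  refine (Finset.sum_le_sum hterm).trans ?_
  rw [Finset.sum_add_distrib, ← Finset.mul_sum, ← Finset.mul_sum, hrefl]
  have s1 := sum_ramp_sq_le h₁ n
  have s2 := sum_ramp_sq_le h₂ n
  calc _ ≤ 4 * K₂ * ramp (n / K₂) * (4 * K₁) + 4 * K₁ * ramp (n / K₁) * (4 * K₂) := by gcongr
    _ = _ := by ring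

/-- The cost `k ^ (-d/2)` of closing an arc of `k` steps, together with the cost of a diameter
requiring `K` steps, is largest for `k` of order `K`. -/
theorem inv_sqrt_pow_mul_min_pow_le {d : ℕ} (hd : 4 ≤ d) {K k : ℝ} (hK : 0 < K) (hk : 0 < k) :
    (√k)⁻¹ ^ d * (min 1 (k / K)) ^ d ≤ (√K)⁻¹ ^ d * ramp (k / K) ^ 2 := by
  obtain ⟨y, hy, rfl⟩ : ∃ y, 0 < y ∧ k = y * K := ⟨k / K, by positivity, by field_simp⟩
  rw [mul_div_cancel_right₀ _ hK.ne', Real.sqrt_mul hy.le, mul_inv, mul_pow]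
  have hs : 0 < √y := Real.sqrt_pos.2 hy
  have hsq : √y ^ 2 = y := Real.sq_sqrt hy.le
  suffices h : (√y)⁻¹ ^ d * (min 1 y) ^ d ≤ ramp y ^ 2 by
    calc _ = (√K)⁻¹ ^ d * ((√y)⁻¹ ^ d * (min 1 y) ^ d) := by ring
      _ ≤ _ := by gcongr
  rcases le_total y 1 with h | h
  · rw [min_eq_right h, ramp, min_eq_left (h.trans ((one_le_inv₀ hy).2 h)), ← mul_pow]
    have e : (√y)⁻¹ * y = √y := by
      rw [← hsq, Real.sqrt_sq hs.le]
      field_simp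
    rw [e]
    calc √y ^ d ≤ √y ^ 4 := pow_le_pow_of_le_one hs.le (Real.sqrt_le_one.2 h) hd
      _ = y ^ 2 := by rw [← hsq, Real.sqrt_sq hs.le]; ring
  · rw [min_eq_left h, one_pow, mul_one, ramp, min_eq_right ((inv_le_one_of_one_le₀ h).trans h)]
    calc (√y)⁻¹ ^ d ≤ (√y)⁻¹ ^ 4 := pow_le_pow_of_le_one (by positivity)
          (inv_le_one_of_one_le₀ (Real.one_le_sqrt.2 h)) hd
      _ = y⁻¹ ^ 2 := by
        rw [inv_pow, inv_pow, ← hsq, Real.sqrt_sq hs.le]; ring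

/-! ### Pinchings seen on a grid -/

/-- The loops of duration of order `T` staying in the box which have, between the points `i` and
`i + k` of the grid of `n` steps, an approximate pinching. The distance of these two points is
controlled up to the diameters of the adjacent steps. -/
def gridPinches (d : ℕ) (T : ℝ) (N n i k : ℕ) (r R₁ R₂ : ℝ) : Set (Loop d) :=
  {l | l ∈ loopsOfDuration d T ∧ l ∈ loopsInBox d N ∧
    dist (l.pos ((i : ℝ) / n)) (l.pos (((i + k : ℕ) : ℝ) / n)) ≤
        r + l.arcDiam n i (i + 1) + l.arcDiam n (i + k) (i + k + 1) ∧
      R₁ / 2 < l.arcDiam n i (i + k) ∧ R₂ / 2 < l.arcDiam n (i + k) (i + n)}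

theorem nearWeight_le {d : ℕ} (hd : 4 ≤ d) (N : ℕ) {r K₁ K₂ : ℝ} (hr : 0 < r) (h₁ : 0 < K₁)
    (h₂ : 0 < K₂) {n k : ℕ} (hk : 1 ≤ k) (hkn : k < n) :
    nearWeight d (n * r ^ 2 / 2) N n k (5 * r) *
      ((min 1 (k / K₁)) ^ d * (min 1 (((n - k : ℕ) : ℝ) / K₂)) ^ d) ≤
    10 ^ d * ((N : ℝ) ^ d * r⁻¹ ^ d * ((√K₁)⁻¹ ^ d * (√K₂)⁻¹ ^ d)) *
      (ramp (k / K₁) ^ 2 * ramp (((n - k : ℕ) : ℝ) / K₂) ^ 2) := by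
  have hk' : (0 : ℝ) < k := by exact_mod_cast hk
  have hnk' : (0 : ℝ) < (n - k : ℕ) := by exact_mod_cast Nat.sub_pos_of_lt hkn
  have hn' : (0 : ℝ) < n := by exact_mod_cast (by omega : 0 < n)
  have hs : ∀ j : ℝ, 0 < j → (√(j / n * (n * r ^ 2 / 2)))⁻¹ = √2 * r⁻¹ * (√j)⁻¹ := fun j hj => by
    rw [show j / n * (n * r ^ 2 / 2) = j * r ^ 2 / 2 by field_simp, Real.sqrt_div (by positivity),
      Real.sqrt_mul hj.le, Real.sqrt_sq hr.le]
    field_simp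
  have h2 : (√2) ^ d * (√2) ^ d = (2 : ℝ) ^ d := by
    rw [← mul_pow, Real.mul_self_sqrt zero_le_two]
  have e1 := inv_sqrt_pow_mul_min_pow_le hd h₁ hk'
  have e2 := inv_sqrt_pow_mul_min_pow_le hd h₂ hnk'
  rw [nearWeight, ← Nat.cast_sub hkn.le, hs _ hk', hs _ hnk']
  have hrr : r ^ d * r⁻¹ ^ d = 1 := by rw [← mul_pow, mul_inv_cancel₀ hr.ne', one_pow]
  calc _ = (5 ^ d * ((√2) ^ d * (√2) ^ d)) * ((N : ℝ) ^ d * r⁻¹ ^ d * (r ^ d * r⁻¹ ^ d)) *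
        (((√k)⁻¹ ^ d * (min 1 (k / K₁)) ^ d) *
          ((√((n - k : ℕ) : ℝ))⁻¹ ^ d * (min 1 (((n - k : ℕ) : ℝ) / K₂)) ^ d)) := by
        simp only [mul_pow]; ring
    _ = 10 ^ d * ((N : ℝ) ^ d * r⁻¹ ^ d) *
        (((√k)⁻¹ ^ d * (min 1 (k / K₁)) ^ d) *
          ((√((n - k : ℕ) : ℝ))⁻¹ ^ d * (min 1 (((n - k : ℕ) : ℝ) / K₂)) ^ d)) := by
        rw [h2, ← mul_pow, hrr]; norm_num
    _ ≤ 10 ^ d * ((N : ℝ) ^ d * r⁻¹ ^ d) * (((√K₁)⁻¹ ^ d * ramp (k / K₁) ^ 2) *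
          ((√K₂)⁻¹ ^ d * ramp (((n - k : ℕ) : ℝ) / K₂) ^ 2)) := by gcongr
    _ = _ := by ring

theorem nearWeight_mul (d : ℕ) (T : ℝ) (N n k : ℕ) (x ρ : ℝ) :
    nearWeight d T N n k (x * ρ) = x ^ d * nearWeight d T N n k ρ := by
  rw [nearWeight, nearWeight, mul_pow]; ring

theorem nearWeight_nonneg (d : ℕ) (T : ℝ) (N : ℕ) {n k : ℕ} {ρ : ℝ} (hρ : 0 ≤ ρ) :
    0 ≤ nearWeight d T N n k ρ := by
  rw [nearWeight]; positivity

/-- The measure of the pinchings seen on a grid of `n` steps of duration `r ^ 2 / 2`. The quotients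
`R ^ 2 / (2 r ^ 2)` are the numbers of steps in which an arc typically reaches the diameter `R / 2`, and the
factors `ramp` the cost of a different number of steps. -/
theorem exists_gridPinches_bound {d : ℕ} (hd : 4 ≤ d) :
    ∃ K : ℝ, 1 ≤ K ∧ ∀ (p : ℝ → Point d → Point d → ℝ) (μ : Measure (Loop d)),
      IsHeatKernel d p → HasLoopMarginals p μ → ∀ N : ℕ, 1 ≤ N → ∀ r : ℝ, 1 ≤ r →
      ∀ R₁ > 0, ∀ R₂ > 0, ∀ n i k : ℕ, 1 ≤ k → k < n →
      μ (gridPinches d (n * r ^ 2 / 2) N n i k r R₁ R₂) ≤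
        ENNReal.ofReal (K * ((N : ℝ) ^ d * r⁻¹ ^ d *
          ((√(R₁ ^ 2 / (2 * r ^ 2)))⁻¹ ^ d * (√(R₂ ^ 2 / (2 * r ^ 2)))⁻¹ ^ d)) *
          (ramp (k / (R₁ ^ 2 / (2 * r ^ 2))) ^ 2 *
            ramp (((n - k : ℕ) : ℝ) / (R₂ ^ 2 / (2 * r ^ 2))) ^ 2)) := by
  obtain ⟨K, hK1, hK⟩ := exists_osc_bound (d := d) (by omega) (M := d * 3) (by omega)
  refine ⟨5 * K * 10 ^ d, ?_, ?_⟩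
  · have : (1 : ℝ) ≤ 10 ^ d := one_le_pow₀ (by norm_num)
    nlinarith
  intro p μ hp hμ N hN r hr R₁ hR₁ R₂ hR₂ n i k hk hkn
  have hr0 : 0 < r := by linarith
  have hn' : (0 : ℝ) < n := by exact_mod_cast (by omega : 0 < n)
  have hk' : (0 : ℝ) < k := by exact_mod_cast hk
  have hnk' : (0 : ℝ) < (n - k : ℕ) := by exact_mod_cast Nat.sub_pos_of_lt hkn
  have hmain := nearWeight_le hd N hr0 (K₁ := R₁ ^ 2 / (2 * r ^ 2)) (K₂ := R₂ ^ 2 / (2 * r ^ 2))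
    (by positivity) (by positivity) hk hkn
  -- Each step has the duration `r ^ 2 / 2`. The condition on the first arc gives the factor `Y ^ 3`, the
  -- one on the second arc `Z ^ 3`, and a step of diameter `2 ^ m r` gives `(1 / 4) ^ (3 m d)`.
  set T : ℝ := n * r ^ 2 / 2 with hT
  have hT0 : 0 < T := by positivity
  set K₁ := R₁ ^ 2 / (2 * r ^ 2) with hK₁
  set K₂ := R₂ ^ 2 / (2 * r ^ 2) with hK₂
  have hK₁0 : 0 < K₁ := by positivity
  have hK₂0 : 0 < K₂ := by positivity
  set Y := (min 1 (k / K₁)) ^ d with hY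
  set Z := (min 1 (((n - k : ℕ) : ℝ) / K₂)) ^ d with hZ
  set W := nearWeight d T N n k (5 * r) with hW
  have hY0 : 0 ≤ Y := by positivity
  have hZ0 : 0 ≤ Z := by positivity
  have hW0 : 0 ≤ W := nearWeight_nonneg _ _ _ (by positivity)
  have hwk : ∀ (j : ℕ) (R : ℝ), 0 < R → (j : ℝ) / n * T / (R / 2) ^ 2 = j / (R ^ 2 / (2 * r ^ 2)) :=
    fun j R hR => by
      rw [hT]; field_simp
  have bY : ∀ ρ ≥ 1, μ {l | l ∈ nearLoops d T N n i k ρ ∧ R₁ / 2 < l.arcDiam n i (i + k)} ≤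
      ENNReal.ofReal (K * nearWeight d T N n k ρ * Y ^ 3) := fun ρ hρ => by
    have h := hK p μ hp hμ T hT0 N hN ρ hρ n i k k hk le_rfl hkn (R₁ / 2) (by positivity)
    rwa [hwk k R₁ hR₁, pow_mul] at h
  have bZ : ∀ ρ ≥ 1, μ {l | l ∈ nearLoops d T N n i k ρ ∧ R₂ / 2 < l.arcDiam n (i + k) (i + n)} ≤
      ENNReal.ofReal (K * nearWeight d T N n k ρ * Z ^ 3) := fun ρ hρ => by
    have h := hK p μ hp hμ T hT0 N hN ρ hρ n (i + k) (n - k) (n - k) (by omega) le_rfl (by omega)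
      (R₂ / 2) (by positivity)
    rwa [hwk _ R₂ hR₂, pow_mul, nearLoops_symm d T N i hkn, nearWeight_symm d T N hkn,
      show i + k + (n - k) = i + n by omega] at h
  have hx : ∀ m : ℕ, (min 1 (((1 : ℕ) : ℝ) / n * T / (2 ^ m * r) ^ 2)) ^ (d * 3) ≤
      ((1 / 4 : ℝ) ^ (m * d)) ^ 3 := fun m => by
    rw [pow_mul, pow_mul]
    gcongr
    refine (min_le_right _ _).trans ?_
    have e : ((1 : ℕ) : ℝ) / n * T / (2 ^ m * r) ^ 2 = (1 / 4 : ℝ) ^ m * (1 / 2) := by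
      rw [hT, mul_pow, ← pow_mul, mul_comm m 2, pow_mul, one_div_pow]
      norm_num
      field_simp
    rw [e]
    exact mul_le_of_le_one_right (by positivity) (by norm_num)
  have hρ : ∀ m : ℕ, (1 : ℝ) ≤ 5 * (2 ^ m * r) := fun m => by
    have : 1 ≤ (2 : ℝ) ^ m := one_le_pow₀ one_le_two
    nlinarith
  have hKW : ∀ m : ℕ, 0 ≤ K * nearWeight d T N n k (5 * (2 ^ m * r)) := fun m =>
    mul_nonneg (by linarith) (nearWeight_nonneg _ _ _ (by positivity))
  have bX : ∀ m : ℕ, μ {l | l ∈ nearLoops d T N n i k (5 * (2 ^ m * r)) ∧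
      2 ^ m * r < l.arcDiam n i (i + 1)} ≤
      ENNReal.ofReal (K * nearWeight d T N n k (5 * (2 ^ m * r)) * ((1 / 4 : ℝ) ^ (m * d)) ^ 3) :=
    fun m => by
      refine (hK p μ hp hμ T hT0 N hN _ (hρ m) n i 1 k le_rfl hk hkn (2 ^ m * r)
        (by positivity)).trans (ENNReal.ofReal_le_ofReal ?_)
      exact mul_le_mul_of_nonneg_left (hx m) (hKW m)
  have bX' : ∀ m : ℕ, μ {l | l ∈ nearLoops d T N n i k (5 * (2 ^ m * r)) ∧
      2 ^ m * r < l.arcDiam n (i + k) (i + k + 1)} ≤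
      ENNReal.ofReal (K * nearWeight d T N n k (5 * (2 ^ m * r)) * ((1 / 4 : ℝ) ^ (m * d)) ^ 3) :=
    fun m => by
      have h := hK p μ hp hμ T hT0 N hN _ (hρ m) n (i + k) 1 (n - k) le_rfl (by omega) (by omega)
        (2 ^ m * r) (by positivity)
      rw [nearLoops_symm d T N i hkn, nearWeight_symm d T N hkn] at h
      refine h.trans (ENNReal.ofReal_le_ofReal ?_)
      exact mul_le_mul_of_nonneg_left (hx m) (hKW m)
  -- `E ρ` is the event that the pinching is seen at distance `ρ`, with no condition on the steps.
  set E : ℝ → Set (Loop d) := fun ρ => {l | l ∈ nearLoops d T N n i k ρ ∧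
    R₁ / 2 < l.arcDiam n i (i + k) ∧ R₂ / 2 < l.arcDiam n (i + k) (i + n)} with hE
  have hsub : gridPinches d T N n i k r R₁ R₂ ⊆ E (5 * r) ∪
      ⋃ m : ℕ, ((E (5 * (2 ^ m * r)) ∩ {l | 2 ^ m * r < l.arcDiam n i (i + 1)}) ∪
        (E (5 * (2 ^ m * r)) ∩ {l | 2 ^ m * r < l.arcDiam n (i + k) (i + k + 1)})) := by
    rintro l ⟨h1, h2, h3, h4, h5⟩
    rcases exists_scale (D := l.arcDiam n i (i + 1)) (D' := l.arcDiam n (i + k) (i + k + 1)) hr0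
      with h | ⟨m, hm, hm'⟩
    · exact Or.inl ⟨⟨h1, h2, h3.trans h⟩, h4, h5⟩
    · refine Or.inr (mem_iUnion.2 ⟨m, ?_⟩)
      have h0 : l ∈ E (5 * (2 ^ m * r)) := ⟨⟨h1, h2, h3.trans hm⟩, h4, h5⟩
      exact hm'.imp (fun h => ⟨h0, h⟩) (fun h => ⟨h0, h⟩)
  have hE0 : μ (E (5 * r)) ≤ ENNReal.ofReal (K * W * (Y * Z)) := by
    have h5 : (1 : ℝ) ≤ 5 * r := by linarith
    rw [← one_mul Y]
    refine le_ofReal_mul_of_le_cubes (mul_nonneg (by linarith) hW0) zero_le_one hY0 hZ0 ?_ ?_ ?_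
    · refine le_trans ((bY _ h5).trans' (measure_mono fun l hl => ⟨hl.1, hl.2.1⟩))
        (ENNReal.ofReal_le_ofReal (mul_le_mul_of_nonneg_left ?_ (mul_nonneg (by linarith) hW0)))
      rw [one_pow]
      exact pow_le_one₀ hY0 (pow_le_one₀ (by positivity) (min_le_left _ _))
    · exact (bY _ h5).trans' (measure_mono fun l hl => ⟨hl.1, hl.2.1⟩)
    · exact (bZ _ h5).trans' (measure_mono fun l hl => ⟨hl.1, hl.2.2⟩)
  have hgeo : ∀ m : ℕ, K * nearWeight d T N n k (5 * (2 ^ m * r)) *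
      ((1 / 4 : ℝ) ^ (m * d) * Y * Z) ≤ K * W * (Y * Z) * (1 / 2) ^ m := fun m => by
    rw [show 5 * (2 ^ m * r) = 2 ^ m * (5 * r) by ring, nearWeight_mul, ← hW]
    have e : ((2 : ℝ) ^ m) ^ d * (1 / 4 : ℝ) ^ (m * d) ≤ (1 / 2) ^ m := by
      rw [← pow_mul, ← mul_pow]
      norm_num
      exact pow_le_pow_of_le_one (by norm_num) (by norm_num) (Nat.le_mul_of_pos_right m (by omega))
    calc _ = K * W * (Y * Z) * (((2 : ℝ) ^ m) ^ d * (1 / 4 : ℝ) ^ (m * d)) := by ring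
      _ ≤ _ := by gcongr
  have hEm : ∀ m : ℕ, μ ((E (5 * (2 ^ m * r)) ∩ {l | 2 ^ m * r < l.arcDiam n i (i + 1)}) ∪
        (E (5 * (2 ^ m * r)) ∩ {l | 2 ^ m * r < l.arcDiam n (i + k) (i + k + 1)})) ≤
      ENNReal.ofReal (2 * (K * W * (Y * Z)) * (1 / 2) ^ m) := fun m => by
    refine (measure_union_le _ _).trans ?_
    rw [mul_assoc, two_mul, ENNReal.ofReal_add (by positivity) (by positivity)]
    gcongr
    · refine le_trans ?_ (ENNReal.ofReal_le_ofReal (hgeo m))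
      refine le_ofReal_mul_of_le_cubes (hKW m) (by positivity) hY0 hZ0 ?_ ?_ ?_
      · exact (bX m).trans' (measure_mono fun l hl => ⟨hl.1.1, hl.2⟩)
      · exact (bY _ (hρ m)).trans' (measure_mono fun l hl => ⟨hl.1.1, hl.1.2.1⟩)
      · exact (bZ _ (hρ m)).trans' (measure_mono fun l hl => ⟨hl.1.1, hl.1.2.2⟩)
    · refine le_trans ?_ (ENNReal.ofReal_le_ofReal (hgeo m))
      refine le_ofReal_mul_of_le_cubes (hKW m) (by positivity) hY0 hZ0 ?_ ?_ ?_
      · exact (bX' m).trans' (measure_mono fun l hl => ⟨hl.1.1, hl.2⟩)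
      · exact (bY _ (hρ m)).trans' (measure_mono fun l hl => ⟨hl.1.1, hl.1.2.1⟩)
      · exact (bZ _ (hρ m)).trans' (measure_mono fun l hl => ⟨hl.1.1, hl.1.2.2⟩)
  have hKWYZ : 0 ≤ K * W * (Y * Z) := by positivity
  calc μ (gridPinches d T N n i k r R₁ R₂)
      ≤ ENNReal.ofReal (K * W * (Y * Z)) +
        ∑' m : ℕ, ENNReal.ofReal (2 * (K * W * (Y * Z)) * (1 / 2) ^ m) := by
        refine (measure_mono hsub).trans ((measure_union_le _ _).trans ?_)
        gcongr
        exact (measure_iUnion_le _).trans (ENNReal.tsum_le_tsum hEm)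
    _ = ENNReal.ofReal (5 * K * (W * (Y * Z))) := by
        rw [← ENNReal.ofReal_tsum_of_nonneg (fun m => by positivity)
          (summable_geometric_two.mul_left _), tsum_mul_left, tsum_geometric_two,
          ← ENNReal.ofReal_add hKWYZ (by positivity)]
        congr 1; ring
    _ ≤ _ := ENNReal.ofReal_le_ofReal ?_
  refine (mul_le_mul_of_nonneg_left hmain (show 0 ≤ 5 * K by linarith)).trans (le_of_eq ?_)
  ring

/-- Summation over the positions and lengths of the arcs, and over the dyadic scales of the duration of
the loop. The sum is of the order of a single term: the two arcs have their typical durations. -/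
theorem exists_sum_gridPinches_bound {d : ℕ} (hd : 4 ≤ d) :
    ∃ C : ℝ, 1 ≤ C ∧ ∀ (p : ℝ → Point d → Point d → ℝ) (μ : Measure (Loop d)),
      IsHeatKernel d p → HasLoopMarginals p μ → ∀ N : ℕ, 1 ≤ N → ∀ r : ℝ, 1 ≤ r →
      ∀ R₁ > 0, ∀ R₂ > 0,
      ∑' m : ℕ, μ (⋃ i ∈ Finset.range (2 ^ (m + 1)), ⋃ k ∈ Finset.Ico 1 (2 ^ (m + 1)),
          gridPinches d (2 ^ m * r ^ 2) N (2 ^ (m + 1)) i k r R₁ R₂) ≤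
        ENNReal.ofReal (C * ((N : ℝ) ^ d * r⁻¹ ^ d *
          ((√(R₁ ^ 2 / (2 * r ^ 2)))⁻¹ ^ d * (√(R₂ ^ 2 / (2 * r ^ 2)))⁻¹ ^ d)) *
          (R₁ ^ 2 / (2 * r ^ 2) * (R₂ ^ 2 / (2 * r ^ 2)))) := by
  obtain ⟨K, hK1, hK⟩ := exists_gridPinches_bound hd
  refine ⟨192 * K, by linarith, fun p μ hp hμ N hN r hr R₁ hR₁ R₂ hR₂ => ?_⟩
  have hr0 : 0 < r := by linarith
  replace hK := hK p μ hp hμ N hN r hr R₁ hR₁ R₂ hR₂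
  set K₁ := R₁ ^ 2 / (2 * r ^ 2) with hK₁
  set K₂ := R₂ ^ 2 / (2 * r ^ 2) with hK₂
  have hK₁0 : 0 < K₁ := by positivity
  have hK₂0 : 0 < K₂ := by positivity
  clear_value K₁ K₂
  set A := K * ((N : ℝ) ^ d * r⁻¹ ^ d * ((√K₁)⁻¹ ^ d * (√K₂)⁻¹ ^ d)) with hA
  have hA0 : 0 ≤ A := by positivity
  have hn : ∀ n : ℕ, μ (⋃ i ∈ Finset.range n, ⋃ k ∈ Finset.Ico 1 n,
      gridPinches d (n * r ^ 2 / 2) N n i k r R₁ R₂) ≤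
      ENNReal.ofReal (A * (16 * (K₁ * K₂) * (ramp (n / K₁) + ramp (n / K₂)))) := fun n => by
    calc _ ≤ ∑ i ∈ Finset.range n, ∑ k ∈ Finset.Ico 1 n,
          μ (gridPinches d (n * r ^ 2 / 2) N n i k r R₁ R₂) :=
          (measure_biUnion_finset_le _ _).trans
            (Finset.sum_le_sum fun i _ => measure_biUnion_finset_le _ _)
      _ ≤ ∑ i ∈ Finset.range n, ∑ k ∈ Finset.Ico 1 n, ENNReal.ofReal (A *
          (ramp (k / K₁) ^ 2 * ramp (((n - k : ℕ) : ℝ) / K₂) ^ 2)) :=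
          Finset.sum_le_sum fun i _ => Finset.sum_le_sum fun k hk =>
            hK n i k (Finset.mem_Ico.1 hk).1 (Finset.mem_Ico.1 hk).2
      _ = ENNReal.ofReal (A * (n * ∑ k ∈ Finset.Ico 1 n,
          ramp (k / K₁) ^ 2 * ramp (((n - k : ℕ) : ℝ) / K₂) ^ 2)) := by
          rw [Finset.sum_const, Finset.card_range, ← ENNReal.ofReal_sum_of_nonneg
            (fun k _ => by positivity), ← Finset.mul_sum, ← ENNReal.ofReal_nsmul]
          congr 1
          rw [nsmul_eq_mul]
          ring
      _ ≤ _ := ENNReal.ofReal_le_ofReal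
          (mul_le_mul_of_nonneg_left (sum_ramp_convolution_le hK₁0 hK₂0 n) hA0)
  refine ENNReal.tsum_le_of_sum_range_le fun j => ?_
  have h0 : ∀ (m : ℕ) {L : ℝ}, 0 < L → 0 ≤ ramp (2 ^ (m + 1) / L) := fun m L hL =>
    ramp_nonneg (by positivity)
  calc _ ≤ ∑ m ∈ Finset.range j, ENNReal.ofReal
        (A * (16 * (K₁ * K₂) * (ramp (2 ^ (m + 1) / K₁) + ramp (2 ^ (m + 1) / K₂)))) :=
        Finset.sum_le_sum fun m _ => by
          have h := hn (2 ^ (m + 1))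
          push_cast at h
          rwa [show (2 : ℝ) ^ (m + 1) * r ^ 2 / 2 = 2 ^ m * r ^ 2 by ring] at h
    _ = ENNReal.ofReal (A * (16 * (K₁ * K₂) * (∑ m ∈ Finset.range j, ramp (2 ^ (m + 1) / K₁) +
          ∑ m ∈ Finset.range j, ramp (2 ^ (m + 1) / K₂)))) := by
        rw [← ENNReal.ofReal_sum_of_nonneg (fun m _ => by
          have := h0 m hK₁0
          have := h0 m hK₂0
          positivity), ← Finset.mul_sum, ← Finset.mul_sum, Finset.sum_add_distrib]
    _ ≤ _ := ENNReal.ofReal_le_ofReal ?_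
  have s1 := sum_ramp_dyadic_le hK₁0 j
  have s2 := sum_ramp_dyadic_le hK₂0 j
  calc _ ≤ A * (16 * (K₁ * K₂) * (6 + 6)) := by gcongr
    _ = _ := by rw [hA]; ring

/-! ### Large steps -/

/-- The loops of duration of order `T` staying in the box, one of whose `n` steps has a diameter of at
least `R / 2`. -/
def bigSteps (d : ℕ) (T : ℝ) (N n : ℕ) (R : ℝ) : Set (Loop d) :=
  {l | l ∈ loopsOfDuration d T ∧ l ∈ loopsInBox d N ∧ ∃ i < n, R / 2 < l.arcDiam n i (i + 1)}

theorem dist_pos_le {d N : ℕ} {l : Loop d} (hl : l ∈ loopsInBox d N) (s t : ℝ) :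
    dist (l.pos s) (l.pos t) ≤ 2 * d * N := by
  rw [Subtype.dist_eq, EuclideanSpace.dist_eq, Real.sqrt_le_left (by positivity)]
  have hco : ∀ i, dist ((l.pos s : EuclideanSpace ℝ (Fin d)) i)
      ((l.pos t : EuclideanSpace ℝ (Fin d)) i) ≤ 2 * N := fun i => by
    rw [Real.dist_eq]
    have h1 := abs_le.1 (hl (s * l.duration) i)
    have h2 := abs_le.1 (hl (t * l.duration) i)
    exact abs_le.2 ⟨by simp only [Loop.pos]; linarith, by simp only [Loop.pos]; linarith⟩
  calc _ ≤ ∑ _i : Fin d, (2 * (N : ℝ)) ^ 2 := Finset.sum_le_sum fun i _ => by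
        have := hco i
        gcongr
    _ = (d : ℝ) * (2 * N) ^ 2 := by simp
    _ ≤ (d : ℝ) ^ 2 * (2 * N) ^ 2 := by
        gcongr
        exact_mod_cast Nat.le_self_pow two_ne_zero d
    _ = _ := by ring

/-- Any loop staying in the box nearly closes up after half of its duration, at the scale of the
box. -/
theorem exists_bigSteps_bound {d : ℕ} (hd : 1 ≤ d) {M : ℕ} (hM : 8 ≤ M) :
    ∃ K : ℝ, 1 ≤ K ∧ ∀ (p : ℝ → Point d → Point d → ℝ) (μ : Measure (Loop d)),
      IsHeatKernel d p → HasLoopMarginals p μ → ∀ N : ℕ, 1 ≤ N → ∀ T > 0, ∀ R > 0,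
      ∀ h : ℕ, 1 ≤ h →
      μ (bigSteps d T N (2 * h) R) ≤
        ENNReal.ofReal (K * (N : ℝ) ^ (2 * d) * (h * T⁻¹ ^ d * (2 * T / (h * R ^ 2)) ^ M)) := by
  obtain ⟨K, hK1, hK⟩ := exists_osc_bound hd hM
  refine ⟨2 * K * (4 * d) ^ d, ?_, fun p μ hp hμ N hN T hT R hR h hh => ?_⟩
  · have : (1 : ℝ) ≤ (4 * d) ^ d := one_le_pow₀ (by
      have : (1 : ℝ) ≤ d := by exact_mod_cast hd
      linarith)
    nlinarith
  have hd' : (1 : ℝ) ≤ d := by exact_mod_cast hd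
  have hN' : (1 : ℝ) ≤ N := by exact_mod_cast hN
  have hh' : (0 : ℝ) < h := by exact_mod_cast hh
  have hρ : (1 : ℝ) ≤ 2 * d * N := by nlinarith [mul_le_mul hd' hN' zero_le_one (by linarith)]
  have hsub : bigSteps d T N (2 * h) R ⊆ ⋃ i ∈ Finset.range (2 * h),
      {l | l ∈ nearLoops d T N (2 * h) i h (2 * d * N) ∧ R / 2 < Metric.diam (l.pos ''
        Icc ((i : ℝ) / (2 * h : ℕ)) (((i + 1 : ℕ) : ℝ) / (2 * h : ℕ)))} := by
    rintro l ⟨h1, h2, i, hi, h3⟩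
    exact mem_biUnion (Finset.mem_coe.2 (Finset.mem_range.2 hi))
      ⟨⟨h1, h2, dist_pos_le h2 _ _⟩, h3⟩
  have hW : nearWeight d T N (2 * h) h (2 * d * N) = (4 * d) ^ d * (N : ℝ) ^ (2 * d) * T⁻¹ ^ d := by
    have e1 : (h : ℝ) / (2 * h : ℕ) * T = T / 2 := by push_cast; field_simp
    have e2 : (((2 * h : ℕ) : ℝ) - h) / (2 * h : ℕ) * T = T / 2 := by push_cast; field_simp; ring
    have e3 : (√(T / 2))⁻¹ ^ d * (√(T / 2))⁻¹ ^ d = (T / 2)⁻¹ ^ d := by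
      rw [← mul_pow, ← mul_inv, Real.mul_self_sqrt (by positivity)]
    rw [nearWeight, e1, e2, e3, ← mul_pow, ← mul_pow, pow_mul, ← mul_pow, ← mul_pow]
    congr 1
    field_simp
    ring
  have hx : min 1 (((1 : ℕ) : ℝ) / (2 * h : ℕ) * T / (R / 2) ^ 2) ≤ 2 * T / (h * R ^ 2) := by
    refine (min_le_right _ _).trans (le_of_eq ?_)
    push_cast
    field_simp
  calc _ ≤ ∑ i ∈ Finset.range (2 * h), ENNReal.ofReal (K * ((4 * d) ^ d * (N : ℝ) ^ (2 * d) *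
        T⁻¹ ^ d) * (2 * T / (h * R ^ 2)) ^ M) := by
        refine (measure_mono hsub).trans ((measure_biUnion_finset_le _ _).trans
          (Finset.sum_le_sum fun i _ => ?_))
        refine (hK p μ hp hμ T hT N hN _ hρ (2 * h) i 1 h le_rfl hh (by omega) (R / 2)
          (by positivity)).trans (ENNReal.ofReal_le_ofReal ?_)
        rw [hW]
        gcongr
    _ = _ := by
        rw [Finset.sum_const, Finset.card_range, ← ENNReal.ofReal_nsmul, nsmul_eq_mul]
        push_cast
        congr 1
        ring

/-- Large steps at all scales of the duration: steps of duration of order `r ^ 2` for the loops of duration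
at least `r ^ 2`, and the two halves of the shorter ones. The contribution is negligible when `R` is much
larger than `r`, since `M` is arbitrary. -/
theorem exists_sum_bigSteps_bound {d : ℕ} (hd : 2 ≤ d) {M : ℕ} (hM : 8 ≤ M) (hdM : d + 1 ≤ M) :
    ∃ C : ℝ, 1 ≤ C ∧ ∀ (p : ℝ → Point d → Point d → ℝ) (μ : Measure (Loop d)),
      IsHeatKernel d p → HasLoopMarginals p μ → ∀ N : ℕ, 1 ≤ N → ∀ r : ℝ, 1 ≤ r → ∀ R > 0,
      ∑' m : ℕ, μ (bigSteps d (2 ^ m * r ^ 2) N (2 ^ (m + 1)) R) +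
        ∑' m : ℕ, μ (bigSteps d (r ^ 2 / 2 ^ (m + 1)) N 2 R) ≤
        ENNReal.ofReal (C * (N : ℝ) ^ (2 * d) * (2 * r ^ 2 / R ^ 2) ^ M) := by
  obtain ⟨K, hK1, hK⟩ := exists_bigSteps_bound (d := d) (by omega) hM
  refine ⟨4 * K, by linarith, fun p μ hp hμ N hN r hr R hR => ?_⟩
  have hr0 : 0 < r := by linarith
  set A := K * (N : ℝ) ^ (2 * d) * (2 * r ^ 2 / R ^ 2) ^ M with hA
  have hA0 : 0 ≤ A := by positivity
  have hrd : (r ^ 2)⁻¹ ^ d ≤ 1 :=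
    pow_le_one₀ (by positivity) (inv_le_one_of_one_le₀ (one_le_pow₀ hr))
  have h1 : ∀ m : ℕ, μ (bigSteps d (2 ^ m * r ^ 2) N (2 ^ (m + 1)) R) ≤
      ENNReal.ofReal (A * (1 / 2) ^ m) := fun m => by
    have h := hK p μ hp hμ N hN (2 ^ m * r ^ 2) (by positivity) R hR (2 ^ m) Nat.one_le_two_pow
    rw [← pow_succ'] at h
    refine h.trans (ENNReal.ofReal_le_ofReal ?_)
    push_cast
    have e : 2 * (2 ^ m * r ^ 2) / (2 ^ m * R ^ 2) = 2 * r ^ 2 / R ^ 2 := by field_simp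
    have e2 : (2 : ℝ) ^ m * (2 ^ m * r ^ 2)⁻¹ ^ d ≤ (1 / 2) ^ m := by
      rw [mul_inv, mul_pow]
      calc (2 : ℝ) ^ m * ((2 ^ m)⁻¹ ^ d * (r ^ 2)⁻¹ ^ d)
          ≤ 2 ^ m * ((2 ^ m)⁻¹ ^ 2 * 1) := by
            have h3 : ((2 : ℝ) ^ m)⁻¹ ^ d ≤ ((2 : ℝ) ^ m)⁻¹ ^ 2 :=
              pow_le_pow_of_le_one (by positivity)
                (inv_le_one_of_one_le₀ (one_le_pow₀ one_le_two)) hd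
            gcongr
        _ = (1 / 2) ^ m := by
            rw [one_div, inv_pow 2 m]
            field_simp
    rw [e]
    calc _ = A * ((2 : ℝ) ^ m * (2 ^ m * r ^ 2)⁻¹ ^ d) := by rw [hA]; ring
      _ ≤ _ := by gcongr
  have h2 : ∀ m : ℕ, μ (bigSteps d (r ^ 2 / 2 ^ (m + 1)) N 2 R) ≤
      ENNReal.ofReal (A * (1 / 2) ^ m) := fun m => by
    have h := hK p μ hp hμ N hN (r ^ 2 / 2 ^ (m + 1)) (by positivity) R hR 1 le_rfl
    refine h.trans (ENNReal.ofReal_le_ofReal ?_)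
    have e : 2 * (r ^ 2 / 2 ^ (m + 1)) / (((1 : ℕ) : ℝ) * R ^ 2) =
        2 * r ^ 2 / R ^ 2 * (2 ^ (m + 1))⁻¹ := by
      push_cast; field_simp
    have hle : ((2 : ℝ) ^ (m + 1))⁻¹ ≤ 1 := inv_le_one_of_one_le₀ (one_le_pow₀ one_le_two)
    have e2 : (r ^ 2 / 2 ^ (m + 1))⁻¹ ^ d * ((2 : ℝ) ^ (m + 1))⁻¹ ^ M ≤ (1 / 2) ^ m := by
      calc (r ^ 2 / 2 ^ (m + 1))⁻¹ ^ d * ((2 : ℝ) ^ (m + 1))⁻¹ ^ M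
          ≤ (r ^ 2 / 2 ^ (m + 1))⁻¹ ^ d * ((2 : ℝ) ^ (m + 1))⁻¹ ^ (d + 1) := by
            gcongr ?_ * ?_
            exact pow_le_pow_of_le_one (by positivity) hle hdM
        _ = (r ^ 2)⁻¹ ^ d * ((2 : ℝ) ^ (m + 1))⁻¹ := by
            have h3 : ((2 : ℝ) ^ (m + 1)) ^ d * ((2 : ℝ) ^ (m + 1))⁻¹ ^ d = 1 := by
              rw [← mul_pow, mul_inv_cancel₀ (by positivity), one_pow]
            rw [inv_div, pow_succ _ d, div_eq_mul_inv, mul_pow]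
            linear_combination (r ^ 2)⁻¹ ^ d * ((2 : ℝ) ^ (m + 1))⁻¹ * h3
        _ ≤ 1 * ((2 : ℝ) ^ m)⁻¹ := by
            gcongr
            · exact one_le_two
            · omega
        _ = _ := by rw [one_mul, one_div, inv_pow]
    rw [e, mul_pow]
    calc _ = A * ((r ^ 2 / 2 ^ (m + 1))⁻¹ ^ d * ((2 : ℝ) ^ (m + 1))⁻¹ ^ M) := by
          rw [hA]; push_cast; ring
      _ ≤ _ := by gcongr
  have hs : ∑' m : ℕ, ENNReal.ofReal (A * (1 / 2) ^ m) = ENNReal.ofReal (A * 2) := by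
    rw [← ENNReal.ofReal_tsum_of_nonneg (fun m => by positivity)
      (summable_geometric_two.mul_left _), tsum_mul_left, tsum_geometric_two]
  calc _ ≤ ENNReal.ofReal (A * 2) + ENNReal.ofReal (A * 2) :=
        add_le_add ((ENNReal.tsum_le_tsum h1).trans hs.le) ((ENNReal.tsum_le_tsum h2).trans hs.le)
    _ = _ := by
        rw [← ENNReal.ofReal_add (by positivity) (by positivity), hA]
        congr 1; ring

/-! ### The measure of the pinching loops -/

/-- Every duration belongs to one of the dyadic scales, at which the loop is looked at on a grid of
steps of duration of order `r ^ 2`, or of two steps if its duration is smaller. -/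
theorem pinching_subset {d N : ℕ} {R₁ R₂ r : ℝ} (hr : 0 < r) (hR₂ : 0 < R₂) (hR : R₂ ≤ R₁) :
    {l : Loop d | l.IsPinching R₁ R₂ r} ∩ loopsInBox d N ⊆
      (⋃ m : ℕ, ⋃ i ∈ Finset.range (2 ^ (m + 1)), ⋃ k ∈ Finset.Ico 1 (2 ^ (m + 1)),
          gridPinches d (2 ^ m * r ^ 2) N (2 ^ (m + 1)) i k r R₁ R₂) ∪
        ((⋃ m : ℕ, bigSteps d (2 ^ m * r ^ 2) N (2 ^ (m + 1)) R₂) ∪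
          ⋃ m : ℕ, bigSteps d (r ^ 2 / 2 ^ (m + 1)) N 2 R₂) := by
  rintro l ⟨hl, hbox⟩
  replace hl : l.IsPinching R₁ R₂ r := hl
  have hr2 : 0 < r ^ 2 := by positivity
  obtain ⟨z, hz1, hz2⟩ := exists_mem_Ico_zpow (x := l.duration / r ^ 2)
    (div_pos l.duration_pos hr2) (one_lt_two (α := ℝ))
  rw [le_div_iff₀ hr2] at hz1
  rw [zpow_add_one₀ two_ne_zero, div_lt_iff₀ hr2] at hz2
  obtain ⟨m, rfl | rfl⟩ : ∃ m : ℕ, z = m ∨ z = -((m + 1 : ℕ) : ℤ) := by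
    rcases le_or_gt 0 z with h | h
    · exact ⟨z.toNat, Or.inl (by omega)⟩
    · exact ⟨(-z - 1).toNat, Or.inr (by omega)⟩
  · rw [zpow_natCast] at hz1 hz2
    have hdur : l ∈ loopsOfDuration d (2 ^ m * r ^ 2) := ⟨hz1, by linarith⟩
    rcases hl.grid hR hR₂ (n := 2 ^ (m + 1)) (by positivity) with h | ⟨i, hi, k, hk, hkn, h⟩
    · exact Or.inr (Or.inl (mem_iUnion.2 ⟨m, hdur, hbox, h⟩))
    · refine Or.inl (mem_iUnion.2 ⟨m, mem_biUnion (Finset.mem_coe.2 (Finset.mem_range.2 hi))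
        (mem_biUnion (Finset.mem_coe.2 (Finset.mem_Ico.2 ⟨hk, hkn⟩)) ⟨hdur, hbox, h⟩)⟩)
  · rw [zpow_neg, zpow_natCast, ← div_eq_inv_mul] at hz1
    rw [zpow_neg, zpow_natCast] at hz2
    have hdur : l ∈ loopsOfDuration d (r ^ 2 / 2 ^ (m + 1)) :=
      ⟨hz1, hz2.trans_eq (by rw [div_eq_mul_inv]; ring)⟩
    refine Or.inr (Or.inr (mem_iUnion.2 ⟨m, hdur, hbox, ?_⟩))
    -- on a grid of two steps, the first arc of a pinching is a single step
    rcases hl.grid hR hR₂ (n := 2) two_pos with h | ⟨i, hi, k, hk, hkn, -, h, -⟩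
    · exact h
    · obtain rfl : k = 1 := by omega
      exact ⟨i, hi, by linarith⟩

theorem inv_sqrt_pow_mul_ratio {x : ℝ} (hx : 0 < x) (a c : ℝ) (d : ℕ) :
    (√((x ^ a) ^ 2 / (2 * (x ^ c) ^ 2)))⁻¹ ^ d * ((x ^ a) ^ 2 / (2 * (x ^ c) ^ 2)) =
      √2 ^ d / 2 * x ^ (-(a - c) * ((d : ℝ) - 2)) := by
  have h0 : 0 < x ^ (a - c) := Real.rpow_pos_of_pos hx _
  have e1 : (x ^ a) ^ 2 / (2 * (x ^ c) ^ 2) = (x ^ (a - c)) ^ 2 / 2 := by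
    have := Real.rpow_pos_of_pos hx c
    rw [Real.rpow_sub hx]
    field_simp
  have e2 : x ^ (-(a - c) * ((d : ℝ) - 2)) = (x ^ (a - c))⁻¹ ^ d * (x ^ (a - c)) ^ 2 := by
    rw [← Real.rpow_neg hx.le, ← Real.rpow_natCast, ← Real.rpow_natCast, ← Real.rpow_mul hx.le,
      ← Real.rpow_mul hx.le, ← Real.rpow_add hx]
    congr 1
    push_cast
    ring
  rw [e1, e2, Real.sqrt_div (by positivity), Real.sqrt_sq h0.le, inv_div, div_eq_mul_inv √2, mul_pow]
  ring

/-- The loop measure of the pinching loops in the box. -/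
theorem exists_pinching_bound {d : ℕ} (hd : 4 ≤ d) {a b c : ℝ} (hc : 0 < c) (hcb : c < b)
    (hba : b ≤ a) :
    ∃ C : ℝ, ∀ (p : ℝ → Point d → Point d → ℝ) (μ : Measure (Loop d)),
      IsHeatKernel d p → HasLoopMarginals p μ → ∀ N : ℕ, 1 ≤ N →
      μ ({l : Loop d | l.IsPinching ((N : ℝ) ^ a) ((N : ℝ) ^ b) ((N : ℝ) ^ c)} ∩ loopsInBox d N) ≤
        ENNReal.ofReal
          (C * (N : ℝ) ^ (-((a + b) * ((d : ℝ) - 2) - ((d : ℝ) + c * ((d : ℝ) - 4))))) := by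
  set ν := (a + b) * ((d : ℝ) - 2) - ((d : ℝ) + c * ((d : ℝ) - 4)) with hν
  -- `N ^ (2 d)` times the `M`-th power of `N ^ (-2 (b - c))` has to be at most `N ^ (-ν)`
  obtain ⟨M, hM⟩ := exists_nat_ge (max ((8 + d : ℕ) : ℝ) ((2 * d + ν) / (2 * (b - c))))
  have hM1 : (8 + d : ℕ) ≤ M := by
    have := (le_max_left _ _).trans hM
    exact_mod_cast this
  have hM2 : 2 * d + ν ≤ M * (2 * (b - c)) :=
    (div_le_iff₀ (by linarith)).1 ((le_max_right _ _).trans hM)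
  obtain ⟨C₁, hC₁, h1⟩ := exists_sum_gridPinches_bound hd
  obtain ⟨C₂, hC₂, h2⟩ := exists_sum_bigSteps_bound (d := d) (by omega) (M := M) (by omega)
    (by omega)
  refine ⟨C₁ * (√2 ^ d / 2) ^ 2 + C₂ * 2 ^ M, fun p μ hp hμ N hN => ?_⟩
  have hN' : (1 : ℝ) ≤ N := by exact_mod_cast hN
  set x := (N : ℝ) with hx
  have hx0 : 0 < x := by linarith
  have hr : 1 ≤ x ^ c := Real.one_le_rpow hN' hc.le
  have hRa : 0 < x ^ a := Real.rpow_pos_of_pos hx0 _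
  have hRb : 0 < x ^ b := Real.rpow_pos_of_pos hx0 _
  replace h1 := h1 p μ hp hμ N hN _ hr _ hRa _ hRb
  replace h2 := h2 p μ hp hμ N hN _ hr _ hRb
  rw [← hx] at h1 h2
  have e1 : C₁ * (x ^ d * (x ^ c)⁻¹ ^ d * ((√((x ^ a) ^ 2 / (2 * (x ^ c) ^ 2)))⁻¹ ^ d *
      (√((x ^ b) ^ 2 / (2 * (x ^ c) ^ 2)))⁻¹ ^ d)) *
      ((x ^ a) ^ 2 / (2 * (x ^ c) ^ 2) * ((x ^ b) ^ 2 / (2 * (x ^ c) ^ 2))) =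
      C₁ * (√2 ^ d / 2) ^ 2 * x ^ (-ν) := by
    have e : x ^ (-ν) = x ^ d * (x ^ c)⁻¹ ^ d * (x ^ (-(a - c) * ((d : ℝ) - 2)) *
        x ^ (-(b - c) * ((d : ℝ) - 2))) := by
      rw [← Real.rpow_neg hx0.le c, ← Real.rpow_natCast, ← Real.rpow_natCast,
        ← Real.rpow_mul hx0.le, ← Real.rpow_add hx0, ← Real.rpow_add hx0, ← Real.rpow_add hx0]
      congr 1
      rw [hν]
      ring
    rw [e]
    have e3 := inv_sqrt_pow_mul_ratio hx0 a c d
    have e4 := inv_sqrt_pow_mul_ratio hx0 b c d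
    calc _ = C₁ * (x ^ d * (x ^ c)⁻¹ ^ d) * (((√((x ^ a) ^ 2 / (2 * (x ^ c) ^ 2)))⁻¹ ^ d *
          ((x ^ a) ^ 2 / (2 * (x ^ c) ^ 2))) * ((√((x ^ b) ^ 2 / (2 * (x ^ c) ^ 2)))⁻¹ ^ d *
          ((x ^ b) ^ 2 / (2 * (x ^ c) ^ 2)))) := by ring
      _ = _ := by rw [e3, e4]; ring
  have e2 : C₂ * x ^ (2 * d) * (2 * (x ^ c) ^ 2 / (x ^ b) ^ 2) ^ M ≤ C₂ * 2 ^ M * x ^ (-ν) := by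
    have e : x ^ (2 * d) * ((x ^ c) ^ 2 / (x ^ b) ^ 2) ^ M = x ^ (2 * d - M * (2 * (b - c))) := by
      rw [← div_pow, ← Real.rpow_sub hx0, ← pow_mul, ← Real.rpow_natCast, ← Real.rpow_natCast,
        ← Real.rpow_mul hx0.le, ← Real.rpow_add hx0]
      congr 1
      push_cast
      ring
    calc _ = C₂ * 2 ^ M * (x ^ (2 * d) * ((x ^ c) ^ 2 / (x ^ b) ^ 2) ^ M) := by
          rw [mul_div_assoc, mul_pow]; ring
      _ ≤ _ := by
          rw [e]
          gcongr
          linarith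
  rw [add_mul, ENNReal.ofReal_add (by positivity) (by positivity), ← e1]
  refine (measure_mono (pinching_subset (by linarith) hRb
    (Real.rpow_le_rpow_of_exponent_le hN' hba))).trans ((measure_union_le _ _).trans ?_)
  refine add_le_add ((measure_iUnion_le _).trans h1) ((measure_union_le _ _).trans ?_)
  exact (add_le_add (measure_iUnion_le _) (measure_iUnion_le _)).trans
    (h2.trans (ENNReal.ofReal_le_ofReal e2))

/-! ### Poisson point processes -/

theorem measurableSet_loopsInBox (d N : ℕ) : MeasurableSet (loopsInBox d N) := by
  have h : loopsInBox d N = ⋂ (q : ℚ) (i : Fin d),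
      {l : Loop d | |(l.path (q : ℝ) : EuclideanSpace ℝ (Fin d)) i| ≤ N} := by
    ext l
    simp only [mem_iInter]
    refine ⟨fun hl q i => hl q i, fun hl t i => ?_⟩
    have hcont : Continuous fun t => |(l.path t : EuclideanSpace ℝ (Fin d)) i| := by
      have := l.continuous_path
      fun_prop
    exact Rat.denseRange_cast.induction_on (p := fun t => |(l.path t : EuclideanSpace ℝ (Fin d)) i| ≤
      N) t (isClosed_le hcont continuous_const) fun q => hl q i
  rw [h]
  refine MeasurableSet.iInter fun q => MeasurableSet.iInter fun i => ?_
  have hm : Measurable fun l : Loop d => |(l.path (q : ℝ) : EuclideanSpace ℝ (Fin d)) i| := by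
    have hc : Continuous fun y : Point d => |(y : EuclideanSpace ℝ (Fin d)) i| := by fun_prop
    exact hc.measurable.comp (measurable_path (q : ℝ))
  exact measurableSet_le hm measurable_const

/-- A Poisson point process charges a set with probability at most the intensity of the set. -/
theorem IsPoissonProcess.measure_le {Ω S : Type*} [MeasurableSpace Ω] [MeasurableSpace S]
    {P : Measure Ω} [IsProbabilityMeasure P] {m : Measure S} {ξ : Ω → Set S}
    (h : IsPoissonProcess P m ξ) (A : Set S) : P {ω | ∃ s ∈ ξ ω, s ∈ A} ≤ m A := by
  rcases eq_or_ne (m A) ∞ with hA | hA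
  · rw [hA]; exact le_top
  set B := toMeasurable m A with hB
  have hBm : MeasurableSet B := measurableSet_toMeasurable m A
  have hmB : m B = m A := measure_toMeasurable A
  have h0 := h.poisson B hBm (by rwa [hmB]) 0
  simp only [Nat.cast_zero, pow_zero, mul_one, Nat.factorial_zero, Nat.cast_one, div_one] at h0
  have hmeas : MeasurableSet {ω | (ξ ω ∩ B).encard = 0} :=
    h.measurable B hBm (measurableSet_singleton 0)
  calc P {ω | ∃ s ∈ ξ ω, s ∈ A} ≤ P {ω | (ξ ω ∩ B).encard = 0}ᶜ := by
        refine measure_mono fun ω hω h2 => ?_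
        obtain ⟨s, hs, hsA⟩ := hω
        have h3 : ξ ω ∩ B = ∅ := encard_eq_zero.1 h2
        exact h3.subset ⟨hs, subset_toMeasurable m A hsA⟩
    _ = 1 - ENNReal.ofReal (Real.exp (-(m B).toReal)) := by rw [prob_compl_eq_one_sub hmeas, h0]
    _ ≤ m A := by
        rw [tsub_le_iff_left, hmB]
        nth_rewrite 2 [← ENNReal.ofReal_toReal hA]
        rw [← ENNReal.ofReal_add (Real.exp_pos _).le ENNReal.toReal_nonneg, ENNReal.one_le_ofReal]
        linarith [Real.add_one_le_exp (-(m A).toReal)]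

end Cable

end

theorem mainTheorem5 (d : ℕ) (hd : 7 ≤ d) (a b c : ℝ)
    (ha : a ∈ Set.Ioo (0 : ℝ) 1) (hb : b ∈ Set.Ioo (0 : ℝ) 1) (hc : c ∈ Set.Ioo (0 : ℝ) 1)
    (hcb : c < b) (hba : b ≤ a) (ν : ℝ)
    (hν : ν = (a + b) * ((d : ℝ) - 2) - ((d : ℝ) + c * ((d : ℝ) - 4))) (hν_pos : 0 < ν) :
    ∃ C : ℝ, ∀ N : ℕ, 1 ≤ N →
      ∀ (Ω : Type*) [MeasurableSpace Ω] (P : MeasureTheory.Measure Ω)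
        [MeasureTheory.IsProbabilityMeasure P] (ξ : Ω → Set (Cable.Loop d)),
        Cable.IsLoopSoup d N P ξ →
          P (Cable.pinchingEvent ξ N a b c) ≤ ENNReal.ofReal (C * (N : ℝ) ^ (-ν)) := by
  obtain ⟨C, hC⟩ := Cable.exists_pinching_bound (d := d) (by omega) hc.1 hcb hba
  refine ⟨C, fun N hN Ω _ P _ ξ hξ => ?_⟩
  obtain ⟨μ, ⟨p, hp, hμ⟩, hpoisson⟩ := hξ
  refine (hpoisson.measure_le {l | l.IsPinching ((N : ℝ) ^ a) ((N : ℝ) ^ b) ((N : ℝ) ^ c)}).trans ?_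
  rw [Measure.smul_apply, Measure.restrict_apply' (Cable.measurableSet_loopsInBox d N), smul_eq_mul,
    hν]
  calc _ ≤ 1 * μ ({l | l.IsPinching ((N : ℝ) ^ a) ((N : ℝ) ^ b) ((N : ℝ) ^ c)} ∩
        Cable.loopsInBox d N) := by
        gcongr
        simp
    _ ≤ _ := by rw [one_mul]; exact hC p μ hp hμ N hN
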